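/- Let $\Sigma$ be a compact smooth manifold of dimension $3$, let $\tau>1$, and let $h$ be a Riemannian metric on $\Sigma$ whose components $h_{ij}$ in every smooth chart are locally of class $C^\tau$ (Hölder class if $\tau\notin\mathbb N$, Zygmund class $C^\tau_*$ if $\tau\in\mathbb N$). Let $M=\mathbb R\times\Sigma$ carry the ultrastatic metric $g=dt^2-h_{ij}(x)\,dx^i dx^j$, let $m>0$, and let $$P\phi=\partial_t^2\phi-\frac1{\sqrt h}\,\partial_{x^i}\bigl(h^{ij}\sqrt h\,\partial_{x^j}\phi\bigr)+m^2\phi ,\qquad \sqrt h=\sqrt{\det (h_{ij})},$$ be its Klein-Gordon operator. Denote by $P_{(t,x)}$ the operator $P$ acting on the first set of variables of distributions on $M\times M$, with local coordinates $z=(t,x,s,y)$ and covariables $\zeta=(\xi^0,\xi,\eta^0,\eta)$; in these coordinates it is the operator with symbol $$p(z,\zeta)=-(\xi^0)^2+h^{ij}(x)\xi_i\xi_j-\frac{i}{\sqrt h}\,\partial_{x^i}(h^{ij}\sqrt h)(x)\,\xi_j+m^2 .$$ Let $\mathrm{Char}(P_{(t,x)})\subset T^*(M\times M)\setminus 0$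 be the complement of the set of points $(z_0,\zeta_0)$, $\zeta_0\ne0$, that have an open conic neighbourhood on which $|p(z,\zeta)|\ge c|\zeta|^2$ for $|\zeta|\ge C$, with some constants $c,C>0$. For $r\in\mathbb R$ let $H^r_{loc}(M\times M)$ be the space of distributions $v$ such that, in local coordinates, $\int_{\mathbb R^8}\langle\zeta\rangle^{2r}|\mathcal F(\varphi v)(\zeta)|^2\,d\zeta<\infty$ for all smooth compactly supported $\varphi$, where $\langle\zeta\rangle=(1+|\zeta|^2)^{1/2}$, and let $WF^r(v)\subset T^*(M\times M)\setminus0$ be the complement of the set of points $(z_0,\zeta_0)$, $\zeta_0\neq 0$, for which there are a smooth compactly supported $\varphi$ with $\varphi(z_0)\ne0$ and an open conic neighbourhood $\Gamma$ of $\zeta_0$ with $\int_{\Gamma}\langle\zeta\rangle^{2r}|\mathcal F(\varphi v)(\zeta)|^2\,d\zeta<\infty$. Let $0\le\sigma<\tau-1$, and let $v\in H^{2+\sigma-\tau+\varepsilon}_{loc}(M\times M)$, for some $\varepsilon>0$, satisfy $P_{(t,x)}v=0$. Then $$WF^{\sigma+2}(v)\subset\mathrm{Char}(P_{(t,x)}).$$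 -/

import Mathlib

open Set Filter Topology MeasureTheory TopologicalSpace
open scoped Manifold ContDiff Distributions

noncomputable section

namespace KleinGordon

/-! ### Coordinates -/

/-- The model space `ℝ³` of the spatial manifold. -/
abbrev E3 : Type := EuclideanSpace ℝ (Fin 3)

/-- The coordinate space `ℝ⁸ = ℝ⁴ × ℝ⁴` of `M × M`, where `M = ℝ × S`. The index `Sum.inl 0` is the
time variable `t` and `Sum.inl 1, 2, 3` are the space variables `x` of the first factor;
`Sum.inr 0` is `s` and `Sum.inr 1, 2, 3` are the variables `y` of the second factor. -/
abbrev E8 : Type := EuclideanSpace ℝ (Fin 4 ⊕ Fin 4)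

/-- The space variables `x` of a point `(t, x, s, y)` of `ℝ⁸`. -/
def space1 (z : E8) : E3 := WithLp.toLp 2 fun i => z (Sum.inl i.succ)

/-- The space variables `y` of a point `(t, x, s, y)` of `ℝ⁸`. -/
def space2 (z : E8) : E3 := WithLp.toLp 2 fun i => z (Sum.inr i.succ)

/-- The point `(t, x, s, y)` of `ℝ⁸`. -/
def mk8 (t : ℝ) (x : E3) (s : ℝ) (y : E3) : E8 :=
  WithLp.toLp 2 (Sum.elim (Fin.cons t fun i => x i) (Fin.cons s fun i => y i))

theorem continuous_space1 : Continuous space1 := by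
  unfold space1; fun_prop

theorem continuous_space2 : Continuous space2 := by
  unfold space2; fun_prop

/-- The plane wave `x ↦ e^{i⟨x, ξ⟩}`. -/
def planeWave {ι : Type*} [Fintype ι] (ξ x : EuclideanSpace ℝ ι) : ℂ :=
  Complex.exp (Complex.I * ((inner ℝ x ξ : ℝ) : ℂ))

theorem contDiff_planeWave {ι : Type*} [Fintype ι] (ξ : EuclideanSpace ℝ ι) :
    ContDiff ℝ ∞ (planeWave ξ) := by
  unfold planeWave
  refine ContDiff.cexp (contDiff_const.mul ?_)
  exact Complex.ofRealCLM.contDiff.comp (contDiff_id.inner ℝ contDiff_const)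

/-- The product of a test function with a smooth function. -/
def smulTest {ι : Type*} [Fintype ι] {Ω : Opens (EuclideanSpace ℝ ι)}
    (a : EuclideanSpace ℝ ι → ℂ) (ha : ContDiff ℝ ∞ a) (φ : 𝓓(Ω, ℂ)) : 𝓓(Ω, ℂ) where
  toFun x := a x * φ x
  contDiff' := ha.mul φ.contDiff
  hasCompactSupport' := φ.hasCompactSupport.mul_left
  tsupport_subset' := (tsupport_mul_subset_right (f := a) (g := φ)).trans φ.tsupport_subset

/-! ### Hölder and Zygmund regularity on `ℝ³` -/

/-- The Hölder space `C^τ(ℝ³)`: all derivatives of order `≤ [τ]` are bounded, and those of order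
`[τ]` are globally Hölder continuous with exponent `τ - [τ]`. -/
def IsHolder (τ : ℝ) (f : E3 → ℝ) : Prop :=
  ContDiff ℝ (⌊τ⌋₊ : ℕ) f ∧
  (∀ k : ℕ, k ≤ ⌊τ⌋₊ → ∃ C : ℝ, ∀ x, ‖iteratedFDeriv ℝ k f x‖ ≤ C) ∧
  ∃ C : ℝ, ∀ x y, ‖iteratedFDeriv ℝ ⌊τ⌋₊ f x - iteratedFDeriv ℝ ⌊τ⌋₊ f y‖ ≤
    C * ‖x - y‖ ^ (τ - ⌊τ⌋₊)

/-- The function `ψ₀` that generates a Littlewood-Paley partition of unity. -/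
def IsLittlewoodPaley (ψ₀ : E3 → ℝ) : Prop :=
  ContDiff ℝ ∞ ψ₀ ∧ (∀ ξ, ‖ξ‖ ≤ 1 → ψ₀ ξ = 1) ∧ (∀ ξ, 2 ≤ ‖ξ‖ → ψ₀ ξ = 0)

/-- The Littlewood-Paley partition of unity `ψ₀, ψ₁, …` with
`ψ_j(ξ) = ψ₀(2^{-j} ξ) - ψ₀(2^{1-j} ξ)` for `j ≥ 1`. -/
def littlewoodPaley (ψ₀ : E3 → ℝ) : ℕ → E3 → ℝ
  | 0, ξ => ψ₀ ξ
  | j + 1, ξ => ψ₀ (((2 : ℝ) ^ (j + 1))⁻¹ • ξ) - ψ₀ (((2 : ℝ) ^ j)⁻¹ • ξ)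

/-- The Fourier multiplier `ψ(D) f = 𝓕⁻¹ ψ 𝓕 f` for an integrable `f` on `ℝ³` and a bounded
`ψ` of compact support. -/
def multiplier (ψ f : E3 → ℝ) (x : E3) : ℂ :=
  ((2 * Real.pi) ^ (-3 : ℤ) : ℝ) *
    ∫ ξ : E3, planeWave ξ x * ψ ξ * ∫ y : E3, planeWave (-ξ) y * f y

/-- The Zygmund space `C^τ_*(ℝ³)`, for continuous functions of compact support:
`sup_j 2^{jτ} ‖ψ_j(D) f‖_∞ < ∞`. The choice of `ψ₀` is immaterial. -/
def IsZygmund (τ : ℝ) (f : E3 → ℝ) : Prop :=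
  ∃ ψ₀ : E3 → ℝ, IsLittlewoodPaley ψ₀ ∧
    ∃ C : ℝ, ∀ (j : ℕ) (x : E3),
      (2 : ℝ) ^ ((j : ℝ) * τ) * ‖multiplier (littlewoodPaley ψ₀ j) f x‖ ≤ C

/-- Regularity `C^τ` with the convention that the Zygmund space is used for integer `τ`. -/
def IsClass (τ : ℝ) (f : E3 → ℝ) : Prop :=
  ((∃ n : ℕ, (n : ℝ) = τ) → IsZygmund τ f) ∧ ((¬ ∃ n : ℕ, (n : ℝ) = τ) → IsHolder τ f)

/-- Local regularity `C^τ` on an open set `U`: each localisation `χ f`, with `χ` smooth and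
compactly supported in `U`, is of class `C^τ` on `ℝ³`. -/
def IsClassLoc (τ : ℝ) (U : Set E3) (f : E3 → ℝ) : Prop :=
  ∀ χ : E3 → ℝ, ContDiff ℝ ∞ χ → HasCompactSupport χ → tsupport χ ⊆ U →
    IsClass τ fun x => χ x * f x

/-! ### The spatial manifold, its metric and the Klein-Gordon operator -/

section Manifold

variable (S : Type*) [TopologicalSpace S] [ChartedSpace E3 S]

/-- The charts of the maximal smooth atlas of `S`. -/
def Chart : Type _ := {e : OpenPartialHomeomorph S E3 // e ∈ IsManifold.maximalAtlas 𝓘(ℝ, E3) ∞ S}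

variable [IsManifold 𝓘(ℝ, E3) ∞ S]

/-- Continuous Riemannian metrics on `S`. -/
abbrev Metric : Type _ :=
  Bundle.ContinuousRiemannianMetric E3 (fun x : S => TangentSpace 𝓘(ℝ, E3) x)

variable {S}

/-- The coordinate vector `∂/∂xⁱ` of the chart `e` at the point with coordinates `u`. -/
def coordVector (e : Chart S) (u : E3) (i : Fin 3) : TangentSpace 𝓘(ℝ, E3) (e.1.symm u) :=
  mfderiv 𝓘(ℝ, E3) 𝓘(ℝ, E3) e.1.symm u (EuclideanSpace.single i (1 : ℝ) : E3)

/-- The matrix `(h_{ij})` of the metric in the chart `e`. -/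
def metricMatrix (h : Metric S) (e : Chart S) (u : E3) : Matrix (Fin 3) (Fin 3) ℝ :=
  Matrix.of fun i j => h.inner (e.1.symm u) (coordVector e u i) (coordVector e u j)

/-- The metric is of class `C^τ`: so are its components in all charts. -/
def Metric.HasClass (τ : ℝ) (h : Metric S) : Prop :=
  ∀ (e : Chart S) (i j : Fin 3), IsClassLoc τ e.1.target fun u => metricMatrix h e u i j

/-- The component `h^{ij}` of the inverse metric. -/
def invMetric (h : Metric S) (e : Chart S) (u : E3) (i j : Fin 3) : ℝ := (metricMatrix h e u)⁻¹ i j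

/-- The density `√h = √(det h_{ij})`. -/
def volDensity (h : Metric S) (e : Chart S) (u : E3) : ℝ := √(metricMatrix h e u).det

/-- The coefficient `(1/√h) ∑ᵢ ∂ᵢ(h^{ij} √h)` of `∂_j` in the Laplace-Beltrami operator. -/
def firstOrderCoeff (h : Metric S) (e : Chart S) (u : E3) (j : Fin 3) : ℝ :=
  (volDensity h e u)⁻¹ * ∑ i : Fin 3,
    fderiv ℝ (fun w => invMetric h e w i j * volDensity h e w) u (EuclideanSpace.single i (1 : ℝ))

/-- The full symbol of the Klein-Gordon operator
`∂_t² - (1/√h) ∂_i (h^{ij} √h ∂_j) + m²`, acting on the first variables `(t, x)`, in the chart `e`.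
It is a function of `z = (t, x, s, y)` and `ζ = (ξ⁰, ξ, η⁰, η)`, and `∂_j` has the symbol `i ξ_j`. -/
def symbol (h : Metric S) (m : ℝ) (e : Chart S) (z ζ : E8) : ℂ :=
  ((-(ζ (Sum.inl 0)) ^ 2 +
      ∑ i : Fin 3, ∑ j : Fin 3, invMetric h e (space1 z) i j * space1 ζ i * space1 ζ j : ℝ) : ℂ)
    - Complex.I * ((∑ j : Fin 3, firstOrderCoeff h e (space1 z) j * space1 ζ j : ℝ) : ℂ)
    + ((m ^ 2 : ℝ) : ℂ)

/-! ### Distributions on `M × M`, for `M = ℝ × S` -/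

/-- The range of the product chart `(t, p, s, q) ↦ (t, e₁ p, s, e₂ q)` of `M × M`. -/
def chartDomain (e₁ e₂ : Chart S) : Opens E8 where
  carrier := {z | space1 z ∈ e₁.1.target ∧ space2 z ∈ e₂.1.target}
  is_open' := (e₁.1.open_target.preimage continuous_space1).inter
    (e₂.1.open_target.preimage continuous_space2)

/-- The part of the range of the product chart of `(e₁, e₂)` that corresponds to points which also
lie in the domain of the product chart of `(e₁', e₂')`. -/
def overlap (e₁ e₂ e₁' e₂' : Chart S) : Set E8 :=
  {z | z ∈ chartDomain e₁ e₂ ∧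
    e₁.1.symm (space1 z) ∈ e₁'.1.source ∧ e₂.1.symm (space2 z) ∈ e₂'.1.source}

/-- The change of coordinates from the product chart of `(e₁, e₂)` to that of `(e₁', e₂')`. -/
def transition (e₁ e₂ e₁' e₂' : Chart S) (z : E8) : E8 :=
  mk8 (z (Sum.inl 0)) (e₁'.1 (e₁.1.symm (space1 z)))
    (z (Sum.inr 0)) (e₂'.1 (e₂.1.symm (space2 z)))

variable (S) in
/-- A (complex-valued) distribution `v ∈ 𝓓'(M × M)`, `M = ℝ × S`: a distribution in the range of
each product chart, such that these local representatives transform like functions under the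
changes of coordinates. -/
structure BiDistribution where
  /-- The representative in the product chart of `(e₁, e₂)`. -/
  loc (e₁ e₂ : Chart S) : 𝓓(chartDomain e₁ e₂, ℂ) →L[ℂ] ℂ
  /-- If `θ` is the change of coordinates and `g = |det Dθ| (f ∘ θ)`, then the representatives
  take the same value on `g` and on `f`. -/
  compat (e₁ e₂ e₁' e₂' : Chart S) (f : 𝓓(chartDomain e₁ e₂, ℂ)) (g : 𝓓(chartDomain e₁' e₂', ℂ)) :
    tsupport f ⊆ overlap e₁ e₂ e₁' e₂' → tsupport g ⊆ overlap e₁' e₂' e₁ e₂ →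
    (∀ z ∈ overlap e₁' e₂' e₁ e₂,
      g z = |(fderiv ℝ (transition e₁' e₂' e₁ e₂) z).det| * f (transition e₁' e₂' e₁ e₂ z)) →
    loc e₁' e₂' g = loc e₁ e₂ f

/-- The Fourier transform `𝓕(φ u)(ξ) = (2π)^{-4} u(φ e^{-i⟨·, ξ⟩})` of the compactly supported
distribution `φ u` on `ℝ⁸`, where `u` is a distribution on `Ω` and `φ` a test function on `Ω`. -/
def fourierLoc {Ω : Opens E8} (u : 𝓓(Ω, ℂ) →L[ℂ] ℂ) (φ : 𝓓(Ω, ℂ)) (ξ : E8) : ℂ :=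
  ((2 * Real.pi) ^ (-4 : ℤ) : ℝ) * u (smulTest (planeWave (-ξ)) (contDiff_planeWave (-ξ)) φ)

/-- The integrand `⟨ξ⟩^{2r} |𝓕(φ u)(ξ)|²` of the square of the Sobolev norm of order `r`. -/
def sobolevDensity {Ω : Opens E8} (r : ℝ) (u : 𝓓(Ω, ℂ) →L[ℂ] ℂ) (φ : 𝓓(Ω, ℂ)) (ξ : E8) : ℝ :=
  (1 + ‖ξ‖ ^ 2) ^ r * ‖fourierLoc u φ ξ‖ ^ 2

/-- `v ∈ H^r_loc(M × M)`. -/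
def BiDistribution.IsSobolevLoc (r : ℝ) (v : BiDistribution S) : Prop :=
  ∀ (e₁ e₂ : Chart S) (φ : 𝓓(chartDomain e₁ e₂, ℂ)),
    Integrable (sobolevDensity r (v.loc e₁ e₂) φ)

/-- `P_{(t,x)}(z, D) v = 0` on `M × M`. In each product chart the distribution `p(z, D) v`, for the
symbol `p`, is given by
`⟨p(z, D) v, φ⟩ = (2π)^{-4} ∫ 𝓕(χ v)(ζ) (∫ e^{i⟨z, ζ⟩} p(z, ζ) φ(z) dz) dζ`
where `χ` is any cut-off function equal to `1` near the support of `φ`. This is the pairing of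
`p(z, D)(χ v)(z) = (2π)^{-4} ∫ e^{i⟨z, ζ⟩} p(z, ζ) 𝓕(χ v)(ζ) dζ` with `φ`, and the way to read it
for distributions `v` and coefficients of finite regularity. -/
def BiDistribution.SolvesKleinGordon (h : Metric S) (m : ℝ) (v : BiDistribution S) : Prop :=
  ∀ (e₁ e₂ : Chart S) (φ χ : 𝓓(chartDomain e₁ e₂, ℂ)),
    (∀ᶠ z in 𝓝ˢ (tsupport φ), χ z = 1) →
    ((2 * Real.pi) ^ (-4 : ℤ) : ℝ) *
      (∫ ζ : E8, fourierLoc (v.loc e₁ e₂) χ ζ *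
        ∫ z : E8, planeWave ζ z * symbol h m e₁ z ζ * φ z) = 0

/-! ### Cotangent vectors, wave front sets and characteristic sets -/

variable (S) in
/-- The points of the cotangent bundle `T^*(M × M)`, `M = ℝ × S`: a base point `(t, x, s, y)` and a
covector `(ξ⁰, ξ, η⁰, η)` with `ξ ∈ T_x^* S` and `η ∈ T_y^* S`. -/
structure Cotangent where
  (t : ℝ) (x : S) (s : ℝ) (y : S)
  ξ₀ : ℝ
  ξ : TangentSpace 𝓘(ℝ, E3) x →L[ℝ] ℝ
  η₀ : ℝ
  η : TangentSpace 𝓘(ℝ, E3) y →L[ℝ] ℝ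

/-- The covector is not zero. -/
def Cotangent.NonZero (w : Cotangent S) : Prop :=
  w.ξ₀ ≠ 0 ∨ w.ξ ≠ 0 ∨ w.η₀ ≠ 0 ∨ w.η ≠ 0

/-- The coordinates `ξ_i = ξ(∂/∂xⁱ)` in the chart `e` of a covector `ξ` at `x`. -/
def covectorCoord (e : Chart S) (x : S) (ξ : TangentSpace 𝓘(ℝ, E3) x →L[ℝ] ℝ) : E3 :=
  WithLp.toLp 2 fun i =>
    ξ (mfderiv 𝓘(ℝ, E3) 𝓘(ℝ, E3) e.1.symm (e.1 x) (EuclideanSpace.single i (1 : ℝ) : E3))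

/-- The coordinates of the base point in the product chart of `(e₁, e₂)`. -/
def Cotangent.baseCoord (e₁ e₂ : Chart S) (w : Cotangent S) : E8 :=
  mk8 w.t (e₁.1 w.x) w.s (e₂.1 w.y)

/-- The coordinates of the covector in the product chart of `(e₁, e₂)`. -/
def Cotangent.fiberCoord (e₁ e₂ : Chart S) (w : Cotangent S) : E8 :=
  mk8 w.ξ₀ (covectorCoord e₁ w.x w.ξ) w.η₀ (covectorCoord e₂ w.y w.η)

/-- A distribution `u` on an open subset of `ℝ⁸` is microlocally in `H^r` at `(z₀, ζ₀)`: the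
integral of `⟨ζ⟩^{2r} |𝓕(φ u)(ζ)|²` over an open conic neighbourhood of `ζ₀` is finite, for some
test function `φ` with `φ(z₀) ≠ 0`. -/
def IsMicrolocal {Ω : Opens E8} (r : ℝ) (u : 𝓓(Ω, ℂ) →L[ℂ] ℂ) (z₀ ζ₀ : E8) : Prop :=
  ∃ (φ : 𝓓(Ω, ℂ)) (Γ : Set E8), φ z₀ ≠ 0 ∧ IsOpen Γ ∧ ζ₀ ∈ Γ ∧
    (∀ ζ ∈ Γ, ∀ a : ℝ, 0 < a → a • ζ ∈ Γ) ∧ IntegrableOn (sobolevDensity r u φ) Γ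

/-- The Sobolev wave front set `WF^r(v) ⊆ T^*(M × M) \ 0`: the complement of the points at which
`v` is microlocally in `H^r` in coordinates. -/
def waveFront (r : ℝ) (v : BiDistribution S) : Set (Cotangent S) :=
  {w | w.NonZero ∧ ¬ ∀ e₁ e₂ : Chart S, w.x ∈ e₁.1.source → w.y ∈ e₂.1.source →
    IsMicrolocal r (v.loc e₁ e₂) (w.baseCoord e₁ e₂) (w.fiberCoord e₁ e₂)}

/-- A symbol `p` of order `2` on an open set `Ω` is non-characteristic at `(z₀, ζ₀)`: one has
`|p(z, ζ)| ≥ c |ζ|²` for `|ζ| ≥ C` in an open conic neighbourhood of `(z₀, ζ₀)`. -/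
def IsNonChar (Ω : Opens E8) (p : E8 → E8 → ℂ) (z₀ ζ₀ : E8) : Prop :=
  ∃ (Γ : Set (E8 × E8)) (c C : ℝ), 0 < c ∧ 0 < C ∧ IsOpen Γ ∧ (z₀, ζ₀) ∈ Γ ∧
    (∀ w ∈ Γ, w.1 ∈ Ω) ∧ (∀ w ∈ Γ, ∀ a : ℝ, 0 < a → (w.1, a • w.2) ∈ Γ) ∧
    ∀ w ∈ Γ, C ≤ ‖w.2‖ → c * ‖w.2‖ ^ 2 ≤ ‖p w.1 w.2‖

/-- The characteristic set `Char(P_{(t,x)}) ⊆ T^*(M × M) \ 0`: the complement of the points at which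
the symbol is non-characteristic in coordinates. -/
def charSet (h : Metric S) (m : ℝ) : Set (Cotangent S) :=
  {w | w.NonZero ∧ ¬ ∀ e₁ e₂ : Chart S, w.x ∈ e₁.1.source → w.y ∈ e₂.1.source →
    IsNonChar (chartDomain e₁ e₂) (symbol h m e₁) (w.baseCoord e₁ e₂) (w.fiberCoord e₁ e₂)}

end Manifold

end KleinGordon

end

/-! In a product chart the claim is elliptic regularity for rough coefficients. The symbol is a
quadratic form `a(z)(ζ, ζ)` plus terms of order at most one, so the form does not vanish at a
non-characteristic point (`IsNonChar.ne_zero`). What has to be shown is that a solution in `H^s`,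
with `s = 2 + σ - τ + ε'`, is microlocally in `H^{s+t}` up to an arbitrarily small loss, if the
second order coefficients are `C^t` and those of first order `C^{t-1}`. Since `t` can be taken close
enough to `τ`, `s + t > σ + 2`.

All estimates are on the Fourier side. `HasGrowth r Γ V` measures `V` by its `L²` norms on dyadic
shells inside a cone, and multiplication by a coefficient is convolution with its transform. Such a
convolution is bounded on `L²` by the sup norm of the coefficient, and its kernel can be truncated
to `|η| ≤ R` with an operator error `O(R^{-t})`; this is `exists_localizable`, proved with iterated
mollification errors. Consequently frequencies at distance comparable to `2^k` from an output on the
`k`-th shell contribute only `O(2^{-(s+t)k})` when the input has order `s < 0 < s + t`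
(`Localizable.far`).

The coefficients are frozen at the base point and localised to a small ball, so that the remainder
has small sup norm. Commuting the cut-offs loses one order; dividing by the frozen form on a cone
then bounds `V(w) = (1 + |w|)² 𝓕(ψu)(w)` by a small convolution operator applied to functions
dominated by `V`, plus an error. The operator does not respect the cone, so it cannot simply be
inverted there. But truncated to `R = 2^{k/2}` it only looks at the `R`-neighbourhood of the output
set. Each use of the inequality halves the norm and thickens the set by `R`; since `k 2^{k/2}` is
much smaller than `2^k`, `k` uses stay in slightly larger shells and cones and produce a factor
`2^{-k}`. The truncation error `R^{-t}` with `t ≥ 1` leaves a net gain of half a derivative, up to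
the ceiling `s + t` (`HasGrowth.absorb`, `hasGrowth_improve`). Finitely many rounds on shrinking
balls and cones reach the ceiling (`IsLocalSolution.exists_hasGrowth`).

Two further inputs are needed. A Zygmund function of integer order `N` is `C^{N-1,θ}` for every `θ <
1` (`locHol_of_isZygmund`); the loss is paid for by `ε`. A distribution, on test functions supported
in a compact set, is integration of their Fourier transforms against a function of polynomial growth
(`exists_ft_representation`), which gives `𝓕(χu)` its convolution calculus. -/

noncomputable section

namespace KleinGordon

open scoped FourierTransform ENNReal NNReal SchwartzMap

/-! ### The Fourier transform and convolution operators on `L²` -/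

section FourierBasics

variable {E : Type*} [NormedAddCommGroup E] [InnerProductSpace ℝ E]

/-- The plane wave `x ↦ e^{i⟨x, ξ⟩}` on an inner product space. -/
def wave (ξ x : E) : ℂ := Complex.exp (Complex.I * ((inner ℝ x ξ : ℝ) : ℂ))

theorem continuous_wave : Continuous fun p : E × E => wave p.1 p.2 := by
  unfold wave; fun_prop

theorem norm_wave (ξ x : E) : ‖wave ξ x‖ = 1 := by
  unfold wave; rw [mul_comm]; exact Complex.norm_exp_ofReal_mul_I _

theorem wave_add (ξ η x : E) : wave (ξ + η) x = wave ξ x * wave η x := by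
  unfold wave
  rw [← Complex.exp_add, inner_add_right]
  congr 1; push_cast; ring

theorem wave_add_right (ξ x y : E) : wave ξ (x + y) = wave ξ x * wave ξ y := by
  unfold wave
  rw [← Complex.exp_add, inner_add_left]
  congr 1; push_cast; ring

theorem wave_zero (x : E) : wave 0 x = 1 := by simp [wave]

theorem wave_comm (ξ x : E) : wave ξ x = wave x ξ := by
  unfold wave; rw [real_inner_comm]

theorem wave_smul_left (c : ℝ) (ξ x : E) : wave (c • ξ) x = wave ξ (c • x) := by
  unfold wave; rw [inner_smul_left, inner_smul_right]; simp

variable [FiniteDimensional ℝ E] [MeasurableSpace E] [BorelSpace E]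

/-- The unnormalized Fourier transform `∫ e^{-i⟨z, η⟩} g(z) dz`. -/
def ft (g : E → ℂ) (η : E) : ℂ := ∫ z, wave (-η) z * g z

theorem integrable_wave_mul {g : E → ℂ} (hg : Integrable g) (η : E) :
    Integrable fun z => wave η z * g z := by
  refine hg.bdd_mul (c := 1) ?_ (ae_of_all _ fun z => (norm_wave η z).le)
  exact (continuous_wave.comp (by fun_prop : Continuous fun z : E => (η, z))).aestronglyMeasurable

theorem continuous_ft {g : E → ℂ} (hg : Integrable g) : Continuous (ft g) := by
  refine continuous_of_dominated (bound := fun z => ‖g z‖) (fun η => ?_) (fun η => ?_) hg.norm ?_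
  · exact (integrable_wave_mul hg (-η)).aestronglyMeasurable
  · exact ae_of_all _ fun z => by rw [norm_mul, norm_wave, one_mul]
  · refine ae_of_all _ fun z => Continuous.mul ?_ continuous_const
    exact continuous_wave.comp (by fun_prop : Continuous fun η : E => (-η, z))

theorem norm_ft_le (g : E → ℂ) (η : E) : ‖ft g η‖ ≤ ∫ z, ‖g z‖ := by
  refine (norm_integral_le_integral_norm _).trans (le_of_eq ?_)
  simp [norm_wave]

theorem ft_eq_fourier (g : E → ℂ) (η : E) : ft g η = 𝓕 g ((2 * Real.pi)⁻¹ • η) := by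
  rw [Real.fourier_eq', ft]
  refine integral_congr_ae (ae_of_all _ fun z => ?_)
  simp only [smul_eq_mul, wave, inner_neg_right, inner_smul_right]
  congr 2
  have : (Real.pi : ℂ) ≠ 0 := by exact_mod_cast Real.pi_ne_zero
  push_cast
  field_simp

theorem ft_add {f g : E → ℂ} (hf : Integrable f) (hg : Integrable g) (η : E) :
    ft (fun z => f z + g z) η = ft f η + ft g η := by
  simp only [ft, mul_add]
  exact integral_add (integrable_wave_mul hf _) (integrable_wave_mul hg _)

theorem ft_sub {f g : E → ℂ} (hf : Integrable f) (hg : Integrable g) (η : E) :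
    ft (fun z => f z - g z) η = ft f η - ft g η := by
  simp only [ft, mul_sub]
  exact integral_sub (integrable_wave_mul hf _) (integrable_wave_mul hg _)

theorem ft_const_mul (c : ℂ) (f : E → ℂ) (η : E) : ft (fun z => c * f z) η = c * ft f η := by
  simp only [ft]
  rw [← integral_const_mul]
  congr 1; ext z; ring

/-- Plancherel's theorem for functions in `L¹ ∩ L²`. -/
theorem eLpNorm_fourier_eq {f : E → ℂ} (h1 : Integrable f) (h2 : MemLp f 2) :
    eLpNorm (𝓕 f) 2 = eLpNorm f 2 := by
  set F : Lp ℂ 2 (volume : Measure E) := h2.toLp f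
  have hcont : Continuous (𝓕 f) := by
    exact VectorFourier.fourierIntegral_continuous Real.continuous_fourierChar
      (by exact continuous_inner) h1
  have key : ((𝓕 F : Lp ℂ 2 (volume : Measure E)) : E → ℂ) =ᵐ[volume] 𝓕 f := by
    -- The `L²` transform and the integral agree as distributions: in both cases the transform can
    -- be moved to the test function.
    refine ae_eq_of_integral_contDiff_smul_eq ?_ hcont.locallyIntegrable ?_
    · exact (Lp.memLp (𝓕 F)).locallyIntegrable (by norm_num)
    intro g hg hgc
    have hgc' : HasCompactSupport fun x => (g x : ℂ) :=
      hgc.comp_left (g := fun x : ℝ => (x : ℂ)) (by simp)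
    have hg' : ContDiff ℝ ∞ fun x => (g x : ℂ) := Complex.ofRealCLM.contDiff.comp hg
    let G : 𝓢(E, ℂ) := hgc'.toSchwartzMap hg'
    have hG : ∀ x, G x = (g x : ℂ) := fun x => rfl
    have e := congrArg (fun T => T G) (Lp.fourier_toTemperedDistribution_eq F)
    simp only [TemperedDistribution.fourier_apply, Lp.toTemperedDistribution_apply] at e
    have e1 : ∫ x, g x • ((𝓕 F : Lp ℂ 2 (volume : Measure E)) : E → ℂ) x
        = ∫ x, G x • ((𝓕 F : Lp ℂ 2 (volume : Measure E)) : E → ℂ) x := by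
      simp [hG]
    have e2 : ∫ x, (𝓕 G) x • (F : E → ℂ) x = ∫ x, (𝓕 G) x • f x := by
      refine integral_congr_ae ?_
      filter_upwards [h2.coeFn_toLp] with x hx
      rw [hx]
    rw [e1, ← e, e2]
    have := VectorFourier.integral_fourierIntegral_smul_eq_flip (L := innerₗ E)
      (f := G) (g := f) (μ := volume) (ν := volume)
      Real.continuous_fourierChar (by exact continuous_inner) G.integrable h1
    rw [SchwartzMap.fourier_coe]
    refine Eq.trans this ?_
    simp only [flip_innerₗ]
    refine integral_congr_ae (ae_of_all _ fun x => ?_)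
    simp [hG]; left; rfl
  rw [← eLpNorm_congr_ae key]
  have := Lp.norm_fourier_eq F
  rw [Lp.norm_def, Lp.norm_def, ENNReal.toReal_eq_toReal_iff'
    (Lp.memLp _).2.ne (Lp.memLp _).2.ne] at this
  rw [this, eLpNorm_congr_ae h2.coeFn_toLp]

/-- The convolution `∫ K(w - ζ) V(ζ) dζ`. -/
def conv (K V : E → ℂ) (w : E) : ℂ := ∫ ζ, K (w - ζ) * V ζ

/-- Convolution with `K` is bounded by `B` on `L²`. -/
def OpBound (K : E → ℂ) (B : ℝ) : Prop :=
  ∀ f : E → ℂ, Integrable f → MemLp f 2 →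
    eLpNorm (conv K f) 2 ≤ ENNReal.ofReal B * eLpNorm f 2

theorem exists_eLpNorm_ft_le (E : Type*) [NormedAddCommGroup E] [InnerProductSpace ℝ E]
    [FiniteDimensional ℝ E] [MeasurableSpace E] [BorelSpace E] :
    ∃ C : ℝ, 0 < C ∧ ∀ f : E → ℂ, Integrable f → MemLp f 2 →
      eLpNorm (ft f) 2 ≤ ENNReal.ofReal C * eLpNorm f 2 := by
  set r : ℝ := (2 * Real.pi)⁻¹
  have hr : 0 < r := by positivity
  set c : ℝ≥0∞ := ENNReal.ofReal |(r ^ Module.finrank ℝ E)⁻¹|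
  have hc : c ^ ((1 / 2 : ℝ≥0∞)).toReal ≠ ⊤ :=
    ENNReal.rpow_ne_top_of_nonneg (by positivity) ENNReal.ofReal_ne_top
  -- The factor `c` is the Jacobian of the dilation relating `ft` to `𝓕`; the `+ 1` makes the
  -- constant strictly positive.
  refine ⟨(c ^ ((1 / 2 : ℝ≥0∞)).toReal).toReal + 1, by positivity, fun f h1 h2 => ?_⟩
  have hcont : Continuous (𝓕 f) :=
    VectorFourier.fourierIntegral_continuous Real.continuous_fourierChar
      (by exact continuous_inner) h1
  have : ft f = (𝓕 f) ∘ fun x => r • x := by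
    ext η; exact ft_eq_fourier f η
  rw [this, ← eLpNorm_map_measure hcont.aestronglyMeasurable (by fun_prop),
    Measure.map_addHaar_smul _ hr.ne', eLpNorm_smul_measure_of_ne_top (by norm_num),
    eLpNorm_fourier_eq h1 h2, smul_eq_mul]
  gcongr
  rw [ENNReal.ofReal_add (by positivity) (by positivity), ENNReal.ofReal_toReal hc]
  exact le_self_add

/-- Fubini. On the physical side, convolution with `ft g` is multiplication by `g`, so only the
values of `g` matter for `L²` bounds. -/
theorem conv_ft {g f : E → ℂ} (hg : Integrable g) (hf : Integrable f) (w : E) :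
    conv (ft g) f w = ft (fun z => g z * ft f (-z)) w := by
  have hprod : Integrable (fun p : E × E => f p.1 * g p.2) (volume.prod volume) := hf.mul_prod hg
  have : Integrable (fun p : E × E => wave (-(w - p.1)) p.2 * g p.2 * f p.1)
      (volume.prod volume) := by
    have h := hprod.bdd_mul (f := fun p : E × E => wave (-(w - p.1)) p.2) (c := 1)
      ((continuous_wave.comp
        (by fun_prop : Continuous fun p : E × E => (-(w - p.1), p.2))).aestronglyMeasurable)
      (ae_of_all _ fun z => (norm_wave _ _).le)
    refine h.congr (ae_of_all _ fun p => ?_)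
    simp only; ring
  calc conv (ft g) f w = ∫ ζ, ∫ z, wave (-(w - ζ)) z * g z * f ζ := by
        simp only [conv, ft, integral_mul_const]
    _ = ∫ z, ∫ ζ, wave (-(w - ζ)) z * g z * f ζ := integral_integral_swap this
    _ = _ := by
        simp only [ft]
        congr 1; ext z
        rw [← integral_const_mul, ← integral_const_mul]
        congr 1; ext ζ
        rw [neg_sub, sub_eq_add_neg, wave_add, neg_neg, wave_comm ζ z]
        ring

theorem eLpNorm_reflect {h : E → ℂ} (hh : Continuous h) :
    eLpNorm (fun z : E => h (-z)) 2 volume = eLpNorm h 2 volume :=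
    eLpNorm_comp_measurePreserving hh.aestronglyMeasurable
      (Measure.measurePreserving_neg (volume : Measure E))

/-- By `conv_ft` and Plancherel, used once for `f` and once for the product. The bound is linear in
the sup norm of `g` and involves no smoothness: this makes the remainder of a frozen coefficient a
small operator. -/
theorem exists_opBound_ft (E : Type*) [NormedAddCommGroup E] [InnerProductSpace ℝ E]
    [FiniteDimensional ℝ E] [MeasurableSpace E] [BorelSpace E] :
    ∃ C : ℝ, 0 < C ∧ ∀ (g : E → ℂ) (M : ℝ), Integrable g → 0 ≤ M → (∀ x, ‖g x‖ ≤ M) →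
      OpBound (ft g) (C * M) := by
  obtain ⟨C, hC, h⟩ := exists_eLpNorm_ft_le E
  refine ⟨C * C, by positivity, ?_⟩
  intro g M hg hM hb f h1 h2
  have hcont : Continuous fun z : E => ft f (-z) := (continuous_ft h1).comp continuous_neg
  have heq := eLpNorm_reflect (continuous_ft h1)
  have hle : ∀ z, ‖g z * ft f (-z)‖ ≤ M * ‖ft f (-z)‖ := fun z => by
    rw [norm_mul]; gcongr; exact hb z
  have hi : Integrable fun z => g z * ft f (-z) := by
    refine hg.mul_bdd (c := ∫ z, ‖f z‖) hcont.aestronglyMeasurable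
      (ae_of_all _ fun z => norm_ft_le f (-z))
  have hl2 : eLpNorm (fun z => g z * ft f (-z)) 2 ≤
      ENNReal.ofReal M * (ENNReal.ofReal C * eLpNorm f 2) := by
    refine (eLpNorm_le_mul_eLpNorm_of_ae_le_mul (ae_of_all _ hle) 2).trans ?_
    rw [heq]
    gcongr
    exact h f h1 h2
  have hm : MemLp (fun z => g z * ft f (-z)) 2 :=
    ⟨hi.1, hl2.trans_lt (ENNReal.mul_lt_top ENNReal.ofReal_lt_top
      (ENNReal.mul_lt_top ENNReal.ofReal_lt_top h2.2))⟩
  have e : conv (ft g) f = ft (fun z => g z * ft f (-z)) := funext (conv_ft hg h1)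
  rw [e]
  refine (h _ hi hm).trans ?_
  refine (mul_le_mul_right hl2 _).trans (le_of_eq ?_)
  rw [ENNReal.ofReal_mul (by positivity), ENNReal.ofReal_mul hC.le]
  ring

end FourierBasics

end KleinGordon

namespace KleinGordon

/-! ### Local Hölder classes and their calculus -/

section LocalHolder

variable {E : Type} [NormedAddCommGroup E] [NormedSpace ℝ E]

/-- Local Hölder regularity `C^{n,θ}` on a set `U` (which is open in all applications). -/
def LocHol (θ : ℝ) : ℕ → ∀ {V : Type} [NormedAddCommGroup V] [NormedSpace ℝ V],
    Set E → (E → V) → Prop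
  | 0, _, _, _, U, F => ∀ x ∈ U, ∃ C : ℝ, ∃ N ∈ 𝓝 x, ∀ y ∈ N, ∀ z ∈ N,
      ‖F y - F z‖ ≤ C * ‖y - z‖ ^ θ
  | n + 1, _, _, _, U, F => (∀ x ∈ U, DifferentiableAt ℝ F x) ∧ LocHol θ n U (fderiv ℝ F)

variable {V W Z : Type} [NormedAddCommGroup V] [NormedSpace ℝ V] [NormedAddCommGroup W]
  [NormedSpace ℝ W] [NormedAddCommGroup Z] [NormedSpace ℝ Z] {θ : ℝ} {n : ℕ} {U : Set E}

theorem LocHol.congr (hU : IsOpen U) {F G : E → V} (h : LocHol θ n U F) (e : EqOn F G U) :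
    LocHol θ n U G := by
  induction n generalizing V with
  | zero =>
    intro x hx
    obtain ⟨C, N, hN, hC⟩ := h x hx
    refine ⟨C, N ∩ U, inter_mem hN (hU.mem_nhds hx), fun y hy z hz => ?_⟩
    rw [← e hy.2, ← e hz.2]
    exact hC y hy.1 z hz.1
  | succ n ih =>
    have ev : ∀ x ∈ U, F =ᶠ[𝓝 x] G := fun x hx => e.eventuallyEq_of_mem (hU.mem_nhds hx)
    exact ⟨fun x hx => (ev x hx).differentiableAt_iff.1 (h.1 x hx),
      ih h.2 fun x hx => (ev x hx).fderiv_eq⟩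

theorem LocHol.mono_set {U' : Set E} {F : E → V} (h : LocHol θ n U F) (hs : U' ⊆ U) :
    LocHol θ n U' F := by
  induction n generalizing V with
  | zero => exact fun x hx => h x (hs hx)
  | succ n ih => exact ⟨fun x hx => h.1 x (hs hx), ih h.2⟩

theorem LocHol.union {U' : Set E} {F : E → V} (h : LocHol θ n U F) (h' : LocHol θ n U' F) :
    LocHol θ n (U ∪ U') F := by
  induction n generalizing V with
  | zero => exact fun x hx => hx.elim (h x) (h' x)
  | succ n ih => exact ⟨fun x hx => hx.elim (h.1 x) (h'.1 x), ih h.2 h'.2⟩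

theorem LocHol.continuousAt (hθ : 0 < θ) {F : E → V} (h : LocHol θ n U F) {x : E} (hx : x ∈ U) :
    ContinuousAt F x := by
  cases n with
  | succ n => exact (h.1 x hx).continuousAt
  | zero =>
    obtain ⟨C, N, hN, hC⟩ := h x hx
    have : Tendsto (fun y => C * ‖y - x‖ ^ θ) (𝓝 x) (𝓝 0) := by
      have h0 : Tendsto (fun y => ‖y - x‖) (𝓝 x) (𝓝 0) := by
        have : Continuous fun y => ‖y - x‖ := by fun_prop
        simpa using this.tendsto x
      have := (h0.rpow_const (p := θ) (Or.inr hθ.le)).const_mul C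
      simpa [Real.zero_rpow hθ.ne'] using this
    rw [ContinuousAt, tendsto_iff_norm_sub_tendsto_zero]
    refine squeeze_zero' (Eventually.of_forall fun y => norm_nonneg _) ?_ this
    filter_upwards [hN] with y hy
    exact hC y hy x (mem_of_mem_nhds hN)

theorem locHol_zero_of_lipschitz (hθ1 : θ ≤ 1) {F : E → V}
    (h : ∀ x ∈ U, ∃ C : ℝ, ∃ N ∈ 𝓝 x, ∀ y ∈ N, ∀ z ∈ N, ‖F y - F z‖ ≤ C * ‖y - z‖) :
    LocHol θ 0 U F := by
  intro x hx
  obtain ⟨C, N, hN, hC⟩ := h x hx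
  -- The radius `1 / 2` keeps `‖y - z‖ ≤ 1`, where `‖y - z‖ ≤ ‖y - z‖ ^ θ`.
  refine ⟨|C|, N ∩ Metric.ball x (1 / 2), inter_mem hN (Metric.ball_mem_nhds x (by norm_num)),
    fun y hy z hz => (hC y hy.1 z hz.1).trans ?_⟩
  have h1 : ‖y - z‖ ≤ 1 := by
    rw [← dist_eq_norm]
    have := dist_triangle_right y z x
    have a := Metric.mem_ball.1 hy.2
    have b := Metric.mem_ball.1 hz.2
    linarith
  have h2 : ‖y - z‖ ≤ ‖y - z‖ ^ θ := by
    rcases (norm_nonneg (y - z)).eq_or_lt with h0 | h0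
    · rw [← h0]; exact Real.rpow_nonneg le_rfl _
    · exact Real.self_le_rpow_of_le_one h0.le h1 hθ1
  calc C * ‖y - z‖ ≤ |C| * ‖y - z‖ := by gcongr; exact le_abs_self C
    _ ≤ _ := by gcongr

/-- The derivative is continuous, hence locally bounded, so the mean value inequality gives a local
Lipschitz bound; higher orders reduce to this one through the derivative. -/
theorem LocHol.of_succ (hθ : 0 < θ) (hθ1 : θ ≤ 1) (hU : IsOpen U) {F : E → V}
    (h : LocHol θ (n + 1) U F) : LocHol θ n U F := by
  induction n generalizing V with
  | zero =>
    refine locHol_zero_of_lipschitz hθ1 fun x hx => ?_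
    have hc : ContinuousAt (fderiv ℝ F) x := LocHol.continuousAt hθ h.2 hx
    have hb : ∀ᶠ y in 𝓝 x, ‖fderiv ℝ F y‖ < ‖fderiv ℝ F x‖ + 1 :=
      hc.norm.eventually_lt continuousAt_const (by linarith)
    obtain ⟨r, hr, hball⟩ := Metric.mem_nhds_iff.1 (hb.and (hU.mem_nhds hx))
    refine ⟨‖fderiv ℝ F x‖ + 1, Metric.ball x r, Metric.ball_mem_nhds x hr, fun y hy z hz => ?_⟩
    exact (convex_ball x r).norm_image_sub_le_of_norm_fderiv_le
      (fun w hw => h.1 w (hball hw).2) (fun w hw => (hball hw).1.le) hz hy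
  | succ n ih => exact ⟨h.1, ih h.2⟩

theorem LocHol.clm (hU : IsOpen U) {F : E → V} (h : LocHol θ n U F) (A : V →L[ℝ] W) :
    LocHol θ n U fun x => A (F x) := by
  induction n generalizing V W with
  | zero =>
    intro x hx
    obtain ⟨C, N, hN, hC⟩ := h x hx
    refine ⟨‖A‖ * C, N, hN, fun y hy z hz => ?_⟩
    rw [← map_sub, mul_assoc]
    exact (A.le_opNorm _).trans (by gcongr; exact hC y hy z hz)
  | succ n ih =>
    refine ⟨fun x hx => A.differentiableAt.comp x (h.1 x hx), ?_⟩
    refine LocHol.congr hU (ih h.2 (ContinuousLinearMap.compL ℝ E V W A)) fun x hx => ?_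
    exact (A.hasFDerivAt.comp x (h.1 x hx).hasFDerivAt).fderiv.symm

theorem LocHol.add (hU : IsOpen U) {F G : E → V} (hF : LocHol θ n U F) (hG : LocHol θ n U G) :
    LocHol θ n U fun x => F x + G x := by
  induction n generalizing V with
  | zero =>
    intro x hx
    obtain ⟨C, N, hN, hC⟩ := hF x hx
    obtain ⟨C', N', hN', hC'⟩ := hG x hx
    refine ⟨C + C', N ∩ N', inter_mem hN hN', fun y hy z hz => ?_⟩
    rw [add_sub_add_comm, add_mul]
    exact (norm_add_le _ _).trans (add_le_add (hC y hy.1 z hz.1) (hC' y hy.2 z hz.2))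
  | succ n ih =>
    refine ⟨fun x hx => (hF.1 x hx).add (hG.1 x hx), ?_⟩
    refine LocHol.congr hU (ih hF.2 hG.2) fun x hx => ?_
    exact (fderiv_fun_add (hF.1 x hx) (hG.1 x hx)).symm

/-- Leibniz' rule turns `B` into bilinear maps with values in spaces of linear maps, so the
induction needs arbitrary bilinear maps and target spaces. The undifferentiated factor drops one
order by `LocHol.of_succ`. -/
theorem LocHol.bilin (hθ : 0 < θ) (hθ1 : θ ≤ 1) (hU : IsOpen U) (B : V →L[ℝ] W →L[ℝ] Z)
    {F : E → V} {G : E → W} (hF : LocHol θ n U F) (hG : LocHol θ n U G) :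
    LocHol θ n U fun x => B (F x) (G x) := by
  induction n generalizing V W Z with
  | zero =>
    intro x hx
    have hFb := (hF.continuousAt hθ hx).norm.eventually_lt
      (continuousAt_const (y := ‖F x‖ + 1)) (by simp)
    have hGb := (hG.continuousAt hθ hx).norm.eventually_lt
      (continuousAt_const (y := ‖G x‖ + 1)) (by simp)
    obtain ⟨C, N, hN, hC⟩ := hF x hx
    obtain ⟨C', N', hN', hC'⟩ := hG x hx
    refine ⟨‖B‖ * (|C| * (‖G x‖ + 1) + (‖F x‖ + 1) * |C'|), _,
      inter_mem (inter_mem hN hN') (inter_mem hFb hGb), fun y hy z hz => ?_⟩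
    have e : B (F y) (G y) - B (F z) (G z) = B (F y - F z) (G y) + B (F z) (G y - G z) := by
      simp
    have hy2 : ‖G y‖ ≤ ‖G x‖ + 1 := le_of_lt hy.2.2
    have hz2 : ‖F z‖ ≤ ‖F x‖ + 1 := le_of_lt hz.2.1
    have t := Real.rpow_nonneg (norm_nonneg (y - z)) θ
    have a : ‖F y - F z‖ ≤ |C| * ‖y - z‖ ^ θ :=
      (hC y hy.1.1 z hz.1.1).trans (by gcongr; exact le_abs_self C)
    have b : ‖G y - G z‖ ≤ |C'| * ‖y - z‖ ^ θ :=
      (hC' y hy.1.2 z hz.1.2).trans (by gcongr; exact le_abs_self C')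
    rw [e]
    calc _ ≤ ‖B (F y - F z) (G y)‖ + ‖B (F z) (G y - G z)‖ := norm_add_le _ _
      _ ≤ ‖B‖ * ‖F y - F z‖ * ‖G y‖ + ‖B‖ * ‖F z‖ * ‖G y - G z‖ :=
        add_le_add (B.le_opNorm₂ _ _) (B.le_opNorm₂ _ _)
      _ ≤ ‖B‖ * (|C| * ‖y - z‖ ^ θ) * (‖G x‖ + 1) + ‖B‖ * (‖F x‖ + 1) * (|C'| * ‖y - z‖ ^ θ) := by
        gcongr
      _ = _ := by ring
  | succ n ih =>
    have hd : ∀ x ∈ U, HasFDerivAt (fun x => B (F x) (G x))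
        (B.precompR E (F x) (fderiv ℝ G x) + B.precompL E (fderiv ℝ F x) (G x)) x :=
      fun x hx => B.hasFDerivAt_of_bilinear (hF.1 x hx).hasFDerivAt (hG.1 x hx).hasFDerivAt
    refine ⟨fun x hx => (hd x hx).differentiableAt, ?_⟩
    refine LocHol.congr hU (LocHol.add hU (ih (B.precompR E) (hF.of_succ hθ hθ1 hU) hG.2)
      (ih (B.precompL E) hF.2 (hG.of_succ hθ hθ1 hU))) fun x hx => ?_
    exact (hd x hx).fderiv.symm

theorem LocHol.mul (hθ : 0 < θ) (hθ1 : θ ≤ 1) (hU : IsOpen U) {F G : E → ℝ}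
    (hF : LocHol θ n U F) (hG : LocHol θ n U G) : LocHol θ n U fun x => F x * G x :=
  hF.bilin hθ hθ1 hU (ContinuousLinearMap.mul ℝ ℝ) hG

theorem locHol_of_contDiffOn (hθ1 : θ ≤ 1) (hU : IsOpen U) {F : E → V} (h : ContDiffOn ℝ ∞ F U) :
    LocHol θ n U F := by
  induction n generalizing V with
  | zero =>
    refine locHol_zero_of_lipschitz hθ1 fun x hx => ?_
    obtain ⟨K, N, hN, hK⟩ := (((h x hx).contDiffAt (hU.mem_nhds hx)).of_le
      (by norm_cast : (1 : WithTop ℕ∞) ≤ ∞)).exists_lipschitzOnWith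
    exact ⟨K, N, hN, fun y hy z hz => hK.norm_sub_le hy hz⟩
  | succ n ih =>
    refine ⟨fun x hx => ((h x hx).contDiffAt (hU.mem_nhds hx)).differentiableAt (by simp), ?_⟩
    exact ih (h.fderiv_of_isOpen hU (by simp))

theorem LocHol.scomp (hθ : 0 < θ) (hθ1 : θ ≤ 1) (hU : IsOpen U) {T : Set ℝ} (hT : IsOpen T)
    {φ : ℝ → ℝ} (hφ : ContDiffOn ℝ ∞ φ T) {F : E → ℝ} (hF : LocHol θ n U F)
    (hm : MapsTo F U T) : LocHol θ n U fun x => φ (F x) := by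
  induction n generalizing φ with
  | zero =>
    intro x hx
    obtain ⟨K, N, hN, hK⟩ := (((hφ _ (hm hx)).contDiffAt (hT.mem_nhds (hm hx))).of_le
      (by norm_cast : (1 : WithTop ℕ∞) ≤ ∞)).exists_lipschitzOnWith
    obtain ⟨C, N', hN', hC⟩ := hF x hx
    refine ⟨K * C, N' ∩ F ⁻¹' N, inter_mem hN' ((hF.continuousAt hθ hx) hN), fun y hy z hz => ?_⟩
    rw [mul_assoc]
    exact (hK.norm_sub_le hy.2 hz.2).trans (by gcongr; exact hC y hy.1 z hz.1)
  | succ n ih =>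
    have hd : ∀ x ∈ U, HasFDerivAt (fun x => φ (F x)) (deriv φ (F x) • fderiv ℝ F x) x :=
      fun x hx => (((hφ _ (hm hx)).contDiffAt (hT.mem_nhds (hm hx))).differentiableAt
        (by simp)).hasDerivAt.comp_hasFDerivAt x (hF.1 x hx).hasFDerivAt
    refine ⟨fun x hx => (hd x hx).differentiableAt, ?_⟩
    refine LocHol.congr hU (LocHol.bilin hθ hθ1 hU (ContinuousLinearMap.lsmul ℝ ℝ)
      (ih (φ := deriv φ) ?_ (hF.of_succ hθ hθ1 hU)) hF.2) fun x hx => (hd x hx).fderiv.symm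
    exact hφ.deriv_of_isOpen hT (by simp)

theorem LocHol.comp_clm {E' : Type} [NormedAddCommGroup E'] [NormedSpace ℝ E'] (hθ : 0 < θ)
    (hU : IsOpen U) {F : E → V} (h : LocHol θ n U F) (L : E' →L[ℝ] E) :
    LocHol θ n (L ⁻¹' U) fun x => F (L x) := by
  induction n generalizing V with
  | zero =>
    intro x hx
    obtain ⟨C, N, hN, hC⟩ := h (L x) hx
    refine ⟨|C| * ‖L‖ ^ θ, L ⁻¹' N, L.continuous.continuousAt hN, fun y hy z hz => ?_⟩
    refine (hC _ hy _ hz).trans ?_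
    calc C * ‖L y - L z‖ ^ θ ≤ |C| * ‖L y - L z‖ ^ θ := by gcongr; exact le_abs_self C
      _ ≤ |C| * (‖L‖ * ‖y - z‖) ^ θ := by
        gcongr; rw [← map_sub]; exact L.le_opNorm _
      _ = _ := by rw [Real.mul_rpow (norm_nonneg _) (norm_nonneg _)]; ring
  | succ n ih =>
    refine ⟨fun x hx => (h.1 (L x) hx).comp x L.differentiableAt, ?_⟩
    refine LocHol.congr (hU.preimage L.continuous) (LocHol.clm (hU.preimage L.continuous)
      (ih h.2) ((ContinuousLinearMap.compL ℝ E' E V).flip L)) fun x hx => ?_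
    exact ((h.1 (L x) hx).hasFDerivAt.comp x L.hasFDerivAt).fderiv.symm

/-- Currying the last variable is an isometry, so peeling off one derivative does not change the
Hölder seminorm of the top derivative. -/
theorem locHol_of_iteratedFDeriv {F : E → V} (h : ContDiff ℝ n F) {C : ℝ}
    (hC : ∀ x y, ‖iteratedFDeriv ℝ n F x - iteratedFDeriv ℝ n F y‖ ≤ C * ‖x - y‖ ^ θ) :
    LocHol θ n univ F := by
  induction n generalizing V with
  | zero =>
    refine fun x _ => ⟨C, univ, univ_mem, fun y _ z _ => ?_⟩
    have := hC y z
    simp only [iteratedFDeriv_zero_eq_comp, Function.comp_apply, ← map_sub,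
      LinearIsometryEquiv.norm_map] at this
    exact this
  | succ n ih =>
    refine ⟨fun x _ => (h.differentiable (by simp)).differentiableAt, ?_⟩
    refine ih (h.fderiv_right (by norm_cast)) fun x y => ?_
    have := hC x y
    simp only [iteratedFDeriv_succ_eq_comp_right, Function.comp_apply] at this
    refine le_trans (le_of_eq ?_) this
    rw [← dist_eq_norm, ← dist_eq_norm]
    exact ((continuousMultilinearCurryRightEquiv' ℝ n E V).symm.dist_map _ _).symm

/-- Multiplication with a cut-off function supported in `U` gives a function on the whole space. -/
theorem LocHol.cutoff (hθ : 0 < θ) (hθ1 : θ ≤ 1) (hU : IsOpen U) (B : V →L[ℝ] W →L[ℝ] Z)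
    {χ : E → V} (hχ : ContDiff ℝ ∞ χ) (hs : tsupport χ ⊆ U) {F : E → W} (hF : LocHol θ n U F) :
    LocHol θ n univ fun x => B (χ x) (F x) := by
  have h1 : LocHol θ n U fun x => B (χ x) (F x) :=
    (locHol_of_contDiffOn hθ1 hU hχ.contDiffOn).bilin hθ hθ1 hU B hF
  have ho : IsOpen (tsupport χ)ᶜ := (isClosed_tsupport χ).isOpen_compl
  have h2 : LocHol θ n (tsupport χ)ᶜ fun x => B (χ x) (F x) := by
    refine LocHol.congr ho (F := fun _ => (0 : Z)) (locHol_of_contDiffOn hθ1 ho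
      contDiffOn_const) fun x hx => ?_
    simp [image_eq_zero_of_notMem_tsupport hx]
  refine (h1.union h2).mono_set fun x _ => ?_
  by_cases hx : x ∈ tsupport χ
  · exact Or.inl (hs hx)
  · exact Or.inr hx

end LocalHolder

end KleinGordon

namespace KleinGordon

open scoped FourierTransform SchwartzMap

/-! ### Band-limited mollifiers and the regularization error -/

section Mollifier

variable {E : Type} [NormedAddCommGroup E] [InnerProductSpace ℝ E] [FiniteDimensional ℝ E]
  [MeasurableSpace E] [BorelSpace E]

/-- A real integrable kernel of mean one with compactly supported Fourier transform. -/
structure IsMollifier (ρ : E → ℝ) : Prop where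
  continuous : Continuous ρ
  integrable : Integrable ρ
  integrable_norm_mul : Integrable fun y => ‖y‖ * |ρ y|
  integral_eq_one : ∫ y, ρ y = 1
  ft_eq_zero : ∀ η, 1 ≤ ‖η‖ → ft (fun y => (ρ y : ℂ)) η = 0

/-- The inverse transform of a real even bump is real, so passing to the real part loses nothing. -/
theorem exists_schwartz_ft_eq {E : Type} [NormedAddCommGroup E] [InnerProductSpace ℝ E]
    [FiniteDimensional ℝ E] [MeasurableSpace E] [BorelSpace E] (m : ContDiffBump (0 : E)) :
    ∃ k : 𝓢(E, ℂ), ∀ η, ft (fun y => ((k y).re : ℂ)) η = (m ((2 * Real.pi)⁻¹ • η) : ℂ) := by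
  have hmc : HasCompactSupport fun x => (m x : ℂ) :=
    m.hasCompactSupport.comp_left (g := fun x : ℝ => (x : ℂ)) (by simp)
  have hms : ContDiff ℝ ∞ fun x => (m x : ℂ) := Complex.ofRealCLM.contDiff.comp m.contDiff
  let g : 𝓢(E, ℂ) := hmc.toSchwartzMap hms
  have hg : ∀ x, g x = (m x : ℂ) := fun x => rfl
  let k : 𝓢(E, ℂ) := 𝓕⁻ g
  have hk : ∀ x, k x = 𝓕⁻ (g : E → ℂ) x := fun x => by
    rw [← SchwartzMap.fourierInv_coe]
  have hreal : ∀ x, ((k x).re : ℂ) = k x := by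
    intro x
    rw [← Complex.conj_eq_iff_re, hk, Real.fourierInv_eq', ← integral_conj,
      ← integral_neg_eq_self]
    congr 1; ext v
    simp only [hg, smul_eq_mul, map_mul, Complex.conj_ofReal, ← Complex.exp_conj, m.neg,
      inner_neg_left, Complex.conj_I]
    congr 2
    push_cast; ring
  refine ⟨k, fun η => ?_⟩
  simp only [hreal]
  rw [ft_eq_fourier]
  have : 𝓕 k = g := FourierTransform.fourier_fourierInv_eq g
  rw [← SchwartzMap.fourier_coe, this, hg]

theorem exists_isMollifier (E : Type) [NormedAddCommGroup E] [InnerProductSpace ℝ E]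
    [FiniteDimensional ℝ E] [MeasurableSpace E] [BorelSpace E] :
    ∃ ρ : E → ℝ, IsMollifier ρ := by
  have hp := Real.pi_pos
  -- In the normalization of `ft`, the outer radius `(2π)⁻¹` corresponds to `‖η‖ = 1`.
  let m : ContDiffBump (0 : E) := ⟨(4 * Real.pi)⁻¹, (2 * Real.pi)⁻¹, by positivity, by gcongr; norm_num⟩
  obtain ⟨k, hft⟩ := exists_schwartz_ft_eq m
  have hint : Integrable fun y => (k y).re := k.integrable.re
  refine ⟨fun y => (k y).re, Complex.continuous_re.comp k.continuous, hint, ?_, ?_, fun η hη => ?_⟩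
  · have := k.integrable_pow_mul volume 1
    refine this.mono ?_ (ae_of_all _ fun y => ?_)
    · exact (continuous_norm.mul
        (Complex.continuous_re.comp k.continuous).abs).aestronglyMeasurable
    · rw [Real.norm_of_nonneg (by positivity), Real.norm_of_nonneg (by positivity), pow_one]
      exact mul_le_mul_of_nonneg_left (Complex.abs_re_le_norm _) (norm_nonneg y)
  · have := hft 0
    simp only [ft, neg_zero, wave_zero, one_mul, smul_zero] at this
    rw [integral_complex_ofReal] at this
    have h1 : m (0 : E) = 1 := m.one_of_mem_closedBall (by simp [m.rIn_pos.le])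
    rw [h1] at this
    exact_mod_cast this
  · rw [hft, m.zero_of_le_dist, Complex.ofReal_zero]
    rw [dist_zero_right, norm_smul, Real.norm_of_nonneg (by positivity)]
    show (2 * Real.pi)⁻¹ ≤ _
    exact le_mul_of_one_le_right (by positivity) hη

variable {V : Type} [NormedAddCommGroup V] [NormedSpace ℝ V]

/-- Bounded continuous functions. -/
def BddCont (F : E → V) : Prop := Continuous F ∧ ∃ C, ∀ x, ‖F x‖ ≤ C

/-- The error `F - ρ_R * F` of regularization at the frequency scale `R`. -/
def mollifyError (ρ : E → ℝ) (R : ℝ) (F : E → V) (x : E) : V :=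
  F x - ∫ y, ρ y • F (x - R⁻¹ • y)

variable {ρ : E → ℝ} (hρ : IsMollifier ρ)
include hρ

theorem IsMollifier.integrable_smul {F : E → V} (hF : BddCont F) (R : ℝ) (x : E) :
    Integrable fun y => ρ y • F (x - R⁻¹ • y) := by
  obtain ⟨hc, C, hC⟩ := hF
  exact hρ.integrable.smul_bdd C
    (hc.comp (by fun_prop : Continuous fun y : E => x - R⁻¹ • y)).aestronglyMeasurable
    (ae_of_all _ fun y => hC _)

theorem IsMollifier.norm_mollifyError_le {F : E → V} (hF : Continuous F) {M : ℝ}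
    (hM : ∀ x, ‖F x‖ ≤ M) (R : ℝ) (x : E) :
    ‖mollifyError ρ R F x‖ ≤ (1 + ∫ y, |ρ y|) * M := by
  have h : ‖∫ y, ρ y • F (x - R⁻¹ • y)‖ ≤ (∫ y, |ρ y|) * M := by
    rw [← integral_mul_const]
    refine (norm_integral_le_integral_norm _).trans (integral_mono
      (hρ.integrable_smul ⟨hF, M, hM⟩ R x).norm (hρ.integrable.abs.mul_const M) fun y => ?_)
    simp only [norm_smul, Real.norm_eq_abs]
    gcongr; exact hM _
  calc _ ≤ ‖F x‖ + ‖∫ y, ρ y • F (x - R⁻¹ • y)‖ := norm_sub_le _ _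
    _ ≤ M + (∫ y, |ρ y|) * M := add_le_add (hM x) h
    _ = _ := by ring

theorem IsMollifier.bddCont {F : E → V} (hF : BddCont F) (R : ℝ) :
    BddCont (mollifyError ρ R F) := by
  obtain ⟨C, hC⟩ := hF.2
  refine ⟨hF.1.sub ?_, _, hρ.norm_mollifyError_le hF.1 hC R⟩
  refine continuous_of_dominated (bound := fun y => |ρ y| * C)
    (fun x => (hρ.integrable_smul hF R x).aestronglyMeasurable) (fun x => ae_of_all _ fun y => ?_)
    (hρ.integrable.abs.mul_const C) (ae_of_all _ fun y => ?_)
  · rw [norm_smul, Real.norm_eq_abs]; gcongr; exact hC _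
  · exact continuous_const.smul (hF.1.comp (by fun_prop))

variable [CompleteSpace V]

/-- As `ρ` has mean one, the error averages the differences `F x - F (x - R⁻¹ y)`; the first moment
of `ρ` controls `‖y‖ ^ θ ≤ 1 + ‖y‖`. -/
theorem IsMollifier.norm_mollifyError_le_of_holder {θ : ℝ} (hθ : 0 < θ) (hθ1 : θ ≤ 1) {F : E → V}
    (hF : BddCont F) {C : ℝ} (hC0 : 0 ≤ C) (hC : ∀ x y, ‖F x - F y‖ ≤ C * ‖x - y‖ ^ θ) {R : ℝ}
    (hR : 0 < R) (x : E) :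
    ‖mollifyError ρ R F x‖ ≤ (∫ y, (1 + ‖y‖) * |ρ y|) * C * R ^ (-θ) := by
  have hi : Integrable fun y => (1 + ‖y‖) * |ρ y| := by
    simp only [add_mul, one_mul]
    exact hρ.integrable.abs.add hρ.integrable_norm_mul
  have e : mollifyError ρ R F x = ∫ y, ρ y • (F x - F (x - R⁻¹ • y)) := by
    simp only [smul_sub]
    rw [integral_sub (hρ.integrable.smul_const _) (hρ.integrable_smul hF R x),
      integral_smul_const, hρ.integral_eq_one, one_smul]
    rfl
  rw [e, mul_assoc, ← integral_mul_const]
  refine norm_integral_le_of_norm_le (hi.mul_const _) (ae_of_all _ fun y => ?_)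
  rw [norm_smul, Real.norm_eq_abs]
  have h1 : ‖F x - F (x - R⁻¹ • y)‖ ≤ C * (‖y‖ ^ θ * R ^ (-θ)) := by
    refine (hC _ _).trans (le_of_eq ?_)
    rw [sub_sub_cancel, norm_smul, norm_inv, Real.norm_of_nonneg hR.le,
      Real.mul_rpow (by positivity) (norm_nonneg _), Real.inv_rpow hR.le, Real.rpow_neg hR.le]
    ring
  have h2 : ‖y‖ ^ θ ≤ 1 + ‖y‖ := by
    rcases le_total ‖y‖ 1 with h | h
    · exact (Real.rpow_le_one (norm_nonneg _) h hθ.le).trans (by linarith [norm_nonneg y])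
    · calc ‖y‖ ^ θ ≤ ‖y‖ ^ (1 : ℝ) := Real.rpow_le_rpow_of_exponent_le h hθ1
        _ ≤ _ := by rw [Real.rpow_one]; linarith
  calc |ρ y| * ‖F x - F (x - R⁻¹ • y)‖ ≤ |ρ y| * (C * ((1 + ‖y‖) * R ^ (-θ))) := by
        gcongr; exact h1.trans (by gcongr)
    _ = _ := by ring

/-- The error operator commutes with differentiation, which lets the gain in `R` be iterated through
the derivatives. -/
theorem IsMollifier.hasFDerivAt_mollifyError {F : E → V} (hF : BddCont F)
    (hd : Differentiable ℝ F) (hF' : BddCont (fderiv ℝ F)) (R : ℝ) (x : E) :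
    HasFDerivAt (mollifyError ρ R F) (mollifyError ρ R (fderiv ℝ F) x) x := by
  obtain ⟨C, hC⟩ := hF'.2
  refine (hd x).hasFDerivAt.sub ?_
  refine hasFDerivAt_integral_of_dominated_of_fderiv_le (bound := fun y => |ρ y| * C)
    (F' := fun x y => ρ y • fderiv ℝ F (x - R⁻¹ • y)) univ_mem
    (Eventually.of_forall fun x => (hρ.integrable_smul hF R x).aestronglyMeasurable)
    (hρ.integrable_smul hF R x) (hρ.integrable_smul hF' R x).aestronglyMeasurable
    (ae_of_all _ fun y x _ => ?_) (hρ.integrable.abs.mul_const C) (ae_of_all _ fun y x _ => ?_)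
  · rw [norm_smul, Real.norm_eq_abs]; gcongr; exact hC _
  · have h := (hd (x - R⁻¹ • y)).hasFDerivAt.comp x ((hasFDerivAt_id x).sub_const (R⁻¹ • y))
    exact h.const_smul (ρ y)

theorem IsMollifier.iterate {F : E → V} (hF : BddCont F)
    (hd : Differentiable ℝ F) (hF' : BddCont (fderiv ℝ F)) (R : ℝ) (m : ℕ) :
    BddCont ((mollifyError ρ R)^[m] F) ∧ Differentiable ℝ ((mollifyError ρ R)^[m] F) ∧
      BddCont ((mollifyError ρ R)^[m] (fderiv ℝ F)) ∧
      fderiv ℝ ((mollifyError ρ R)^[m] F) = (mollifyError ρ R)^[m] (fderiv ℝ F) := by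
  induction m with
  | zero => exact ⟨hF, hd, hF', rfl⟩
  | succ m ih =>
    obtain ⟨h1, h2, h3, h4⟩ := ih
    have hh := hρ.hasFDerivAt_mollifyError h1 h2 (h4 ▸ h3) R
    simp only [Function.iterate_succ_apply']
    refine ⟨hρ.bddCont h1 R, fun x => (hh x).differentiableAt, hρ.bddCont h3 R, ?_⟩
    ext1 x
    rw [(hh x).fderiv, h4]

end Mollifier

/-! ### From local to global Hölder bounds; order of approximation -/

section GlobalHolder

variable {E : Type} [NormedAddCommGroup E] [InnerProductSpace ℝ E] [FiniteDimensional ℝ E]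
  [MeasurableSpace E] [BorelSpace E] {V : Type} [NormedAddCommGroup V] [NormedSpace ℝ V]

theorem bddCont_of_hasCompactSupport {F : E → V} (h : Continuous F) (hs : HasCompactSupport F) :
    BddCont F := ⟨h, h.bounded_above_of_compact_support hs⟩

/-- A Lebesgue number `δ` of a finite cover of the support handles points closer than `δ`; for the
others `2M` is at most a multiple of `‖x - y‖ ^ θ`. -/
theorem LocHol.exists_holder {θ : ℝ} (hθ : 0 < θ) {F : E → V} (h : LocHol θ 0 univ F)
    (hs : HasCompactSupport F) :
    ∃ C, 0 ≤ C ∧ ∀ x y, ‖F x - F y‖ ≤ C * ‖x - y‖ ^ θ := by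
  have hc : Continuous F := continuous_iff_continuousAt.2 fun x => h.continuousAt hθ (mem_univ x)
  obtain ⟨M, hM⟩ := hc.bounded_above_of_compact_support hs
  have hM0 : 0 ≤ M := (norm_nonneg _).trans (hM 0)
  choose C N hN hC using fun x => h x (mem_univ x)
  obtain ⟨t, -, ht⟩ := hs.isCompact.elim_nhds_subcover (fun x => interior (N x))
    (fun x _ => isOpen_interior.mem_nhds (mem_interior_iff_mem_nhds.2 (hN x)))
  obtain ⟨δ, hδ, hball⟩ := lebesgue_number_lemma_of_metric (ι := t)
    (c := fun x => interior (N x)) hs.isCompact (fun x => isOpen_interior) (by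
      intro x hx
      obtain ⟨y, hy, hxy⟩ := mem_iUnion₂.1 (ht hx)
      exact mem_iUnion.2 ⟨⟨y, hy⟩, hxy⟩)
  set K : ℝ := ∑ x ∈ t, |C x|
  have hK0 : 0 ≤ K := Finset.sum_nonneg fun _ _ => abs_nonneg _
  have near : ∀ x ∈ tsupport F, ∀ y, ‖x - y‖ < δ → ‖F x - F y‖ ≤ K * ‖x - y‖ ^ θ := by
    intro x hx y hxy
    obtain ⟨i, hi⟩ := hball x hx
    have hx' := interior_subset (hi (Metric.mem_ball_self hδ))
    have hy' := interior_subset (hi (by rwa [Metric.mem_ball, dist_comm, dist_eq_norm] :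
      y ∈ Metric.ball x δ))
    refine (hC i x hx' y hy').trans ?_
    gcongr
    exact (le_abs_self _).trans (Finset.single_le_sum (f := fun x => |C x|)
      (fun _ _ => abs_nonneg _) i.2)
  refine ⟨K + 2 * M / δ ^ θ, by positivity, fun x y => ?_⟩
  have hxy := Real.rpow_nonneg (norm_nonneg (x - y)) θ
  rcases lt_or_ge ‖x - y‖ δ with hlt | hge
  · have hle : K * ‖x - y‖ ^ θ ≤ (K + 2 * M / δ ^ θ) * ‖x - y‖ ^ θ := by
      gcongr; exact le_add_of_nonneg_right (by positivity)
    refine le_trans ?_ hle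
    by_cases hx : x ∈ tsupport F
    · exact near x hx y hlt
    by_cases hy : y ∈ tsupport F
    · rw [norm_sub_rev, norm_sub_rev x y]
      exact near y hy x (by rwa [norm_sub_rev])
    · rw [image_eq_zero_of_notMem_tsupport hx, image_eq_zero_of_notMem_tsupport hy]
      simpa using mul_nonneg hK0 hxy
  · calc ‖F x - F y‖ ≤ ‖F x‖ + ‖F y‖ := norm_sub_le _ _
      _ ≤ 2 * M := by linarith [hM x, hM y]
      _ = 2 * M / δ ^ θ * δ ^ θ := by field_simp
      _ ≤ 2 * M / δ ^ θ * ‖x - y‖ ^ θ := by gcongr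
      _ ≤ _ := by gcongr; exact le_add_of_nonneg_left hK0

/-- Iterated regularization approximates `C^{n,θ}` functions to the order `n + θ`. -/
theorem IsMollifier.norm_iterate_le {ρ : E → ℝ} (hρ : IsMollifier ρ) {θ : ℝ} (hθ : 0 < θ)
    (hθ1 : θ ≤ 1) [CompleteSpace V] {n : ℕ} {F : E → V} (h : LocHol θ n univ F)
    (hs : HasCompactSupport F) :
    ∃ C, 0 ≤ C ∧ ∀ R, 0 < R → ∀ x, ‖(mollifyError ρ R)^[n + 1] F x‖ ≤ C * R ^ (-(n + θ)) := by
  have hcont : Continuous F := continuous_iff_continuousAt.2 fun x => h.continuousAt hθ (mem_univ x)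
  have hI : (0 : ℝ) ≤ ∫ y, (1 + ‖y‖) * |ρ y| := integral_nonneg fun y => by positivity
  induction n generalizing V with
  | zero =>
    obtain ⟨C, hC0, hC⟩ := h.exists_holder hθ hs
    refine ⟨(∫ y, (1 + ‖y‖) * |ρ y|) * C, by positivity, fun R hR x => ?_⟩
    simpa using hρ.norm_mollifyError_le_of_holder hθ hθ1 (bddCont_of_hasCompactSupport hcont hs)
      hC0 hC hR x
  | succ n ih =>
    have hcont' : Continuous (fderiv ℝ F) :=
      continuous_iff_continuousAt.2 fun x => LocHol.continuousAt hθ h.2 (mem_univ x)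
    obtain ⟨C, hC0, hC⟩ := ih h.2 (hs.fderiv (𝕜 := ℝ)) hcont'
    refine ⟨(∫ y, (1 + ‖y‖) * |ρ y|) * C, by positivity, fun R hR x => ?_⟩
    obtain ⟨h1, h2, h3, h4⟩ := hρ.iterate (bddCont_of_hasCompactSupport hcont hs)
      (fun x => h.1 x (mem_univ x))
      (bddCont_of_hasCompactSupport hcont' (hs.fderiv (𝕜 := ℝ))) R (n + 1)
    rw [Function.iterate_succ_apply']
    -- The `(n + 1)`-fold error has derivative of size `R ^ (-(n + θ))`, so it is Lipschitz with
    -- that constant; one more error, with Hölder exponent `1`, gains the missing `R⁻¹`.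
    have hlip : ∀ x y, ‖(mollifyError ρ R)^[n + 1] F x - (mollifyError ρ R)^[n + 1] F y‖ ≤
        C * R ^ (-(n + θ)) * ‖x - y‖ ^ (1 : ℝ) := by
      intro x y
      rw [Real.rpow_one]
      refine convex_univ.norm_image_sub_le_of_norm_fderiv_le (fun z _ => h2 z) (fun z _ => ?_)
        (mem_univ y) (mem_univ x)
      rw [h4]; exact hC R hR z
    refine (hρ.norm_mollifyError_le_of_holder one_pos le_rfl h1 (by positivity) hlip hR x).trans
      (le_of_eq ?_)
    rw [mul_assoc, mul_assoc, mul_assoc, ← Real.rpow_add hR]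
    congr 3
    push_cast; ring

end GlobalHolder

end KleinGordon

namespace KleinGordon

/-! ### Truncation of the transforms of Hölder functions -/

section Localizable

variable {E : Type} [NormedAddCommGroup E] [InnerProductSpace ℝ E] [FiniteDimensional ℝ E]
  [MeasurableSpace E] [BorelSpace E]

/-- A convolution kernel which is bounded by `B` on `L²` and which can be truncated to balls of
radius `R` with an error of order `R^{-t}`. -/
structure Localizable (t B : ℝ) (K : E → ℂ) : Prop where
  continuous : Continuous K
  bounded : ∃ M : ℝ, ∀ η, ‖K η‖ ≤ M
  exists_truncation : ∃ C : ℝ, 0 ≤ C ∧ ∀ R : ℝ, 1 ≤ R → ∃ k : E → ℂ, Continuous k ∧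
    (∀ η, R ≤ ‖η‖ → k η = 0) ∧ OpBound k B ∧ OpBound (fun η => K η - k η) (C * R ^ (-t))

variable {ρ : E → ℝ} (hρ : IsMollifier ρ)
include hρ

theorem IsMollifier.integrable_prod {G : E → ℂ} (hG : Continuous G) (hi : Integrable G) (R : ℝ) :
    Integrable (fun p : E × E => ρ p.2 • G (p.1 - R⁻¹ • p.2)) (volume.prod volume) := by
  have hc : Continuous fun p : E × E => ρ p.2 • G (p.1 - R⁻¹ • p.2) :=
    (hρ.continuous.comp continuous_snd).smul (hG.comp (by fun_prop))
  rw [integrable_prod_iff' hc.aestronglyMeasurable]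
  refine ⟨ae_of_all _ fun y => (hi.comp_sub_right (R⁻¹ • y)).smul (ρ y), ?_⟩
  have : (fun y => ∫ x, ‖ρ y • G (x - R⁻¹ • y)‖) = fun y => |ρ y| * ∫ x, ‖G x‖ := by
    ext y
    simp only [norm_smul, Real.norm_eq_abs]
    rw [integral_const_mul, integral_sub_right_eq_self fun x => ‖G x‖]
  rw [this]
  exact hρ.integrable.abs.mul_const _

theorem IsMollifier.integrable_mollifyError {G : E → ℂ} (hG : Continuous G) (hi : Integrable G)
    (R : ℝ) : Integrable (mollifyError ρ R G) :=
  hi.sub (hρ.integrable_prod hG hi R).integral_prod_left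

theorem IsMollifier.ft_mollifyError {G : E → ℂ} (hG : Continuous G) (hi : Integrable G) (R : ℝ)
    (η : E) :
    ft (mollifyError ρ R G) η = (1 - ft (fun y => (ρ y : ℂ)) (R⁻¹ • η)) * ft G η := by
  have hp := hρ.integrable_prod hG hi R
  have hp' : Integrable (fun p : E × E => wave (-η) p.1 * ρ p.2 • G (p.1 - R⁻¹ • p.2))
      (volume.prod volume) := by
    refine hp.bdd_mul (c := 1) ?_ (ae_of_all _ fun z => (norm_wave _ _).le)
    exact (continuous_wave.comp
      (by fun_prop : Continuous fun p : E × E => (-η, p.1))).aestronglyMeasurable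
  have e1 : ft (mollifyError ρ R G) η
      = ft G η - ft (fun z => ∫ y, ρ y • G (z - R⁻¹ • y)) η := ft_sub hi hp.integral_prod_left η
  have e2 : ft (fun z => ∫ y, ρ y • G (z - R⁻¹ • y)) η
      = ∫ z, ∫ y, wave (-η) z * ρ y • G (z - R⁻¹ • y) := by
    simp only [ft, integral_const_mul]
  have e3 : ∀ y, ∫ z, wave (-η) z * ρ y • G (z - R⁻¹ • y)
      = wave (-(R⁻¹ • η)) y * (ρ y : ℂ) * ft G η := by
    intro y
    rw [← integral_add_right_eq_self _ (R⁻¹ • y), ft, ← integral_const_mul]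
    congr 1; ext z
    rw [add_sub_cancel_right, wave_add_right, ← smul_neg, wave_smul_left, Complex.real_smul]
    ring
  rw [e1, e2, integral_integral_swap hp']
  simp only [e3]
  rw [integral_mul_const, ft, ft]
  ring

/-- The multiplier `(1 - ρ̂(η / R)) ^ m` is `1` for `‖η‖ ≥ R`, so `G` minus its iterated error has
its spectrum in the ball of radius `R`. -/
theorem IsMollifier.iterate_ft {G : E → ℂ} (hG : BddCont G) (hi : Integrable G) (R : ℝ) (m : ℕ) :
    BddCont ((mollifyError ρ R)^[m] G) ∧ Integrable ((mollifyError ρ R)^[m] G) ∧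
    ∀ η, ft ((mollifyError ρ R)^[m] G) η
      = (1 - ft (fun y => (ρ y : ℂ)) (R⁻¹ • η)) ^ m * ft G η := by
  induction m with
  | zero => exact ⟨hG, hi, fun η => by simp⟩
  | succ m ih =>
    obtain ⟨h1, h2, h3⟩ := ih
    simp only [Function.iterate_succ_apply']
    refine ⟨hρ.bddCont h1 R, hρ.integrable_mollifyError h1.1 h2 R, fun η => ?_⟩
    rw [hρ.ft_mollifyError h1.1 h2, h3]; ring

theorem IsMollifier.norm_iterate_le_pow {G : E → ℂ} (hG : Continuous G) {M : ℝ}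
    (hM : ∀ x, ‖G x‖ ≤ M) (R : ℝ) (m : ℕ) (x : E) :
    ‖(mollifyError ρ R)^[m] G x‖ ≤ (1 + ∫ y, |ρ y|) ^ m * M := by
  have : Continuous ((mollifyError ρ R)^[m] G) ∧
      ∀ x, ‖(mollifyError ρ R)^[m] G x‖ ≤ (1 + ∫ y, |ρ y|) ^ m * M := by
    induction m with
    | zero => exact ⟨hG, by simpa using hM⟩
    | succ m ih =>
      simp only [Function.iterate_succ_apply']
      refine ⟨(hρ.bddCont ⟨ih.1, _, ih.2⟩ R).1, fun x => ?_⟩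
      exact (hρ.norm_mollifyError_le ih.1 ih.2 R x).trans (le_of_eq (by ring))
  exact this.2 x

omit hρ in
-- The truncated kernel is the transform of `G` minus its `(n + 1)`-fold error. The remainder is the
-- transform of that error, whose sup norm is `O(R ^ (-(n + θ)))`, and `exists_opBound_ft` makes
-- this an operator bound. The constant `A` is independent of `G`: Hölder norms of `G` only enter
-- the constant of the truncation error, so a coefficient with small sup norm gives a small
-- operator.
theorem exists_localizable (E : Type) [NormedAddCommGroup E] [InnerProductSpace ℝ E]
    [FiniteDimensional ℝ E] [MeasurableSpace E] [BorelSpace E] {θ : ℝ} (hθ : 0 < θ) (hθ1 : θ ≤ 1)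
    (n : ℕ) :
    ∃ A : ℝ, 0 < A ∧ ∀ (G : E → ℂ) (M : ℝ), HasCompactSupport G → LocHol θ n univ G → 0 ≤ M →
      (∀ x, ‖G x‖ ≤ M) → Localizable (n + θ) (A * M) (ft G) := by
  obtain ⟨ρ, hρ⟩ := exists_isMollifier E
  obtain ⟨C₁, hC₁, hop⟩ := exists_opBound_ft E
  set c := 1 + ∫ y, |ρ y|
  have hc : 0 ≤ c := add_nonneg zero_le_one (integral_nonneg fun y => abs_nonneg _)
  refine ⟨C₁ * (1 + c ^ (n + 1)), by positivity, fun G M hs hG hM0 hM => ?_⟩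
  have hcont : Continuous G := continuous_iff_continuousAt.2 fun x => hG.continuousAt hθ (mem_univ x)
  have hi : Integrable G := hcont.integrable_of_hasCompactSupport hs
  refine ⟨continuous_ft hi, ⟨_, norm_ft_le G⟩, ?_⟩
  obtain ⟨C, hC0, hC⟩ := hρ.norm_iterate_le hθ hθ1 hG hs
  refine ⟨C₁ * C, by positivity, fun R hR => ?_⟩
  have hR0 : 0 < R := by linarith
  obtain ⟨h1, h2, h3⟩ := hρ.iterate_ft ⟨hcont, M, hM⟩ hi R (n + 1)
  have hk : ∀ η, ft (fun z => G z - (mollifyError ρ R)^[n + 1] G z) η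
      = ft G η - ft ((mollifyError ρ R)^[n + 1] G) η := ft_sub hi h2
  refine ⟨ft fun z => G z - (mollifyError ρ R)^[n + 1] G z, continuous_ft (hi.sub h2),
    fun η hη => ?_, ?_, ?_⟩
  · rw [hk, h3, hρ.ft_eq_zero]
    · simp
    · rw [norm_smul, norm_inv, Real.norm_of_nonneg hR0.le, inv_mul_eq_div, le_div_iff₀ hR0]
      linarith
  · rw [mul_assoc]
    refine hop _ _ (hi.sub h2) (by positivity) fun x => ?_
    refine (norm_sub_le _ _).trans ?_
    rw [add_mul, one_mul]
    exact add_le_add (hM x) (hρ.norm_iterate_le_pow hcont hM R _ x)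
  · have : (fun η => ft G η - ft (fun z => G z - (mollifyError ρ R)^[n + 1] G z) η)
        = ft ((mollifyError ρ R)^[n + 1] G) := by
      ext η; rw [hk]; ring
    rw [this, mul_assoc]
    exact hop _ _ h2 (by positivity) (hC R hR0)

end Localizable

end KleinGordon

namespace KleinGordon

open scoped ENNReal NNReal

/-! ### Growth of `L²` norms on dyadic shells -/

section Growth

variable {E : Type} [NormedAddCommGroup E] [InnerProductSpace ℝ E] [FiniteDimensional ℝ E]
  [MeasurableSpace E] [BorelSpace E]

/-- The `L²` norm on the set `A`. -/
def locNorm (A : Set E) (V : E → ℂ) : ℝ≥0∞ := eLpNorm V 2 (volume.restrict A)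

theorem locNorm_mono {A A' : Set E} (h : A ⊆ A') (V : E → ℂ) : locNorm A V ≤ locNorm A' V :=
  eLpNorm_mono_measure V (Measure.restrict_mono h le_rfl)

theorem locNorm_eq_indicator {A : Set E} (hA : MeasurableSet A) (V : E → ℂ) :
    locNorm A V = eLpNorm (A.indicator V) 2 :=
  (eLpNorm_indicator_eq_eLpNorm_restrict hA).symm

theorem locNorm_le (A : Set E) (V : E → ℂ) : locNorm A V ≤ eLpNorm V 2 :=
  eLpNorm_restrict_le V 2 volume A

theorem locNorm_congr {A : Set E} (hA : MeasurableSet A) {V W : E → ℂ} (h : EqOn V W A) :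
    locNorm A V = locNorm A W :=
  eLpNorm_congr_ae (ae_restrict_of_forall_mem hA h)

theorem locNorm_add_le {A : Set E} {V W : E → ℂ} (hV : Measurable V) (hW : Measurable W) :
    locNorm A (fun z => V z + W z) ≤ locNorm A V + locNorm A W :=
  eLpNorm_add_le hV.aestronglyMeasurable hW.aestronglyMeasurable (by norm_num)

theorem locNorm_sum_le {κ : Type*} {A : Set E} (s : Finset κ) {V : κ → E → ℂ}
    (hV : ∀ i ∈ s, Measurable (V i)) :
    locNorm A (fun z => ∑ i ∈ s, V i z) ≤ ∑ i ∈ s, locNorm A (V i) := by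
  have := eLpNorm_sum_le (p := 2) (μ := volume.restrict A) (s := s) (f := V)
    (fun i hi => (hV i hi).aestronglyMeasurable) (by norm_num)
  refine le_trans (le_of_eq ?_) this
  rw [locNorm]; congr 1; ext z; simp

theorem locNorm_le_mul {A : Set E} (hA : MeasurableSet A) {V W : E → ℂ} {c : ℝ}
    (h : ∀ z ∈ A, ‖V z‖ ≤ c * ‖W z‖) : locNorm A V ≤ ENNReal.ofReal c * locNorm A W :=
  eLpNorm_le_mul_eLpNorm_of_ae_le_mul (ae_restrict_of_forall_mem hA h) 2

theorem locNorm_union_le {A A' : Set E} (hA : MeasurableSet A) (hA' : MeasurableSet A')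
    {V : E → ℂ} (hV : Measurable V) : locNorm (A ∪ A') V ≤ locNorm A V + locNorm A' V := by
  have e : locNorm (A ∪ A') V = eLpNorm (fun z => A.indicator V z + (A' \ A).indicator V z) 2 := by
    rw [locNorm_eq_indicator (hA.union hA')]
    congr 1; ext z
    by_cases h1 : z ∈ A <;> by_cases h2 : z ∈ A' <;> simp [h1, h2]
  rw [e]
  refine (eLpNorm_add_le (hV.indicator hA).aestronglyMeasurable
    (hV.indicator (hA'.diff hA)).aestronglyMeasurable (by norm_num)).trans ?_
  rw [← locNorm_eq_indicator hA, ← locNorm_eq_indicator (hA'.diff hA)]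
  gcongr
  exact locNorm_mono sdiff_subset V

theorem locNorm_biUnion_le {κ : Type*} (s : Finset κ) {A : κ → Set E}
    (hA : ∀ i, MeasurableSet (A i)) {V : E → ℂ} (hV : Measurable V) :
    locNorm (⋃ i ∈ s, A i) V ≤ ∑ i ∈ s, locNorm (A i) V := by
  classical
  induction s using Finset.induction_on with
  | empty => simp [locNorm]
  | insert i s hi ih =>
    rw [Finset.set_biUnion_insert, Finset.sum_insert hi]
    exact (locNorm_union_le (hA i) (s.measurableSet_biUnion fun i _ => hA i) hV).trans
      (by gcongr)

/-- The dyadic shell `2^{k-m} ≤ 1 + |x| < 2^{k+1+m}`. -/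
def shell (E : Type) [NormedAddCommGroup E] (m k : ℕ) : Set E :=
  {x | (2 : ℝ) ^ k ≤ 2 ^ m * (1 + ‖x‖) ∧ 1 + ‖x‖ < 2 ^ (k + 1 + m)}

theorem measurableSet_shell (m k : ℕ) : MeasurableSet (shell E m k) := by
  have h1 : Measurable fun x : E => (2 : ℝ) ^ m * (1 + ‖x‖) := by fun_prop
  have h2 : Measurable fun x : E => 1 + ‖x‖ := by fun_prop
  exact (h1 measurableSet_Ici).inter (h2 measurableSet_Iio)

theorem shell_mono {m m' : ℕ} (h : m ≤ m') (k : ℕ) : shell E m k ⊆ shell E m' k := by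
  rintro x ⟨h1, h2⟩
  refine ⟨h1.trans ?_, h2.trans_le ?_⟩
  · gcongr; norm_num
  · gcongr; norm_num

theorem exists_mem_shell (x : E) : ∃ k, x ∈ shell E 0 k := by
  obtain ⟨n, h1, h2⟩ := exists_nat_pow_near (by linarith [norm_nonneg x] : (1 : ℝ) ≤ 1 + ‖x‖)
    (by norm_num : (1 : ℝ) < 2)
  exact ⟨n, by simpa using h1, by simpa using h2⟩

theorem shell_zero_index {x : E} {k l : ℕ} (hk : x ∈ shell E 0 k) (hl : x ∈ shell E 0 l) :
    k = l := by
  have a1 := hk.1; have a2 := hk.2; have b1 := hl.1; have b2 := hl.2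
  simp only [pow_zero, one_mul, add_zero] at a1 a2 b1 b2
  have h1 := (pow_lt_pow_iff_right₀ (by norm_num : (1 : ℝ) < 2)).1 (a1.trans_lt b2)
  have h2 := (pow_lt_pow_iff_right₀ (by norm_num : (1 : ℝ) < 2)).1 (b1.trans_lt a2)
  omega

theorem index_of_mem_shell {x : E} {m k l : ℕ} (hk : x ∈ shell E m k) (hl : x ∈ shell E 0 l) :
    k ≤ l + m ∧ l ≤ k + m := by
  have a1 := hk.1; have a2 := hk.2; have b1 := hl.1; have b2 := hl.2
  simp only [pow_zero, one_mul, add_zero] at b1 b2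
  have h1 : (2 : ℝ) ^ k < 2 ^ (m + (l + 1)) := by
    rw [pow_add]; exact a1.trans_lt (by gcongr)
  have h1 := (pow_lt_pow_iff_right₀ (by norm_num : (1 : ℝ) < 2)).1 h1
  have h2 := (pow_lt_pow_iff_right₀ (by norm_num : (1 : ℝ) < 2)).1 (b1.trans_lt a2)
  omega

theorem shell_subset_biUnion (m k : ℕ) :
    shell E m k ⊆ ⋃ l ∈ Finset.Icc (k - m) (k + m), shell E 0 l := by
  intro x hx
  obtain ⟨l, hl⟩ := exists_mem_shell x
  have := index_of_mem_shell hx hl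
  exact mem_biUnion (by simp; omega) hl

theorem volume_shell_lt_top (m k : ℕ) : volume (shell E m k) < ⊤ := by
  refine (measure_mono (fun x hx => ?_)).trans_lt
    (measure_ball_lt_top (x := (0 : E)) (r := 2 ^ (k + 1 + m)))
  rw [mem_ball_zero_iff]
  exact lt_of_le_of_lt (by linarith) hx.2

/-- The `L²` norm of `V` on the intersection of `Γ` with the `k`-th shell is `O(2^{-rk})`. -/
def HasGrowth (r : ℝ) (Γ : Set E) (V : E → ℂ) : Prop :=
  ∃ C : ℝ, 0 ≤ C ∧ ∀ k : ℕ, locNorm (shell E 0 k ∩ Γ) V ≤ ENNReal.ofReal (C * 2 ^ (-(r * k)))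

theorem HasGrowth.mono_set {r : ℝ} {Γ Γ' : Set E} {V : E → ℂ} (h : HasGrowth r Γ V)
    (hs : Γ' ⊆ Γ) : HasGrowth r Γ' V := by
  obtain ⟨C, hC, h⟩ := h
  exact ⟨C, hC, fun k => (locNorm_mono (inter_subset_inter_right _ hs) V).trans (h k)⟩

theorem HasGrowth.mono {r r' : ℝ} {Γ : Set E} {V : E → ℂ} (h : HasGrowth r Γ V)
    (hr : r' ≤ r) : HasGrowth r' Γ V := by
  obtain ⟨C, hC, h⟩ := h
  refine ⟨C, hC, fun k => (h k).trans (ENNReal.ofReal_le_ofReal ?_)⟩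
  gcongr
  norm_num

theorem HasGrowth.add {r : ℝ} {Γ : Set E} {V W : E → ℂ} (hV : HasGrowth r Γ V)
    (hW : HasGrowth r Γ W) (mV : Measurable V) (mW : Measurable W) :
    HasGrowth r Γ fun z => V z + W z := by
  obtain ⟨C, hC, h⟩ := hV
  obtain ⟨C', hC', h'⟩ := hW
  refine ⟨C + C', by positivity, fun k => (locNorm_add_le mV mW).trans ?_⟩
  rw [add_mul, ENNReal.ofReal_add (by positivity) (by positivity)]
  exact add_le_add (h k) (h' k)

theorem HasGrowth.sum {κ : Type*} {r : ℝ} {Γ : Set E} (s : Finset κ) {V : κ → E → ℂ}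
    (h : ∀ i ∈ s, HasGrowth r Γ (V i)) (m : ∀ i ∈ s, Measurable (V i)) :
    HasGrowth r Γ fun z => ∑ i ∈ s, V i z := by
  classical
  induction s using Finset.induction_on with
  | empty => exact ⟨0, le_rfl, fun k => by simp [locNorm]⟩
  | insert i s hi ih =>
    simp only [Finset.sum_insert hi]
    exact (h i (Finset.mem_insert_self i s)).add
      (ih (fun j hj => h j (Finset.mem_insert_of_mem hj))
        fun j hj => m j (Finset.mem_insert_of_mem hj))
      (m i (Finset.mem_insert_self i s))
      (Finset.measurable_sum s fun j hj => m j (Finset.mem_insert_of_mem hj))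

/-- Multiplication with a function of order `a` lowers the growth exponent by `a`. -/
theorem HasGrowth.of_le {r a : ℝ} {Γ : Set E} (hΓ : MeasurableSet Γ) {V W : E → ℂ}
    (hV : HasGrowth r Γ V) {c : ℝ} (hc : 0 ≤ c)
    (h : ∀ k, ∀ z ∈ shell E 0 k ∩ Γ, ‖W z‖ ≤ c * 2 ^ (a * k) * ‖V z‖) :
    HasGrowth (r - a) Γ W := by
  obtain ⟨C, hC, hV⟩ := hV
  refine ⟨c * C, by positivity, fun k => ?_⟩
  refine (locNorm_le_mul ((measurableSet_shell 0 k).inter hΓ) (h k)).trans ?_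
  refine (mul_le_mul_right (hV k) _).trans ?_
  rw [← ENNReal.ofReal_mul (by positivity)]
  refine ENNReal.ofReal_le_ofReal (le_of_eq ?_)
  have : (2 : ℝ) ^ (-((r - a) * k)) = 2 ^ (a * k) * 2 ^ (-(r * k)) := by
    rw [← Real.rpow_add (by norm_num)]; congr 1; ring
  rw [this]; ring

theorem HasGrowth.shell_le {r : ℝ} {Γ : Set E} (hΓ : MeasurableSet Γ) {V : E → ℂ}
    (hV : HasGrowth r Γ V) (mV : Measurable V) (m : ℕ) :
    ∃ C : ℝ, 0 ≤ C ∧ ∀ k : ℕ,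
      locNorm (shell E m k ∩ Γ) V ≤ ENNReal.ofReal (C * 2 ^ (-(r * k))) := by
  obtain ⟨C, hC, h⟩ := hV
  -- At most `2m + 1` shells are met, and an index shift by at most `m` costs at most `2 ^ (|r| m)`.
  refine ⟨(2 * m + 1) * (C * 2 ^ (|r| * m)), by positivity, fun k => ?_⟩
  have hsub : shell E m k ∩ Γ ⊆ ⋃ l ∈ Finset.Icc (k - m) (k + m), (shell E 0 l ∩ Γ) := by
    rintro x ⟨hx, hx'⟩
    obtain ⟨l, hl, hxl⟩ := mem_iUnion₂.1 (shell_subset_biUnion m k hx)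
    exact mem_biUnion hl ⟨hxl, hx'⟩
  refine (locNorm_mono hsub V).trans ((locNorm_biUnion_le _
    (fun l => (measurableSet_shell 0 l).inter hΓ) mV).trans ?_)
  have hb : ∀ l ∈ Finset.Icc (k - m) (k + m), locNorm (shell E 0 l ∩ Γ) V
      ≤ ENNReal.ofReal (C * 2 ^ (|r| * m) * 2 ^ (-(r * k))) := by
    intro l hl
    refine (h l).trans (ENNReal.ofReal_le_ofReal ?_)
    rw [mul_assoc, ← Real.rpow_add (by norm_num)]
    refine mul_le_mul_of_nonneg_left (Real.rpow_le_rpow_of_exponent_le (by norm_num) ?_) hC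
    simp only [Finset.mem_Icc] at hl
    have h1 : |(k : ℝ) - l| ≤ m := by
      rw [abs_le]
      have a : (k : ℝ) ≤ l + m := by exact_mod_cast (by omega : k ≤ l + m)
      have b : (l : ℝ) ≤ k + m := by exact_mod_cast hl.2
      constructor <;> linarith
    have h2 : r * ((k : ℝ) - l) ≤ |r| * m :=
      (le_abs_self _).trans (by rw [abs_mul]; gcongr)
    linarith
  refine (Finset.sum_le_card_nsmul _ _ _ hb).trans ?_
  rw [nsmul_eq_mul, ← ENNReal.ofReal_natCast, ← ENNReal.ofReal_mul (by positivity)]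
  refine ENNReal.ofReal_le_ofReal ?_
  have : ((Finset.Icc (k - m) (k + m)).card : ℝ) ≤ 2 * m + 1 := by
    rw [Nat.card_Icc]; exact_mod_cast (by omega)
  rw [mul_assoc (2 * (m : ℝ) + 1)]
  gcongr

end Growth

end KleinGordon

namespace KleinGordon

open scoped ENNReal NNReal

/-! ### Interaction of separated frequencies -/

section Blocks

variable {E : Type} [NormedAddCommGroup E] [InnerProductSpace ℝ E] [FiniteDimensional ℝ E]
  [MeasurableSpace E] [BorelSpace E]

theorem measurable_conv {K V : E → ℂ} (hK : Continuous K) (hV : Measurable V) :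
    Measurable (conv K V) := by
  have h : StronglyMeasurable (Function.uncurry fun w ζ : E => K (w - ζ) * V ζ) := by
    have h1 : Measurable fun p : E × E => K (p.1 - p.2) * V p.2 :=
      (hK.measurable.comp (measurable_fst.sub measurable_snd)).mul (hV.comp measurable_snd)
    exact h1.stronglyMeasurable
  exact (h.integral_prod_right (ν := volume)).measurable

theorem integrable_mul_of_bounded {K f : E → ℂ} (hK : Continuous K) {M : ℝ}
    (hM : ∀ η, ‖K η‖ ≤ M) (hf : Integrable f) (w : E) : Integrable fun ζ => K (w - ζ) * f ζ :=
  hf.bdd_mul (hK.comp (by fun_prop : Continuous fun ζ : E => w - ζ)).aestronglyMeasurable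
    (ae_of_all _ fun ζ => hM _)

theorem conv_add_left {K K' f : E → ℂ} {w : E} (h : Integrable fun ζ => K (w - ζ) * f ζ)
    (h' : Integrable fun ζ => K' (w - ζ) * f ζ) :
    conv (fun η => K η + K' η) f w = conv K f w + conv K' f w := by
  simp only [conv, add_mul]
  exact integral_add h h'

theorem conv_add_right {K f g : E → ℂ} {w : E} (h : Integrable fun ζ => K (w - ζ) * f ζ)
    (h' : Integrable fun ζ => K (w - ζ) * g ζ) :
    conv K (fun ζ => f ζ + g ζ) w = conv K f w + conv K g w := by
  simp only [conv, mul_add]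
  exact integral_add h h'

theorem conv_sum_right {κ : Type*} {K : E → ℂ} (s : Finset κ) {f : κ → E → ℂ} {w : E}
    (h : ∀ i ∈ s, Integrable fun ζ => K (w - ζ) * f i ζ) :
    conv K (fun ζ => ∑ i ∈ s, f i ζ) w = ∑ i ∈ s, conv K (f i) w := by
  simp only [conv, Finset.mul_sum]
  exact integral_finsetSum s h

theorem bounded_of_compact {k : E → ℂ} (hk : Continuous k) {R : ℝ} (h : ∀ η, R ≤ ‖η‖ → k η = 0) :
    ∃ M : ℝ, ∀ η, ‖k η‖ ≤ M := by
  refine hk.bounded_above_of_compact_support (HasCompactSupport.intro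
    (isCompact_closedBall (0 : E) R) fun x hx => h x ?_)
  simp only [Metric.mem_closedBall, dist_zero_right, not_le] at hx
  exact hx.le

theorem conv_split {K k f : E → ℂ} (hK : Continuous K) (hk : Continuous k) {M M' : ℝ}
    (hM : ∀ η, ‖K η‖ ≤ M) (hM' : ∀ η, ‖k η‖ ≤ M') (hf : Integrable f) (w : E) :
    conv K f w = conv k f w + conv (fun η => K η - k η) f w := by
  have i1 := integrable_mul_of_bounded hk hM' hf w
  have i0 := integrable_mul_of_bounded hK hM hf w
  have i2 : Integrable fun ζ => (K (w - ζ) - k (w - ζ)) * f ζ :=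
    (i0.sub i1).congr (ae_of_all _ fun ζ => by simp [sub_mul])
  unfold conv
  rw [← integral_add i1 i2]
  congr 1; ext ζ; ring

/-- Truncation of a localizable kernel, with the boundedness facts that make convolutions with
integrable functions meaningful. -/
theorem Localizable.truncation {t B : ℝ} {K : E → ℂ} (hK : Localizable t B K) :
    ∃ C : ℝ, 0 ≤ C ∧ ∀ R : ℝ, 1 ≤ R → ∃ k : E → ℂ, Continuous k ∧
      (∀ η, R ≤ ‖η‖ → k η = 0) ∧ OpBound k B ∧ OpBound (fun η => K η - k η) (C * R ^ (-t)) ∧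
      ∀ f : E → ℂ, Integrable f → ∀ w, conv K f w = conv k f w + conv (fun η => K η - k η) f w := by
  obtain ⟨C, hC, h⟩ := hK.exists_truncation
  obtain ⟨M, hM⟩ := hK.bounded
  refine ⟨C, hC, ?_⟩
  intro R hR
  obtain ⟨k, h1, h2, h3, h4⟩ := h R hR
  obtain ⟨M', hM'⟩ := bounded_of_compact h1 h2
  exact ⟨k, h1, h2, h3, h4, fun f hf w => conv_split hK.continuous h1 hM hM' hf w⟩

theorem Localizable.opBound {t B : ℝ} {K : E → ℂ} (hK : Localizable t B K) :
    ∃ B' : ℝ, 0 ≤ B' ∧ OpBound K B' := by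
  obtain ⟨C, hC, h⟩ := hK.truncation
  obtain ⟨k, h1, h2, h3, h4, h5⟩ := h 1 le_rfl
  -- The constant is read off the truncation at `R = 1`; no sign of `B` is assumed, hence `|B|`.
  refine ⟨|B| + C, by positivity, fun f hf hf2 => ?_⟩
  have e : conv K f = fun w => conv k f w + conv (fun η => K η - k η) f w :=
    funext fun w => h5 f hf w
  have m1 : AEStronglyMeasurable (conv k f) volume := by
    have : AEStronglyMeasurable (fun p : E × E => k (p.1 - p.2) * f p.2) (volume.prod volume) :=
      (h1.comp (by fun_prop : Continuous fun p : E × E => p.1 - p.2)).aestronglyMeasurable.mul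
        hf.1.comp_snd
    exact this.integral_prod_right'
  have m2 : AEStronglyMeasurable (conv (fun η => K η - k η) f) volume := by
    have : AEStronglyMeasurable (fun p : E × E => (K (p.1 - p.2) - k (p.1 - p.2)) * f p.2)
        (volume.prod volume) :=
      ((hK.continuous.sub h1).comp
        (by fun_prop : Continuous fun p : E × E => p.1 - p.2)).aestronglyMeasurable.mul
        hf.1.comp_snd
    exact this.integral_prod_right'
  rw [e]
  refine (eLpNorm_add_le m1 m2 (by norm_num)).trans ?_
  rw [ENNReal.ofReal_add (by positivity) hC, add_mul]
  refine add_le_add ((h3 f hf hf2).trans ?_) ((h4 f hf hf2).trans ?_)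
  · gcongr; exact le_abs_self B
  · simp

/-- A localizable kernel connects separated sets only weakly. -/
theorem Localizable.separated {t B : ℝ} {K : E → ℂ} (ht : 0 < t) (hK : Localizable t B K) :
    ∃ C : ℝ, 0 ≤ C ∧ (∀ f : E → ℂ, Integrable f → MemLp f 2 →
        eLpNorm (conv K f) 2 ≤ ENNReal.ofReal C * eLpNorm f 2) ∧
      ∀ R : ℝ, 0 < R → ∀ A : Set E, MeasurableSet A → ∀ f : E → ℂ, Integrable f → MemLp f 2 →
        (∀ w ∈ A, ∀ ζ, f ζ ≠ 0 → R ≤ ‖w - ζ‖) →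
        locNorm A (conv K f) ≤ ENNReal.ofReal (C * R ^ (-t)) * eLpNorm f 2 := by
  obtain ⟨C, hC, h⟩ := hK.truncation
  obtain ⟨B', hB', hop⟩ := hK.opBound
  refine ⟨B' + C, by positivity, fun f hf hf2 => (hop f hf hf2).trans (by gcongr; linarith),
    fun R hR A hA f hf hf2 hs => ?_⟩
  rcases le_or_gt 1 R with h1 | h1
  · obtain ⟨k, -, h2, -, h4, h5⟩ := h R h1
    have : EqOn (conv K f) (conv (fun η => K η - k η) f) A := by
      intro w hw
      rw [h5 f hf w]
      have : conv k f w = 0 := by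
        refine integral_eq_zero_of_ae (ae_of_all _ fun ζ => ?_)
        by_cases hz : f ζ = 0
        · simp [hz]
        · simp [h2 _ (hs w hw ζ hz)]
      rw [this, zero_add]
    rw [locNorm_congr hA this]
    refine (locNorm_le _ _).trans ((h4 f hf hf2).trans ?_)
    gcongr; linarith
  -- For `R < 1` there is no truncation to use, but `R ^ (-t) ≥ 1` and the global bound suffices.
  · refine (locNorm_le _ _).trans ((hop f hf hf2).trans ?_)
    gcongr
    have : 1 ≤ R ^ (-t) := Real.one_le_rpow_of_pos_of_le_one_of_nonpos hR h1.le (by linarith)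
    nlinarith

/-- With truncated subtraction, `k - l + (l - k)` is `|k - l|`: the sum is a part of a two-sided
geometric series and is bounded uniformly in `k`. -/
theorem sum_geometric_dist_le {q : ℝ} (hq : 0 < q) (hq1 : q < 1) (k n : ℕ) :
    ∑ l ∈ Finset.range n, q ^ (k - l + (l - k)) ≤ 2 / (1 - q) := by
  have hgeo : ∀ m, ∑ j ∈ Finset.range m, q ^ j ≤ (1 - q)⁻¹ := fun m =>
    (Summable.sum_le_tsum _ (fun _ _ => by positivity)
      (summable_geometric_of_lt_one hq.le hq1)).trans_eq (tsum_geometric_of_lt_one hq.le hq1)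
  have hn : n ≤ k + (n + 1) := by omega
  calc ∑ l ∈ Finset.range n, q ^ (k - l + (l - k))
      ≤ ∑ l ∈ Finset.range (k + (n + 1)), q ^ (k - l + (l - k)) :=
        Finset.sum_le_sum_of_subset_of_nonneg (Finset.range_mono hn) fun _ _ _ => by positivity
    _ = ∑ l ∈ Finset.range k, q ^ (k - l) + ∑ j ∈ Finset.range (n + 1), q ^ j := by
        rw [Finset.sum_range_add]
        congr 1
        · refine Finset.sum_congr rfl fun l hl => ?_
          rw [Finset.mem_range] at hl
          rw [show k - l + (l - k) = k - l by omega]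
        · refine Finset.sum_congr rfl fun l hl => ?_
          rw [show k - (k + l) + (k + l - k) = l by omega]
    _ ≤ (1 - q)⁻¹ + (1 - q)⁻¹ := by
        refine add_le_add ?_ (hgeo _)
        have : ∑ l ∈ Finset.range k, q ^ (k - l) = q * ∑ j ∈ Finset.range k, q ^ j := by
          rw [← Finset.sum_range_reflect, Finset.mul_sum]
          refine Finset.sum_congr rfl fun l hl => ?_
          rw [Finset.mem_range] at hl
          rw [← pow_succ']; congr 1; omega
        rw [this]
        have h1 := hgeo k
        have h0 : 0 ≤ ∑ j ∈ Finset.range k, q ^ j := Finset.sum_nonneg fun _ _ => by positivity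
        nlinarith
    _ = _ := by rw [div_eq_mul_inv]; ring

/-- The cone `Γ'` is separated from the complement of `Γ`. -/
def ConeSep (c : ℝ) (Γ' Γ : Set E) : Prop :=
  ∀ w ∈ Γ', ∀ ζ, ζ ∉ Γ → c * ‖w‖ ≤ ‖w - ζ‖ ∧ c * ‖ζ‖ ≤ ‖w - ζ‖

/-- Either `ζ` leaves the cone and the angle separates it from `w`, or it leaves the wide shell and
the norms differ by a fixed factor. The condition `2 ≤ max k l` makes `‖·‖` comparable with `1 +
‖·‖` at the larger of the two points. -/
theorem ConeSep.dist_le {c : ℝ} (hc : 0 < c) {Γ' Γ : Set E} (h : ConeSep c Γ' Γ) {k l : ℕ}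
    {w ζ : E} (hw : w ∈ shell E 1 k ∩ Γ') (hζ : ζ ∈ shell E 0 l \ (shell E 3 k ∩ Γ))
    (hm : 2 ≤ max k l) : min c 1 / 4 * 2 ^ (max k l) ≤ ‖w - ζ‖ := by
  obtain ⟨⟨w1, w2⟩, hwΓ⟩ := hw
  obtain ⟨⟨z1, z2⟩, hz⟩ := hζ
  simp only [pow_zero, one_mul, add_zero, pow_one] at w1 w2 z1 z2
  have hc0 : 0 < min c 1 := lt_min hc one_pos
  by_cases hΓ : ζ ∈ Γ
  · have hsh : ζ ∉ shell E 3 k := fun h' => hz ⟨h', hΓ⟩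
    have h1 : min c 1 ≤ 1 := min_le_right _ _
    have nw := norm_nonneg w
    have nz := norm_nonneg ζ
    simp only [shell, mem_ofPred_eq, not_and_or, not_le, not_lt] at hsh
    have key : (2 : ℝ) ^ (max k l) / 4 ≤ ‖w - ζ‖ := by
      rcases hsh with hs | hs
      · have hlk : l ≤ k := by
          have : (2 : ℝ) ^ l < 2 ^ k := by nlinarith
          exact ((pow_lt_pow_iff_right₀ (by norm_num : (1 : ℝ) < 2)).1 this).le
        rw [max_eq_left hlk]
        have := norm_sub_norm_le w ζ
        linarith
      · have hkl : k ≤ l := by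
          have : (2 : ℝ) ^ (k + 4) < 2 ^ (l + 1) := lt_of_le_of_lt hs z2
          have := (pow_lt_pow_iff_right₀ (by norm_num : (1 : ℝ) < 2)).1 this
          omega
        rw [max_eq_right hkl]
        have := norm_sub_norm_le ζ w
        rw [norm_sub_rev] at this
        have e1 : (2 : ℝ) ^ (k + 1 + 3) = 4 * 2 ^ (k + 1 + 1) := by ring
        linarith
    calc min c 1 / 4 * 2 ^ (max k l) ≤ 1 / 4 * 2 ^ (max k l) := by gcongr
      _ ≤ _ := by linarith
  · obtain ⟨h1, h2⟩ := h w hwΓ ζ hΓ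
    have big : (4 : ℝ) ≤ 2 ^ (max k l) := by
      calc (4 : ℝ) = 2 ^ 2 := by norm_num
        _ ≤ _ := by gcongr; norm_num
    have h3 : c * (2 ^ (max k l) / 4) ≤ ‖w - ζ‖ := by
      rcases le_total k l with hkl | hkl
      · rw [max_eq_right hkl] at big ⊢
        refine le_trans ?_ h2
        gcongr; linarith
      · rw [max_eq_left hkl] at big ⊢
        refine le_trans ?_ h1
        gcongr; linarith
    calc min c 1 / 4 * 2 ^ (max k l) ≤ c / 4 * 2 ^ (max k l) := by gcongr; exact min_le_left _ _
      _ = c * (2 ^ (max k l) / 4) := by ring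
      _ ≤ _ := h3

/-- The part of a convolution with frequencies far from the output is of lower order. -/
theorem Localizable.far {t B s c : ℝ} {K V : E → ℂ} (hK : Localizable t B K) (hs : s < 0)
    (hst : 0 < s + t) (hc : 0 < c) {Γ' Γ : Set E} (hsep : ConeSep c Γ' Γ)
    (mΓ : MeasurableSet Γ) (mV : Measurable V) (hV : HasGrowth s univ V)
    (hint : ∀ w, Integrable fun ζ => K (w - ζ) * V ζ) :
    ∃ C : ℝ, 0 ≤ C ∧ ∀ (k : ℕ) (A : Set E), MeasurableSet A → A ⊆ shell E 1 k ∩ Γ' →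
      locNorm A (conv K ((shell E 3 k ∩ Γ)ᶜ.indicator V)) ≤
        ENNReal.ofReal (C * 2 ^ (-((s + t) * k))) := by
  have ht : 0 < t := by linarith
  obtain ⟨C₁, hC₁, hall, hsepK⟩ := hK.separated ht
  obtain ⟨C₂, hC₂, hV⟩ := hV
  set c' : ℝ := min c 1 / 4
  have hc' : 0 < c' := by have := lt_min hc one_pos; positivity
  -- The term `c' ^ (-t)` serves the separated pairs of shells; `2 ^ t` compensates the weight for
  -- the few pairs with `max k l ≤ 1`.
  set C₃ : ℝ := C₁ * (c' ^ (-t) + 2 ^ t)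
  have hC₃ : 0 ≤ C₃ := by positivity
  -- Relative to `2 ^ (-((s + t) k))`, the block `l` has size `2 ^ (s (k - l))` for `l ≤ k` and `2 ^
  -- (-(s + t)(l - k))` for `l ≥ k`. Both decay, by `s < 0` and `0 < s + t` respectively.
  set q : ℝ := max (2 ^ s) (2 ^ (-(s + t)))
  have hq : 0 < q := lt_max_of_lt_left (by positivity)
  have hq1 : q < 1 := max_lt (Real.rpow_lt_one_of_one_lt_of_neg (by norm_num) hs)
    (Real.rpow_lt_one_of_one_lt_of_neg (by norm_num) (by linarith))
  refine ⟨C₃ * C₂ * (2 / (1 - q)), by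
    have : 0 < 1 - q := by linarith
    positivity, fun k A mA hA => ?_⟩
  set P := shell E 3 k ∩ Γ
  have mP : MeasurableSet P := (measurableSet_shell 3 k).inter mΓ
  set g : ℕ → E → ℂ := fun l => (shell E 0 l \ P).indicator V
  have mS : ∀ l, MeasurableSet (shell E 0 l \ P) := fun l => (measurableSet_shell 0 l).diff mP
  have mg : ∀ l, Measurable (g l) := fun l => mV.indicator (mS l)
  have ng : ∀ l, eLpNorm (g l) 2 ≤ ENNReal.ofReal (C₂ * 2 ^ (-(s * l))) := fun l => by
    rw [← locNorm_eq_indicator (mS l)]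
    refine (locNorm_mono ?_ V).trans (hV l)
    rw [inter_univ]; exact sdiff_subset
  have g2 : ∀ l, MemLp (g l) 2 := fun l =>
    ⟨(mg l).aestronglyMeasurable, (ng l).trans_lt ENNReal.ofReal_lt_top⟩
  have gi : ∀ l, Integrable (g l) := fun l => by
    have hfin : IsFiniteMeasure (volume.restrict (shell E 0 l)) :=
      ⟨by rw [Measure.restrict_apply_univ]; exact volume_shell_lt_top 0 l⟩
    have : MemLp (g l) 1 (volume.restrict (shell E 0 l)) :=
      ((g2 l).restrict _).mono_exponent (by norm_num)
    rw [memLp_one_iff_integrable] at this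
    refine (integrableOn_iff_integrable_of_support_subset ?_).1 this
    exact (support_indicator_subset).trans sdiff_subset
  have block : ∀ l, locNorm A (conv K (g l)) ≤
      ENNReal.ofReal (C₃ * C₂ * 2 ^ (-((s + t) * k)) * q ^ (k - l + (l - k))) := by
    intro l
    have h1 : locNorm A (conv K (g l)) ≤
        ENNReal.ofReal (C₃ * 2 ^ (-(t * (max k l : ℕ)))) * eLpNorm (g l) 2 := by
      rcases le_or_gt 2 (max k l) with hm | hm
      · refine (hsepK (c' * 2 ^ (max k l)) (by positivity) A mA (g l) (gi l) (g2 l)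
          fun w hw ζ hζ => hsep.dist_le hc (hA hw) (mem_of_indicator_ne_zero hζ) hm).trans ?_
        refine mul_le_mul_left (ENNReal.ofReal_le_ofReal ?_) _
        rw [Real.mul_rpow hc'.le (by positivity), ← Real.rpow_natCast, ← Real.rpow_mul (by norm_num)]
        rw [show ((max k l : ℕ) : ℝ) * -t = -(t * (max k l : ℕ)) by ring, ← mul_assoc]
        gcongr
        simp only [C₃]
        gcongr
        exact le_add_of_nonneg_right (by positivity)
      · refine (locNorm_le _ _).trans ((hall (g l) (gi l) (g2 l)).trans ?_)
        gcongr
        have hm' : ((max k l : ℕ) : ℝ) ≤ 1 := by exact_mod_cast (by omega : max k l ≤ 1)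
        calc C₁ = C₁ * (2 ^ t * 2 ^ (-t)) := by rw [← Real.rpow_add (by norm_num)]; simp
          _ ≤ C₁ * ((c' ^ (-t) + 2 ^ t) * 2 ^ (-(t * (max k l : ℕ)))) := by
            gcongr
            · exact le_add_of_nonneg_left (by positivity)
            · norm_num
            · nlinarith
          _ = _ := by simp only [C₃]; ring
    refine h1.trans ((mul_le_mul_right (ng l) _).trans ?_)
    rw [← ENNReal.ofReal_mul (by positivity)]
    refine ENNReal.ofReal_le_ofReal ?_
    have h2 : (2 : ℝ) ^ (-(t * (max k l : ℕ))) * 2 ^ (-(s * l)) ≤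
        2 ^ (-((s + t) * k)) * q ^ (k - l + (l - k)) := by
      rcases le_total l k with hlk | hlk
      · rw [max_eq_left hlk, show k - l + (l - k) = k - l by omega]
        calc (2 : ℝ) ^ (-(t * k)) * 2 ^ (-(s * l))
            = 2 ^ (-((s + t) * k)) * (2 ^ s) ^ (k - l) := by
              rw [← Real.rpow_natCast (2 ^ s), ← Real.rpow_mul (by norm_num),
                ← Real.rpow_add (by norm_num), ← Real.rpow_add (by norm_num), Nat.cast_sub hlk]
              congr 1; ring
          _ ≤ _ := by gcongr; exact le_max_left _ _
      · rw [max_eq_right hlk, show k - l + (l - k) = l - k by omega]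
        calc (2 : ℝ) ^ (-(t * l)) * 2 ^ (-(s * l))
            = 2 ^ (-((s + t) * k)) * (2 ^ (-(s + t))) ^ (l - k) := by
              rw [← Real.rpow_natCast (2 ^ (-(s + t))), ← Real.rpow_mul (by norm_num),
                ← Real.rpow_add (by norm_num), ← Real.rpow_add (by norm_num), Nat.cast_sub hlk]
              congr 1; ring
          _ ≤ _ := by gcongr; exact le_max_right _ _
    calc C₃ * 2 ^ (-(t * (max k l : ℕ))) * (C₂ * 2 ^ (-(s * l)))
        = C₃ * C₂ * (2 ^ (-(t * (max k l : ℕ))) * 2 ^ (-(s * l))) := by ring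
      _ ≤ C₃ * C₂ * (2 ^ (-((s + t) * k)) * q ^ (k - l + (l - k))) := by gcongr
      _ = _ := by ring
  obtain ⟨M, hM⟩ := hK.bounded
  have hsum : ∀ n z, ∑ l ∈ Finset.range n, g l z =
      (Pᶜ ∩ {z | 1 + ‖z‖ < 2 ^ n}).indicator V z := by
    intro n z
    obtain ⟨j, hj⟩ := exists_mem_shell z
    have hgl : ∀ l, l ≠ j → g l z = 0 := fun l hl =>
      indicator_of_notMem (fun h => hl (shell_zero_index h.1 hj)) V
    have hjn : 1 + ‖z‖ < 2 ^ n ↔ j < n := by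
      have a := hj.1; have b := hj.2
      simp only [pow_zero, one_mul, add_zero] at a b
      constructor
      · intro h
        exact (pow_lt_pow_iff_right₀ (by norm_num : (1 : ℝ) < 2)).1 (a.trans_lt h)
      · intro h
        exact b.trans_le (by gcongr; · norm_num
                             · omega)
    by_cases hlt : j < n
    · rw [Finset.sum_eq_single j (fun l _ hl => hgl l hl) (fun h => absurd (Finset.mem_range.2 hlt) h)]
      by_cases hp : z ∈ P
      · simp only [g]
        rw [indicator_of_notMem fun h => h.2 hp, indicator_of_notMem fun h => h.1 hp]
      · simp only [g]
        rw [indicator_of_mem (show z ∈ shell E 0 j \ P from ⟨hj, hp⟩),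
          indicator_of_mem (show z ∈ Pᶜ ∩ {z | 1 + ‖z‖ < 2 ^ n} from ⟨hp, hjn.2 hlt⟩)]
    · rw [Finset.sum_eq_zero, indicator_of_notMem]
      · rintro ⟨-, h⟩; exact hlt (hjn.1 h)
      · intro l hl
        refine hgl l ?_
        rintro rfl
        exact hlt (Finset.mem_range.1 hl)
  -- `V` need not be globally in `L²`, so the operator bound only applies to finitely many shells.
  -- Partial sums converge pointwise by dominated convergence, and Fatou's lemma passes the uniform
  -- `L²` bound to the limit.
  have lim : ∀ w, Tendsto (fun n => conv K (fun z => ∑ l ∈ Finset.range n, g l z) w) atTop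
      (𝓝 (conv K (Pᶜ.indicator V) w)) := by
    intro w
    refine tendsto_integral_of_dominated_convergence (fun ζ => ‖K (w - ζ) * V ζ‖) (fun n => ?_)
      (hint w).norm (fun n => ae_of_all _ fun ζ => ?_) (ae_of_all _ fun ζ => ?_)
    · exact (((hK.continuous.comp (by fun_prop : Continuous fun ζ : E => w - ζ)).measurable).mul
        (Finset.measurable_sum _ fun l _ => mg l)).aestronglyMeasurable
    · simp only [hsum, norm_mul]
      gcongr
      exact norm_indicator_le_norm_self _ _
    · obtain ⟨j, hj⟩ := exists_mem_shell ζ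
      refine tendsto_const_nhds.congr' ?_
      filter_upwards [eventually_gt_atTop j] with n hn
      have b := hj.2
      simp only [add_zero] at b
      have : ζ ∈ {z : E | 1 + ‖z‖ < 2 ^ n} := by
        exact b.trans_le (by gcongr; · norm_num
                             · omega)
      simp only [hsum]
      congr 1
      by_cases hp : ζ ∈ Pᶜ
      · rw [indicator_of_mem hp,
          indicator_of_mem (show ζ ∈ Pᶜ ∩ {z | 1 + ‖z‖ < 2 ^ n} from ⟨hp, this⟩)]
      · rw [indicator_of_notMem hp, indicator_of_notMem fun h => hp h.1]
  have bound : ∀ n, locNorm A (conv K fun z => ∑ l ∈ Finset.range n, g l z) ≤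
      ENNReal.ofReal (C₃ * C₂ * (2 / (1 - q)) * 2 ^ (-((s + t) * k))) := by
    intro n
    have e : (conv K fun z => ∑ l ∈ Finset.range n, g l z)
        = fun w => ∑ l ∈ Finset.range n, conv K (g l) w := by
      ext w
      exact conv_sum_right _ fun l _ => integrable_mul_of_bounded hK.continuous hM (gi l) w
    rw [e]
    refine (locNorm_sum_le _ fun l _ => measurable_conv hK.continuous (mg l)).trans ?_
    refine (Finset.sum_le_sum fun l _ => block l).trans ?_
    rw [← ENNReal.ofReal_sum_of_nonneg fun l _ => by positivity]
    refine ENNReal.ofReal_le_ofReal ?_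
    rw [← Finset.mul_sum]
    calc _ ≤ C₃ * C₂ * 2 ^ (-((s + t) * k)) * (2 / (1 - q)) := by
          gcongr; exact sum_geometric_dist_le hq hq1 k n
      _ = _ := by ring
  refine (Lp.eLpNorm_lim_le_liminf_eLpNorm (fun n => (measurable_conv hK.continuous
    (Finset.measurable_sum _ fun l _ => mg l)).aestronglyMeasurable) _
    (ae_of_all _ lim)).trans ?_
  refine liminf_le_of_frequently_le' (Frequently.of_forall fun n => bound n)

end Blocks

end KleinGordon

namespace KleinGordon

open scoped ENNReal NNReal

/-! ### Growth and weighted integrals; existence and associativity of convolutions -/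

section Weights

variable {E : Type} [NormedAddCommGroup E] [InnerProductSpace ℝ E] [FiniteDimensional ℝ E]
  [MeasurableSpace E] [BorelSpace E]

theorem rpow_le_of_comparable {x y c : ℝ} (hx : 0 < x) (hy : 0 < y) (hc : 1 ≤ c) (h1 : x ≤ c * y)
    (h2 : y ≤ c * x) (s : ℝ) : x ^ s ≤ c ^ |s| * y ^ s := by
  have hc0 : 0 < c := by linarith
  rcases le_total 0 s with hs | hs
  · rw [abs_of_nonneg hs, ← Real.mul_rpow hc0.le hy.le]
    gcongr
  · rw [abs_of_nonpos hs, Real.rpow_neg hc0.le, ← Real.inv_rpow hc0.le,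
      ← Real.mul_rpow (by positivity) hy.le]
    refine Real.rpow_le_rpow_of_nonpos (by positivity) ?_ hs
    rw [inv_mul_le_iff₀ hc0]; exact h2

theorem rpow_weight_le {k : ℕ} {x : E} (hx : x ∈ shell E 0 k) (s : ℝ) :
    (1 + ‖x‖) ^ s ≤ 2 ^ |s| * 2 ^ (s * k) := by
  have a := hx.1; have b := hx.2
  simp only [pow_zero, one_mul, add_zero] at a b
  have := rpow_le_of_comparable (x := 1 + ‖x‖) (y := 2 ^ k) (c := 2) (by positivity)
    (by positivity) (by norm_num) (by rw [pow_succ] at b; linarith) (by linarith [norm_nonneg x]) s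
  rwa [← Real.rpow_natCast, ← Real.rpow_mul (by norm_num), mul_comm (k : ℝ) s] at this

theorem locNorm_sq (A : Set E) (V : E → ℂ) : locNorm A V ^ (2 : ℝ) = ∫⁻ z in A, ‖V z‖ₑ ^ (2 : ℝ) :=
  eLpNorm_nnreal_pow_eq_lintegral (p := 2) (by norm_num)

/-- The strict loss `a < r` makes the contributions of the shells a convergent geometric series. -/
theorem HasGrowth.integrableOn {r a : ℝ} {Γ : Set E} (hΓ : MeasurableSet Γ) {V : E → ℂ}
    (mV : Measurable V) (hV : HasGrowth r Γ V) (ha : a < r) :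
    IntegrableOn (fun x => ((1 + ‖x‖) ^ a * ‖V x‖) ^ 2) Γ := by
  obtain ⟨C, hC, hV⟩ := hV
  have hm : Measurable fun x : E => ((1 + ‖x‖) ^ a * ‖V x‖) ^ 2 := by fun_prop
  refine ⟨hm.aestronglyMeasurable, ?_⟩
  have hcover : Γ ⊆ ⋃ k, shell E 0 k ∩ Γ := fun x hx => by
    obtain ⟨k, hk⟩ := exists_mem_shell x
    exact mem_iUnion.2 ⟨k, hk, hx⟩
  set q : ℝ := (2 ^ (a - r)) ^ 2
  have hq1 : q < 1 := by
    have : (2 : ℝ) ^ (a - r) < 1 :=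
      Real.rpow_lt_one_of_one_lt_of_neg (by norm_num) (by linarith)
    exact pow_lt_one₀ (by positivity) this (by norm_num)
  have hblock : ∀ k : ℕ, ∫⁻ x in shell E 0 k ∩ Γ, ‖((1 + ‖x‖) ^ a * ‖V x‖) ^ 2‖ₑ ≤
      ENNReal.ofReal ((2 ^ |a| * C) ^ 2 * q ^ k) := by
    intro k
    have h1 : ∀ x ∈ shell E 0 k ∩ Γ, ‖((1 + ‖x‖) ^ a * ‖V x‖) ^ 2‖ₑ ≤
        ENNReal.ofReal ((2 ^ |a| * 2 ^ (a * k)) ^ 2) * ‖V x‖ₑ ^ (2 : ℝ) := by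
      intro x hx
      rw [Real.enorm_of_nonneg (by positivity), ← ofReal_norm (V x),
        ENNReal.ofReal_rpow_of_nonneg (norm_nonneg _) (by norm_num),
        ← ENNReal.ofReal_mul (by positivity)]
      refine ENNReal.ofReal_le_ofReal ?_
      rw [mul_pow, Real.rpow_two]
      gcongr
      exact rpow_weight_le hx.1 a
    refine (setLIntegral_mono' ((measurableSet_shell 0 k).inter hΓ) h1).trans ?_
    rw [lintegral_const_mul' _ _ ENNReal.ofReal_ne_top, ← locNorm_sq]
    calc _ ≤ ENNReal.ofReal ((2 ^ |a| * 2 ^ (a * k)) ^ 2) *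
          ENNReal.ofReal (C * 2 ^ (-(r * k))) ^ (2 : ℝ) := by gcongr; exact hV k
      _ = _ := by
        rw [ENNReal.ofReal_rpow_of_nonneg (by positivity) (by norm_num),
          ← ENNReal.ofReal_mul (by positivity), Real.rpow_two]
        congr 1
        have : q ^ k = (2 ^ (a * k) * 2 ^ (-(r * k))) ^ 2 := by
          simp only [q]
          rw [← pow_mul, mul_comm 2 k, pow_mul, ← Real.rpow_natCast (2 ^ (a - r)) k,
            ← Real.rpow_mul (by norm_num), ← Real.rpow_add (by norm_num)]
          congr 2; ring
        rw [this]; ring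
  calc ∫⁻ x in Γ, ‖((1 + ‖x‖) ^ a * ‖V x‖) ^ 2‖ₑ
      ≤ ∫⁻ x in ⋃ k, shell E 0 k ∩ Γ, ‖((1 + ‖x‖) ^ a * ‖V x‖) ^ 2‖ₑ := lintegral_mono_set hcover
    _ ≤ ∑' k, ∫⁻ x in shell E 0 k ∩ Γ, ‖((1 + ‖x‖) ^ a * ‖V x‖) ^ 2‖ₑ := lintegral_iUnion_le _ _
    _ ≤ ∑' k, ENNReal.ofReal ((2 ^ |a| * C) ^ 2 * q ^ k) := ENNReal.tsum_le_tsum hblock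
    _ < ⊤ := by
      have : Summable fun k => (2 ^ |a| * C) ^ 2 * q ^ k :=
        (summable_geometric_of_lt_one (by positivity) hq1).mul_left _
      exact this.tsum_ofReal_lt_top

/-- One shell is bounded by the whole integral, so nothing is lost in this direction; on the shell
the weight is comparable to `4 ^ (s k)`. -/
theorem hasGrowth_of_integrable {s : ℝ} {V : E → ℂ}
    (h : Integrable fun x : E => (1 + ‖x‖ ^ 2) ^ s * ‖V x‖ ^ 2) : HasGrowth s univ V := by
  set I := ∫⁻ x : E, ‖(1 + ‖x‖ ^ 2) ^ s * ‖V x‖ ^ 2‖ₑ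
  have hI : I ≠ ⊤ := h.2.ne
  refine ⟨(4 ^ |s| * I.toReal) ^ (1 / 2 : ℝ), by positivity, fun k => ?_⟩
  rw [inter_univ]
  have key : locNorm (shell E 0 k) V ^ (2 : ℝ) ≤
      ENNReal.ofReal (((4 ^ |s| * I.toReal) ^ (1 / 2 : ℝ) * 2 ^ (-(s * k))) ^ (2 : ℝ)) := by
    rw [locNorm_sq]
    have h1 : ∀ x ∈ shell E 0 k, ‖V x‖ₑ ^ (2 : ℝ) ≤
        ENNReal.ofReal (4 ^ |s| * (2 ^ (-(s * k))) ^ 2) *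
          ‖(1 + ‖x‖ ^ 2) ^ s * ‖V x‖ ^ 2‖ₑ := by
      intro x hx
      have a := hx.1; have b := hx.2
      simp only [pow_zero, one_mul, add_zero] at a b
      rw [Real.enorm_of_nonneg (by positivity), ← ofReal_norm (V x),
        ENNReal.ofReal_rpow_of_nonneg (norm_nonneg _) (by norm_num),
        ← ENNReal.ofReal_mul (by positivity)]
      refine ENNReal.ofReal_le_ofReal ?_
      rw [Real.rpow_two, ← mul_assoc]
      refine le_mul_of_one_le_left (by positivity) ?_
      have nx := norm_nonneg x
      rw [pow_succ] at b
      have hp : (0 : ℝ) < 2 ^ k := by positivity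
      have := rpow_le_of_comparable (x := ((2 : ℝ) ^ k) ^ 2) (y := 1 + ‖x‖ ^ 2) (c := 4)
        (by positivity) (by positivity) (by norm_num) (by nlinarith [sq_nonneg (‖x‖ - 1)])
        (by nlinarith) s
      have e : (((2 : ℝ) ^ k) ^ 2) ^ s * (2 ^ (-(s * k))) ^ 2 = 1 := by
        rw [← Real.rpow_natCast 2 k, ← Real.rpow_natCast _ 2, ← Real.rpow_natCast _ 2,
          ← Real.rpow_mul (by norm_num), ← Real.rpow_mul (by norm_num),
          ← Real.rpow_mul (by norm_num), ← Real.rpow_add (by norm_num)]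
        rw [show (k : ℝ) * ((2 : ℕ) * s) + -(s * k) * (2 : ℕ) = 0 by ring, Real.rpow_zero]
      calc (1 : ℝ) = (((2 : ℝ) ^ k) ^ 2) ^ s * (2 ^ (-(s * k))) ^ 2 := e.symm
        _ ≤ 4 ^ |s| * (1 + ‖x‖ ^ 2) ^ s * (2 ^ (-(s * k))) ^ 2 := by gcongr
        _ = _ := by ring
    refine (setLIntegral_mono' (measurableSet_shell 0 k) h1).trans ?_
    rw [lintegral_const_mul' _ _ ENNReal.ofReal_ne_top]
    refine (mul_le_mul_right (setLIntegral_le_lintegral _ _) _).trans ?_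
    rw [Real.mul_rpow (by positivity) (by positivity), ← Real.rpow_mul (by positivity)]
    change _ * I ≤ _
    conv_lhs => rw [← ENNReal.ofReal_toReal hI]
    rw [← ENNReal.ofReal_mul (by positivity)]
    refine ENNReal.ofReal_le_ofReal (le_of_eq ?_)
    norm_num
    ring
  rw [← ENNReal.ofReal_rpow_of_nonneg (by positivity) (by norm_num)] at key
  exact (ENNReal.rpow_le_rpow_iff (by norm_num)).1 key

theorem one_add_norm_le_mul (x y : E) : 1 + ‖x‖ ≤ (1 + ‖x - y‖) * (1 + ‖y‖) := by
  have : ‖x‖ ≤ ‖x - y‖ + ‖y‖ := by simpa using norm_add_le (x - y) y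
  nlinarith [norm_nonneg (x - y), norm_nonneg y]

/-- Convolutions of kernels and functions of complementary growth converge. -/
theorem integrable_conv_of_growth {t s : ℝ} {K V : E → ℂ} (mK : Measurable K) (mV : Measurable V)
    (hK : HasGrowth t univ K) (hV : HasGrowth s univ V) (hst : 0 < s + t) (w : E) :
    Integrable fun ζ => K (w - ζ) * V ζ := by
  obtain ⟨a, ha1, ha2⟩ : ∃ a, -s < a ∧ a < t := exists_between (by linarith)
  have iK := hK.integrableOn MeasurableSet.univ mK ha2
  have iV := hV.integrableOn MeasurableSet.univ mV (a := -a) (by linarith)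
  rw [integrableOn_univ] at iK iV
  have iK' := iK.comp_sub_left w
  have hb := (iK'.add iV).const_mul ((1 + ‖w‖) ^ |a|)
  refine hb.mono ((mK.comp (measurable_const.sub measurable_id)).mul mV).aestronglyMeasurable
    (ae_of_all _ fun ζ => ?_)
  have pos1 : 0 < 1 + ‖w - ζ‖ := by positivity
  have pos2 : 0 < 1 + ‖ζ‖ := by positivity
  -- Peetre's inequality: for fixed `w` the weights at `ζ` and at `w - ζ` are comparable, so the
  -- exponents `a` and `-a` can be inserted. The product of the two weighted factors is then at most
  -- the sum of their squares.
  have h1 : 1 ≤ (1 + ‖w‖) ^ |a| * ((1 + ‖w - ζ‖) ^ a * (1 + ‖ζ‖) ^ (-a)) := by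
    have := rpow_le_of_comparable (x := 1 + ‖ζ‖) (y := 1 + ‖w - ζ‖) (c := 1 + ‖w‖) pos2 pos1
      (by linarith [norm_nonneg w]) (by
        have := one_add_norm_le_mul ζ w
        rw [norm_sub_rev] at this; linarith)
      (by
        have := one_add_norm_le_mul (w - ζ) w
        rw [sub_sub_cancel_left, norm_neg] at this; linarith) a
    calc (1 : ℝ) = (1 + ‖ζ‖) ^ a * (1 + ‖ζ‖) ^ (-a) := by
          rw [← Real.rpow_add pos2]; simp
      _ ≤ ((1 + ‖w‖) ^ |a| * (1 + ‖w - ζ‖) ^ a) * (1 + ‖ζ‖) ^ (-a) := by gcongr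
      _ = _ := by ring
  set A := (1 + ‖w - ζ‖) ^ a * ‖K (w - ζ)‖ with hA
  set B := (1 + ‖ζ‖) ^ (-a) * ‖V ζ‖ with hB
  have h2 : ‖K (w - ζ) * V ζ‖ ≤ (1 + ‖w‖) ^ |a| * (A * B) := by
    rw [norm_mul]
    calc ‖K (w - ζ)‖ * ‖V ζ‖ = 1 * (‖K (w - ζ)‖ * ‖V ζ‖) := (one_mul _).symm
      _ ≤ ((1 + ‖w‖) ^ |a| * ((1 + ‖w - ζ‖) ^ a * (1 + ‖ζ‖) ^ (-a))) *
          (‖K (w - ζ)‖ * ‖V ζ‖) := by gcongr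
      _ = _ := by rw [hA, hB]; ring
  refine h2.trans ?_
  rw [Real.norm_of_nonneg (by simp only [Pi.add_apply]; positivity)]
  simp only [Pi.add_apply]
  gcongr
  nlinarith [sq_nonneg (A - B), sq_nonneg (A + B)]

/-- Associativity of convolution, for a kernel `K`, a rapidly decreasing `ψ` and `V` such that `K`
and `V` have complementary growth. -/
theorem conv_assoc {t s : ℝ} {K ψ V : E → ℂ} (mK : Measurable K) (mψ : Measurable ψ)
    (mV : Measurable V) (hK : HasGrowth t univ K) (hV : HasGrowth s univ V) (hst : 0 < s + t)
    (hψ : ∀ a : ℝ, Integrable fun x => (1 + ‖x‖) ^ a * ‖ψ x‖) (w : E) :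
    conv K (conv ψ V) w = conv (conv K ψ) V w := by
  obtain ⟨a, ha1, ha2⟩ : ∃ a, -s < a ∧ a < t := exists_between (by linarith)
  have iK := hK.integrableOn MeasurableSet.univ mK ha2
  have iV := hV.integrableOn MeasurableSet.univ mV (a := -a) (by linarith)
  rw [integrableOn_univ] at iK iV
  have iK' := iK.comp_sub_left w
  have mΦ : Measurable fun p : E × E => K (w - p.1) * (ψ (p.1 - p.2) * V p.2) := by fun_prop
  set f : E → ℝ := fun x => (1 + ‖x‖) ^ |a| * ‖ψ x‖ with hf
  have mf : Measurable f := by fun_prop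
  have i1 : Integrable (fun p : E × E => f (p.1 - p.2) *
      ((1 + ‖p.2‖) ^ (-a) * ‖V p.2‖) ^ 2) (volume.prod volume) := by
    have m1 : Measurable fun p : E × E => f (p.1 - p.2) *
      ((1 + ‖p.2‖) ^ (-a) * ‖V p.2‖) ^ 2 := by fun_prop
    rw [integrable_prod_iff' m1.aestronglyMeasurable]
    refine ⟨ae_of_all _ fun y => ((hψ |a|).comp_sub_right y).mul_const
      (((1 + ‖y‖) ^ (-a) * ‖V y‖) ^ 2), ?_⟩
    have : (fun y => ∫ x, ‖f (x - y) * ((1 + ‖y‖) ^ (-a) * ‖V y‖) ^ 2‖) =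
        fun y => (∫ x, ‖f x‖) * ((1 + ‖y‖) ^ (-a) * ‖V y‖) ^ 2 := by
      ext y
      simp only [norm_mul]
      rw [integral_mul_const, integral_sub_right_eq_self fun x => ‖f x‖,
        Real.norm_of_nonneg (r := ((1 + ‖y‖) ^ (-a) * ‖V y‖) ^ 2) (by positivity)]
    rw [this]
    exact iV.const_mul _
  have i2 : Integrable (fun p : E × E => f (p.1 - p.2) *
      ((1 + ‖w - p.1‖) ^ a * ‖K (w - p.1)‖) ^ 2) (volume.prod volume) := by
    have m1 : Measurable fun p : E × E => f (p.1 - p.2) *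
      ((1 + ‖w - p.1‖) ^ a * ‖K (w - p.1)‖) ^ 2 := by fun_prop
    rw [integrable_prod_iff m1.aestronglyMeasurable]
    refine ⟨ae_of_all _ fun x => ((hψ |a|).comp_sub_left x).mul_const
      (((1 + ‖w - x‖) ^ a * ‖K (w - x)‖) ^ 2), ?_⟩
    have : (fun x => ∫ y, ‖f (x - y) * ((1 + ‖w - x‖) ^ a * ‖K (w - x)‖) ^ 2‖) =
        fun x => (∫ y, ‖f y‖) * ((1 + ‖w - x‖) ^ a * ‖K (w - x)‖) ^ 2 := by
      ext x
      simp only [norm_mul]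
      rw [integral_mul_const, integral_sub_left_eq_self (fun y => ‖f y‖) _ x,
        Real.norm_of_nonneg (r := ((1 + ‖w - x‖) ^ a * ‖K (w - x)‖) ^ 2) (by positivity)]
    rw [this]
    exact iK'.const_mul _
  -- Absolute integrability for Fubini: Peetre's inequality is applied twice, and the rapid decay of
  -- `ψ` pays for the factor `(1 + ‖x - y‖) ^ |a|`.
  have hΦ : Integrable (fun p : E × E => K (w - p.1) * (ψ (p.1 - p.2) * V p.2))
      (volume.prod volume) := by
    refine ((i1.add i2).const_mul ((1 + ‖w‖) ^ |a|)).mono mΦ.aestronglyMeasurable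
      (ae_of_all _ fun p => ?_)
    obtain ⟨x, y⟩ := p
    simp only [Pi.add_apply]
    have pos1 : 0 < 1 + ‖w - x‖ := by positivity
    have pos2 : 0 < 1 + ‖y‖ := by positivity
    have pos3 : 0 < 1 + ‖x - y‖ := by positivity
    have c1 : 1 + ‖y‖ ≤ (1 + ‖w‖) * (1 + ‖x - y‖) * (1 + ‖w - x‖) := by
      have e1 := one_add_norm_le_mul y x
      have e2 := one_add_norm_le_mul x w
      rw [norm_sub_rev y x] at e1
      rw [norm_sub_rev x w] at e2
      calc _ ≤ _ := e1
        _ ≤ (1 + ‖x - y‖) * ((1 + ‖w - x‖) * (1 + ‖w‖)) := by gcongr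
        _ = _ := by ring
    have c2 : 1 + ‖w - x‖ ≤ (1 + ‖w‖) * (1 + ‖x - y‖) * (1 + ‖y‖) := by
      have e1 := one_add_norm_le_mul (w - x) w
      have e2 := one_add_norm_le_mul x y
      rw [sub_sub_cancel_left, norm_neg] at e1
      calc _ ≤ _ := e1
        _ ≤ ((1 + ‖x - y‖) * (1 + ‖y‖)) * (1 + ‖w‖) := by gcongr
        _ = _ := by ring
    have hc : 1 ≤ (1 + ‖w‖) * (1 + ‖x - y‖) := by
      nlinarith [norm_nonneg w, norm_nonneg (x - y), mul_nonneg (norm_nonneg w) (norm_nonneg (x - y))]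
    have h1 : 1 ≤ (1 + ‖w‖) ^ |a| * (1 + ‖x - y‖) ^ |a| *
        ((1 + ‖w - x‖) ^ a * (1 + ‖y‖) ^ (-a)) := by
      have := rpow_le_of_comparable pos2 pos1 hc c1 c2 a
      rw [Real.mul_rpow (by positivity) pos3.le] at this
      calc (1 : ℝ) = (1 + ‖y‖) ^ a * (1 + ‖y‖) ^ (-a) := by rw [← Real.rpow_add pos2]; simp
        _ ≤ ((1 + ‖w‖) ^ |a| * (1 + ‖x - y‖) ^ |a| * (1 + ‖w - x‖) ^ a) * (1 + ‖y‖) ^ (-a) := by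
          gcongr
        _ = _ := by ring
    set A := (1 + ‖w - x‖) ^ a * ‖K (w - x)‖ with hA
    set B := (1 + ‖y‖) ^ (-a) * ‖V y‖ with hB
    have hfn : 0 ≤ f (x - y) := by rw [hf]; positivity
    rw [Real.norm_of_nonneg (by positivity), norm_mul, norm_mul]
    calc ‖K (w - x)‖ * (‖ψ (x - y)‖ * ‖V y‖) = 1 * (‖K (w - x)‖ * (‖ψ (x - y)‖ * ‖V y‖)) :=
          (one_mul _).symm
      _ ≤ ((1 + ‖w‖) ^ |a| * (1 + ‖x - y‖) ^ |a| * ((1 + ‖w - x‖) ^ a * (1 + ‖y‖) ^ (-a))) *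
          (‖K (w - x)‖ * (‖ψ (x - y)‖ * ‖V y‖)) := by gcongr
      _ = (1 + ‖w‖) ^ |a| * (f (x - y) * (A * B)) := by rw [hA, hB, hf]; ring
      _ ≤ (1 + ‖w‖) ^ |a| * (f (x - y) * (B ^ 2 + A ^ 2)) := by
        gcongr
        nlinarith [sq_nonneg (A - B), sq_nonneg (A + B)]
      _ = _ := by ring
  calc conv K (conv ψ V) w = ∫ x, ∫ y, K (w - x) * (ψ (x - y) * V y) := by
        simp only [conv, integral_const_mul]
    _ = ∫ y, ∫ x, K (w - x) * (ψ (x - y) * V y) := integral_integral_swap hΦ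
    _ = _ := by
        simp only [conv]
        congr 1; ext y
        rw [← integral_mul_const, ← integral_add_right_eq_self _ y]
        congr 1; ext x
        rw [add_sub_cancel_right, sub_sub, add_comm y x]
        ring

end Weights

end KleinGordon

namespace KleinGordon

open scoped ENNReal NNReal

/-! ### Convolution estimates on cones -/

section Absorption

variable {E : Type} [NormedAddCommGroup E] [InnerProductSpace ℝ E] [FiniteDimensional ℝ E]
  [MeasurableSpace E] [BorelSpace E]

theorem integrable_indicator_of_locNorm {A : Set E} (hA : MeasurableSet A) {m k : ℕ}
    (hs : A ⊆ shell E m k) {V : E → ℂ} (mV : Measurable V) (hV : locNorm A V < ⊤) :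
    Integrable (A.indicator V) ∧ MemLp (A.indicator V) 2 := by
  have h2 : MemLp (A.indicator V) 2 :=
    ⟨(mV.indicator hA).aestronglyMeasurable, by rwa [← locNorm_eq_indicator hA]⟩
  have hfin : IsFiniteMeasure (volume.restrict (shell E m k)) :=
    ⟨by rw [Measure.restrict_apply_univ]; exact volume_shell_lt_top m k⟩
  have : MemLp (A.indicator V) 1 (volume.restrict (shell E m k)) :=
    (h2.restrict _).mono_exponent (by norm_num)
  rw [memLp_one_iff_integrable] at this
  exact ⟨(integrableOn_iff_integrable_of_support_subset
    (support_indicator_subset.trans hs)).1 this, h2⟩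

theorem conv_indicator_add {K V : E → ℂ} {A : Set E} (hA : MeasurableSet A) {w : E}
    (h : Integrable fun ζ => K (w - ζ) * V ζ) :
    conv K V w = conv K (A.indicator V) w + conv K (Aᶜ.indicator V) w := by
  have e : ∀ B : Set E, (fun ζ => K (w - ζ) * B.indicator V ζ) =
      B.indicator fun ζ => K (w - ζ) * V ζ := fun B => by
    ext ζ
    by_cases hz : ζ ∈ B <;> simp [hz]
  rw [← conv_add_right (by rw [e]; exact h.indicator hA) (by rw [e]; exact h.indicator hA.compl)]
  simp only [conv]
  congr 1; ext ζ
  by_cases hz : ζ ∈ A <;> simp [hz]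

/-- Convolution with a localizable kernel preserves growth, up to a loss in the cone and up to the
order of the kernel. -/
theorem Localizable.hasGrowth_conv {t B s r c : ℝ} {K V : E → ℂ} (hK : Localizable t B K)
    (hs : s < 0) (hst : 0 < s + t) (hc : 0 < c) {Γ' Γ : Set E} (hsep : ConeSep c Γ' Γ)
    (mΓ' : MeasurableSet Γ') (mΓ : MeasurableSet Γ) (mV : Measurable V)
    (hV : HasGrowth s univ V) (hVΓ : HasGrowth r Γ V)
    (hint : ∀ w, Integrable fun ζ => K (w - ζ) * V ζ) :
    HasGrowth (min r (s + t)) Γ' (conv K V) := by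
  obtain ⟨C₁, hC₁, hfar⟩ := hK.far hs hst hc hsep mΓ mV hV hint
  obtain ⟨B', hB', hop⟩ := hK.opBound
  obtain ⟨C₂, hC₂, hnear⟩ := hVΓ.shell_le mΓ mV 3
  refine ⟨B' * C₂ + C₁, by positivity, fun k => ?_⟩
  set P := shell E 3 k ∩ Γ
  have mP : MeasurableSet P := (measurableSet_shell 3 k).inter mΓ
  have mA : MeasurableSet (shell E 0 k ∩ Γ') := (measurableSet_shell 0 k).inter mΓ'
  obtain ⟨i1, i2⟩ := integrable_indicator_of_locNorm mP inter_subset_left mV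
    ((hnear k).trans_lt ENNReal.ofReal_lt_top)
  rw [show conv K V = fun w => conv K (P.indicator V) w + conv K (Pᶜ.indicator V) w from
    funext fun w => conv_indicator_add mP (hint w)]
  refine (locNorm_add_le (measurable_conv hK.continuous (mV.indicator mP))
    (measurable_conv hK.continuous (mV.indicator mP.compl))).trans ?_
  have e1 : (2 : ℝ) ^ (-(r * k)) ≤ 2 ^ (-(min r (s + t) * k)) := by
    gcongr
    · norm_num
    · exact min_le_left _ _
  have e2 : (2 : ℝ) ^ (-((s + t) * k)) ≤ 2 ^ (-(min r (s + t) * k)) := by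
    gcongr
    · norm_num
    · exact min_le_right _ _
  rw [add_mul, ENNReal.ofReal_add (by positivity) (by positivity)]
  refine add_le_add ?_ ((hfar k _ mA (inter_subset_inter_left _ (shell_mono (by norm_num) k))).trans
    (ENNReal.ofReal_le_ofReal (by gcongr)))
  refine (locNorm_le _ _).trans ((hop _ i1 i2).trans ?_)
  rw [← locNorm_eq_indicator mP]
  refine (mul_le_mul_right (hnear k) _).trans ?_
  rw [← ENNReal.ofReal_mul hB']
  refine ENNReal.ofReal_le_ofReal ?_
  rw [← mul_assoc]
  gcongr

/-- Growth has to be checked on the distant shells only. -/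
theorem HasGrowth.of_large {r r' : ℝ} {Γ : Set E} {V : E → ℂ} (hV : HasGrowth r Γ V) {C : ℝ}
    (hC : 0 ≤ C) (k₀ : ℕ)
    (h : ∀ k, k₀ ≤ k → locNorm (shell E 0 k ∩ Γ) V ≤ ENNReal.ofReal (C * 2 ^ (-(r' * k)))) :
    HasGrowth r' Γ V := by
  obtain ⟨C₁, hC₁, h₁⟩ := hV
  refine ⟨C + C₁ * 2 ^ (|r' - r| * k₀), by positivity, fun k => ?_⟩
  rcases le_or_gt k₀ k with hk | hk
  · refine (h k hk).trans (ENNReal.ofReal_le_ofReal ?_)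
    gcongr
    exact le_add_of_nonneg_right (by positivity)
  · refine (h₁ k).trans (ENNReal.ofReal_le_ofReal ?_)
    have hk' : (k : ℝ) ≤ k₀ := by exact_mod_cast hk.le
    have : (2 : ℝ) ^ (-(r * k)) ≤ 2 ^ (|r' - r| * k₀) * 2 ^ (-(r' * k)) := by
      rw [← Real.rpow_add (by norm_num)]
      refine Real.rpow_le_rpow_of_exponent_le (by norm_num) ?_
      have : (r' - r) * k ≤ |r' - r| * k₀ := by
        refine (mul_le_mul_of_nonneg_right (le_abs_self _) (by positivity)).trans ?_
        gcongr
      linarith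
    calc C₁ * 2 ^ (-(r * k)) ≤ C₁ * (2 ^ (|r' - r| * k₀) * 2 ^ (-(r' * k))) := by gcongr
      _ ≤ _ := by
        rw [add_mul, mul_assoc]
        exact le_add_of_nonneg_left (by positivity)

/-- A kernel vanishing beyond the radius `R` sees, from `A`, only the `R`-thickening of `A`. The
main term can therefore stay localised, with the small constant `B`. -/
theorem locNorm_conv_thickening {B t C R : ℝ} {K k f : E → ℂ} (hk : Continuous k)
    (hR : ∀ η, R ≤ ‖η‖ → k η = 0) (hop : OpBound k B)
    (hop' : OpBound (fun η => K η - k η) (C * R ^ (-t))) (hK : Continuous K)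
    (hsplit : ∀ w, conv K f w = conv k f w + conv (fun η => K η - k η) f w)
    (mf : Measurable f) (hf : Integrable f) (hf2 : MemLp f 2) {A : Set E} (hA : MeasurableSet A) :
    locNorm A (conv K f) ≤ ENNReal.ofReal B * locNorm (Metric.thickening R A) f +
      ENNReal.ofReal (C * R ^ (-t)) * eLpNorm f 2 := by
  have mT : MeasurableSet (Metric.thickening R A) := Metric.isOpen_thickening.measurableSet
  rw [funext hsplit]
  refine (locNorm_add_le (measurable_conv hk mf) (measurable_conv (hK.sub hk) mf)).trans
    (add_le_add ?_ ((locNorm_le _ _).trans (hop' f hf hf2)))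
  have e : EqOn (conv k f) (conv k ((Metric.thickening R A).indicator f)) A := by
    intro w hw
    simp only [conv]
    congr 1; ext ζ
    by_cases hz : ζ ∈ Metric.thickening R A
    · rw [indicator_of_mem hz]
    · rw [hR (w - ζ), zero_mul, zero_mul]
      by_contra hlt
      push Not at hlt
      exact hz (Metric.mem_thickening_iff.2 ⟨w, hw, by rwa [dist_eq_norm, norm_sub_rev]⟩)
  rw [locNorm_congr hA e, locNorm_eq_indicator mT]
  exact (locNorm_le _ _).trans (hop _ (hf.indicator mT) (hf2.indicator mT))

end Absorption

end KleinGordon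

namespace KleinGordon

open scoped ENNReal NNReal

/-! ### Absorbing a small operator by successive thickening -/

section Absorption

variable {E : Type} [NormedAddCommGroup E] [InnerProductSpace ℝ E] [FiniteDimensional ℝ E]
  [MeasurableSpace E] [BorelSpace E]

/-- There are three contributions: frequencies within `2 ^ (k / 2)` of `A`, with the constant `B`;
the other near frequencies, by the truncation error; the far ones, by `Localizable.far`. The
majorant `V` replaces `V'` so that several convolutions can be absorbed into one norm. -/
theorem Localizable.locNorm_conv_le {t B s r c : ℝ} {K V' V : E → ℂ} (hK : Localizable t B K)
    (hs : s < 0) (hst : 0 < s + t) (ht : 1 ≤ t) (hc : 0 < c) {Γ' Γ : Set E}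
    (hsep : ConeSep c Γ' Γ) (mΓ : MeasurableSet Γ) (mV' : Measurable V') (mV : Measurable V)
    (hle : ∀ w, ‖V' w‖ ≤ ‖V w‖) (hV : HasGrowth s univ V) (hVΓ : HasGrowth r Γ V)
    (hint : ∀ w, Integrable fun ζ => K (w - ζ) * V' ζ) :
    ∃ C : ℝ, 0 ≤ C ∧ ∀ (k : ℕ) (A : Set E), MeasurableSet A → A ⊆ shell E 1 k ∩ Γ' →
      locNorm A (conv K V') ≤
        ENNReal.ofReal B * locNorm (shell E 3 k ∩ Γ ∩ Metric.thickening (2 ^ ((k : ℝ) / 2)) A) V +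
          ENNReal.ofReal (C * 2 ^ (-(min (r + 1 / 2) (s + t) * k))) := by
  have one_le : ∀ A : Set E, MeasurableSet A → locNorm A V' ≤ locNorm A V := fun A hA => by
    have := locNorm_le_mul hA (c := 1) (V := V') (W := V) fun z _ => by simpa using hle z
    simpa using this
  have hV' : HasGrowth s univ V' := by
    obtain ⟨C, hC, h⟩ := hV
    exact ⟨C, hC, fun k => (one_le _ ((measurableSet_shell 0 k).inter MeasurableSet.univ)).trans
      (h k)⟩
  obtain ⟨C₁, hC₁, hfar⟩ := hK.far hs hst hc hsep mΓ mV' hV' hint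
  obtain ⟨C₂, hC₂, htr⟩ := hK.truncation
  obtain ⟨C₃, hC₃, hnear⟩ := hVΓ.shell_le mΓ mV 3
  refine ⟨C₂ * C₃ + C₁, by positivity, fun k A mA hA => ?_⟩
  set P := shell E 3 k ∩ Γ
  have mP : MeasurableSet P := (measurableSet_shell 3 k).inter mΓ
  obtain ⟨i1, i2⟩ := integrable_indicator_of_locNorm mP inter_subset_left mV'
    (((one_le _ mP).trans (hnear k)).trans_lt ENNReal.ofReal_lt_top)
  -- The radius is a compromise: as `t ≥ 1`, `R ^ (-t)` still gains `2 ^ (-k / 2)`, while `k`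
  -- thickenings by `R` remain negligible against `2 ^ k`.
  set R : ℝ := 2 ^ ((k : ℝ) / 2)
  have hR : 1 ≤ R := Real.one_le_rpow (by norm_num) (by positivity)
  obtain ⟨κ, hκ, hκR, op1, op2, hsplit⟩ := htr R hR
  rw [show conv K V' = fun w => conv K (P.indicator V') w + conv K (Pᶜ.indicator V') w from
    funext fun w => conv_indicator_add mP (hint w)]
  refine (locNorm_add_le (measurable_conv hK.continuous (mV'.indicator mP))
    (measurable_conv hK.continuous (mV'.indicator mP.compl))).trans ?_
  have h1 := locNorm_conv_thickening hκ hκR op1 op2 hK.continuous (hsplit _ i1)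
    (mV'.indicator mP) i1 i2 mA
  have mT : MeasurableSet (Metric.thickening R A) := Metric.isOpen_thickening.measurableSet
  have h2 : locNorm (Metric.thickening R A) (P.indicator V') ≤
      locNorm (P ∩ Metric.thickening R A) V := by
    rw [locNorm_eq_indicator mT, indicator_indicator, inter_comm,
      ← locNorm_eq_indicator (mP.inter mT)]
    exact one_le _ (mP.inter mT)
  have h3 : eLpNorm (P.indicator V') 2 ≤ ENNReal.ofReal (C₃ * 2 ^ (-(r * k))) := by
    rw [← locNorm_eq_indicator mP]
    exact (one_le _ mP).trans (hnear k)
  refine (add_le_add (h1.trans (add_le_add (mul_le_mul_right h2 _) (mul_le_mul_right h3 _)))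
    (hfar k A mA hA)).trans ?_
  rw [add_assoc, ← ENNReal.ofReal_mul (by positivity), ← ENNReal.ofReal_add (by positivity)
    (by positivity)]
  refine add_le_add le_rfl (ENNReal.ofReal_le_ofReal ?_)
  have e1 : R ^ (-t) * (2 : ℝ) ^ (-(r * k)) ≤ 2 ^ (-(min (r + 1 / 2) (s + t) * k)) := by
    rw [← Real.rpow_mul (by norm_num), ← Real.rpow_add (by norm_num)]
    refine Real.rpow_le_rpow_of_exponent_le (by norm_num) ?_
    have := min_le_left (r + 1 / 2) (s + t)
    have hk : (0 : ℝ) ≤ k := by positivity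
    nlinarith [mul_nonneg hk (sub_nonneg.2 ht), mul_nonneg hk (sub_nonneg.2 this)]
  have e2 : (2 : ℝ) ^ (-((s + t) * k)) ≤ 2 ^ (-(min (r + 1 / 2) (s + t) * k)) := by
    gcongr
    · norm_num
    · exact min_le_right _ _
  calc C₂ * R ^ (-t) * (C₃ * 2 ^ (-(r * k))) + C₁ * 2 ^ (-((s + t) * k))
      = C₂ * C₃ * (R ^ (-t) * 2 ^ (-(r * k))) + C₁ * 2 ^ (-((s + t) * k)) := by ring
    _ ≤ C₂ * C₃ * 2 ^ (-(min (r + 1 / 2) (s + t) * k)) +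
        C₁ * 2 ^ (-(min (r + 1 / 2) (s + t) * k)) := by gcongr
    _ = _ := by ring

/-- The first steps `A, A^R, A^{2R}, …` of thickening a part of a dyadic shell stay in the
neighbouring shells. -/
theorem ConeSep.cthickening_subset {c : ℝ} (hc : 0 < c) {Γ' Γ : Set E} (h : ConeSep c Γ' Γ)
    {k : ℕ} (hk : 1 ≤ k) {d : ℝ} (hd : d + 1 ≤ min c 1 / 4 * 2 ^ k) :
    Metric.cthickening d (shell E 0 k ∩ Γ') ⊆ shell E 1 k ∩ Γ := by
  intro ζ hζ
  have hζ' : ζ ∈ Metric.thickening (min c 1 / 4 * 2 ^ k) (shell E 0 k ∩ Γ') := by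
    have hpos : 0 < min c 1 / 4 * (2 : ℝ) ^ k := by
      have := lt_min hc one_pos; positivity
    exact Metric.cthickening_subset_thickening' hpos (by linarith) _ hζ
  obtain ⟨w, ⟨⟨w1, w2⟩, hw⟩, hwζ⟩ := Metric.mem_thickening_iff.1 hζ'
  simp only [pow_zero, one_mul, add_zero] at w1 w2
  rw [dist_eq_norm, norm_sub_rev] at hwζ
  have h1 : min c 1 ≤ 1 := min_le_right _ _
  have h2 : min c 1 ≤ c := min_le_left _ _
  have hp : (2 : ℝ) ≤ 2 ^ k := by
    calc (2 : ℝ) = 2 ^ 1 := by norm_num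
      _ ≤ 2 ^ k := by gcongr; norm_num
  have n1 : ‖w‖ ≤ ‖w - ζ‖ + ‖ζ‖ := by simpa using norm_add_le (w - ζ) ζ
  have n2 : ‖ζ‖ ≤ ‖w - ζ‖ + ‖w‖ := by
    rw [norm_sub_rev]; simpa using norm_add_le (ζ - w) w
  have hwζ' : ‖w - ζ‖ ≤ 1 / 4 * 2 ^ k := by nlinarith
  refine ⟨⟨?_, ?_⟩, ?_⟩
  · rw [pow_one]; linarith
  · rw [pow_succ] at w2
    rw [pow_succ, pow_succ]; linarith
  · by_contra hn
    have := (h w hw ζ hn).1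
    nlinarith [norm_nonneg w]

theorem exists_rpow_half_le {a : ℝ} (ha : 0 < a) :
    ∃ k₀ : ℕ, ∀ k : ℕ, k₀ ≤ k → (k : ℝ) * 2 ^ ((k : ℝ) / 2) + 1 ≤ a * 2 ^ k := by
  set q : ℝ := 2 ^ (-(1 / 2) : ℝ)
  have hq : 0 < q := by positivity
  have hq1 : q < 1 := Real.rpow_lt_one_of_one_lt_of_neg (by norm_num) (by norm_num)
  have h1 : Tendsto (fun k : ℕ => (k : ℝ) * q ^ k + (1 / 2 : ℝ) ^ k) atTop (𝓝 (0 + 0)) :=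
    (tendsto_self_mul_const_pow_of_lt_one hq.le hq1).add
      (tendsto_pow_atTop_nhds_zero_of_lt_one (by norm_num) (by norm_num))
  rw [add_zero] at h1
  obtain ⟨k₀, hk₀⟩ := eventually_atTop.1 (h1.eventually_le_const ha)
  refine ⟨k₀, fun k hk => ?_⟩
  have e1 : (2 : ℝ) ^ ((k : ℝ) / 2) = q ^ k * 2 ^ k := by
    rw [← Real.rpow_natCast q, ← Real.rpow_natCast 2, ← Real.rpow_mul (by norm_num),
      ← Real.rpow_add (by norm_num)]
    congr 1; ring
  have e2 : (1 : ℝ) = (1 / 2) ^ k * 2 ^ k := by rw [← mul_pow]; norm_num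
  calc (k : ℝ) * 2 ^ ((k : ℝ) / 2) + 1 = (k * q ^ k + (1 / 2) ^ k) * 2 ^ k := by
        rw [e1, add_mul, ← e2]; ring
    _ ≤ _ := by gcongr; exact hk₀ k hk

/-- The errors of the unrolled recursion form a geometric series with sum at most `2 e`; in
particular they do not accumulate with the number of steps. -/
theorem le_of_halving {x : ℕ → ℝ≥0∞} {e : ℝ≥0∞} {k : ℕ}
    (h : ∀ j < k, x j ≤ 2⁻¹ * x (j + 1) + e) : x 0 ≤ 2⁻¹ ^ k * x k + 2 * e := by
  induction k generalizing x with
  | zero => simp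
  | succ k ih =>
    have h1 := ih (x := fun j => x (j + 1)) fun j hj => h (j + 1) (by omega)
    calc x 0 ≤ 2⁻¹ * x 1 + e := h 0 (by omega)
      _ ≤ 2⁻¹ * (2⁻¹ ^ k * x (k + 1) + 2 * e) + e := by gcongr
      _ = 2⁻¹ ^ (k + 1) * x (k + 1) + (2⁻¹ * 2 * e + e) := by ring
      _ = _ := by rw [ENNReal.inv_mul_cancel (by norm_num) (by norm_num)]; rw [one_mul, two_mul]

/-- If `V` is controlled by convolutions with localizable kernels of small norm applied to `V` and
by an error term, then the error term determines the growth of `V`. -/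
theorem HasGrowth.absorb {κ : Type*} [Fintype κ] {K V' : κ → E → ℂ} {V Err : E → ℂ}
    {t B b s r e c : ℝ} (hK : ∀ i, Localizable t B (K i)) (hs : s < 0) (hst : 0 < s + t)
    (ht : 1 ≤ t) (hb : 0 ≤ b) (hc : 0 < c) {Γ₀ Γ₁ Γ₂ : Set E}
    (h01 : ConeSep c Γ₀ Γ₁) (h12 : ConeSep c Γ₁ Γ₂) (h02 : Γ₀ ⊆ Γ₂)
    (mΓ₁ : MeasurableSet Γ₁) (mΓ₂ : MeasurableSet Γ₂)
    (mV' : ∀ i, Measurable (V' i)) (mV : Measurable V) (mErr : Measurable Err)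
    (hle : ∀ i w, ‖V' i w‖ ≤ ‖V w‖) (hV : HasGrowth s univ V) (hVΓ : HasGrowth r Γ₂ V)
    (hErr : HasGrowth e Γ₁ Err) (hint : ∀ i w, Integrable fun ζ => K i (w - ζ) * V' i ζ)
    (hsmall : b * (Fintype.card κ * B) ≤ 1 / 2)
    (heq : ∀ w ∈ Γ₁, 1 ≤ ‖w‖ → ‖V w‖ ≤ b * ‖∑ i, conv (K i) (V' i) w‖ + ‖Err w‖) :
    HasGrowth (min (min (r + 1 / 2) (s + t)) e) Γ₀ V := by
  set γ := min (min (r + 1 / 2) (s + t)) e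
  choose C hC hloc using fun i => (hK i).locNorm_conv_le hs hst ht hc h12 mΓ₂ (mV' i) mV (hle i) hV
    hVΓ (hint i)
  obtain ⟨C₁, hC₁, hE⟩ := hErr.shell_le mΓ₁ mErr 1
  obtain ⟨C₂, hC₂, hV3⟩ := hVΓ.shell_le mΓ₂ mV 3
  set D : ℝ := b * ∑ i, C i + C₁
  have hD : 0 ≤ D := add_nonneg (mul_nonneg hb (Finset.sum_nonneg fun i _ => hC i)) hC₁
  have mconv : ∀ i, Measurable (conv (K i) (V' i)) := fun i =>
    measurable_conv (hK i).continuous (mV' i)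
  -- One use of the inequality: half the norm on a thickened set, plus an error of the final order.
  -- The condition `2 ≤ k` ensures `‖w‖ ≥ 1` on the shell, where `heq` is available.
  have step : ∀ k : ℕ, 2 ≤ k → ∀ A : Set E, MeasurableSet A → A ⊆ shell E 1 k ∩ Γ₁ →
      locNorm A V ≤ 2⁻¹ * locNorm (shell E 3 k ∩ Γ₂ ∩ Metric.thickening (2 ^ ((k : ℝ) / 2)) A) V +
        ENNReal.ofReal (D * 2 ^ (-(γ * k))) := by
    intro k hk A mA hA
    set N := locNorm (shell E 3 k ∩ Γ₂ ∩ Metric.thickening (2 ^ ((k : ℝ) / 2)) A) V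
    have hp1 : (2 : ℝ) ^ (-(min (r + 1 / 2) (s + t) * k)) ≤ 2 ^ (-(γ * k)) := by
      gcongr
      · norm_num
      · exact min_le_left _ _
    have hp2 : (2 : ℝ) ^ (-(e * k)) ≤ 2 ^ (-(γ * k)) := by
      gcongr
      · norm_num
      · exact min_le_right _ _
    set S : E → ℂ := fun w => ∑ i, conv (K i) (V' i) w
    have mS : Measurable S := Finset.measurable_sum _ fun i _ => mconv i
    have hS : locNorm A S ≤ ENNReal.ofReal (Fintype.card κ * B) * N +
        ENNReal.ofReal ((∑ i, C i) * 2 ^ (-(γ * k))) := by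
      refine (locNorm_sum_le _ fun i _ => mconv i).trans ?_
      refine (Finset.sum_le_sum fun i _ => hloc i k A mA hA).trans ?_
      rw [Finset.sum_add_distrib, Finset.sum_const, Finset.card_univ, nsmul_eq_mul,
        ENNReal.ofReal_mul (by positivity), ENNReal.ofReal_natCast, mul_assoc, Finset.sum_mul,
        ENNReal.ofReal_sum_of_nonneg fun i _ => mul_nonneg (hC i) (by positivity)]
      refine add_le_add le_rfl (Finset.sum_le_sum fun i _ => ENNReal.ofReal_le_ofReal ?_)
      exact mul_le_mul_of_nonneg_left hp1 (hC i)
    have h1 : locNorm A V ≤ locNorm A fun w => ((b * ‖S w‖ : ℝ) : ℂ) + ((‖Err w‖ : ℝ) : ℂ) := by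
      have := locNorm_le_mul mA (c := 1) (V := V)
        (W := fun w => ((b * ‖S w‖ : ℝ) : ℂ) + ((‖Err w‖ : ℝ) : ℂ)) fun w hw => by
          obtain ⟨⟨hw1, -⟩, hw2⟩ := hA hw
          have : (4 : ℝ) ≤ 2 ^ k := by
            calc (4 : ℝ) = 2 ^ 2 := by norm_num
              _ ≤ 2 ^ k := by gcongr; norm_num
          rw [pow_one] at hw1
          rw [← Complex.ofReal_add, Complex.norm_real, Real.norm_of_nonneg (by positivity), one_mul]
          exact heq w hw2 (by linarith)
      simpa using this
    have h2 : locNorm A (fun w => ((b * ‖S w‖ : ℝ) : ℂ)) ≤ ENNReal.ofReal b * locNorm A S :=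
      locNorm_le_mul mA fun w _ => by
        rw [Complex.norm_real, Real.norm_of_nonneg (by positivity)]
    have h3 : locNorm A (fun w => ((‖Err w‖ : ℝ) : ℂ)) ≤ ENNReal.ofReal (C₁ * 2 ^ (-(e * k))) := by
      have := locNorm_le_mul mA (c := 1) (V := fun w => ((‖Err w‖ : ℝ) : ℂ)) (W := Err)
        fun w _ => by rw [Complex.norm_real, norm_norm, one_mul]
      rw [ENNReal.ofReal_one, one_mul] at this
      exact this.trans ((locNorm_mono hA Err).trans (hE k))
    refine h1.trans ((locNorm_add_le (by fun_prop) (by fun_prop)).trans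
      ((add_le_add (h2.trans (mul_le_mul_right hS _)) h3).trans ?_))
    have hb2 : ENNReal.ofReal b * ENNReal.ofReal (Fintype.card κ * B) ≤ 2⁻¹ := by
      rw [← ENNReal.ofReal_mul hb]
      refine (ENNReal.ofReal_le_ofReal hsmall).trans (le_of_eq ?_)
      rw [one_div, ENNReal.ofReal_inv_of_pos (by norm_num)]; norm_num
    have hsum : 0 ≤ ∑ i, C i := Finset.sum_nonneg fun i _ => hC i
    rw [mul_add, ← mul_assoc, add_assoc,
      ← ENNReal.ofReal_mul hb (q := (∑ i, C i) * 2 ^ (-(γ * k))),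
      ← ENNReal.ofReal_add (by positivity) (by positivity)]
    refine add_le_add (mul_le_mul_left hb2 _) (ENNReal.ofReal_le_ofReal ?_)
    calc b * ((∑ i, C i) * 2 ^ (-(γ * k))) + C₁ * 2 ^ (-(e * k))
        ≤ b * ((∑ i, C i) * 2 ^ (-(γ * k))) + C₁ * 2 ^ (-(γ * k)) := by gcongr
      _ = _ := by simp only [D]; ring
  have hmin : 0 < min c 1 / 4 := by have := lt_min hc one_pos; positivity
  obtain ⟨k₀, hk₀⟩ := exists_rpow_half_le hmin
  -- Beyond `k₀` all `k` thickenings fit into the margin between `Γ₀` and `Γ₁`; the finitely many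
  -- other shells only affect the constant.
  refine (hVΓ.mono_set h02).of_large (C := C₂ + 2 * D) (by positivity) (max k₀ 2) fun k hk => ?_
  have hk2 : 2 ≤ k := (le_max_right _ _).trans hk
  have hkk := hk₀ k ((le_max_left _ _).trans hk)
  set R : ℝ := 2 ^ ((k : ℝ) / 2)
  have hR : 0 ≤ R := by positivity
  set A : ℕ → Set E := fun j => Metric.cthickening (j * R) (shell E 0 k ∩ Γ₀)
  have mA : ∀ j, MeasurableSet (A j) := fun j => Metric.isClosed_cthickening.measurableSet
  have hA : ∀ j ≤ k, A j ⊆ shell E 1 k ∩ Γ₁ := fun j hj => by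
    refine h01.cthickening_subset hc (by omega) (le_trans ?_ hkk)
    gcongr
  have hsucc : ∀ j, Metric.thickening R (A j) ⊆ A (j + 1) := fun j => by
    refine (Metric.thickening_cthickening_subset _ (by positivity) _).trans
      ((Metric.thickening_subset_cthickening _ _).trans (Metric.cthickening_mono ?_ _))
    push_cast; linarith
  have iter := le_of_halving (k := k) (x := fun j => locNorm (A j) V)
    (e := ENNReal.ofReal (D * 2 ^ (-(γ * k)))) fun j hj => by
      refine (step k hk2 (A j) (mA j) (hA j hj.le)).trans ?_
      gcongr
      exact locNorm_mono (inter_subset_right.trans (hsucc j)) V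
  have hk3 : locNorm (A k) V ≤ ENNReal.ofReal (C₂ * 2 ^ (-(r * k))) := by
    refine (locNorm_mono (fun ζ hζ => ?_) V).trans (hV3 k)
    obtain ⟨hz1, hz2⟩ := hA k le_rfl hζ
    refine ⟨shell_mono (by norm_num) k hz1, ?_⟩
    -- A point of `Γ₁` outside `Γ₂` would be separated from itself, which forces it to be `0`.
    by_contra hn
    have h2 := (h12 ζ hz2 ζ hn).1
    have : (4 : ℝ) ≤ 2 ^ k := by
      calc (4 : ℝ) = 2 ^ 2 := by norm_num
        _ ≤ 2 ^ k := by gcongr; norm_num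
    have h3 := hz1.1
    rw [sub_self, norm_zero] at h2
    nlinarith
  refine (locNorm_mono ((Metric.self_subset_cthickening (δ := ((0 : ℕ) : ℝ) * R) _)) V).trans
    (iter.trans ((add_le_add_left (mul_le_mul_right hk3 _) _).trans ?_))
  have e2 : (2⁻¹ : ℝ≥0∞) ^ k = ENNReal.ofReal ((1 / 2) ^ k) := by
    rw [ENNReal.ofReal_pow (by norm_num), one_div, ENNReal.ofReal_inv_of_pos (by norm_num)]
    norm_num
  have e3 : (2 : ℝ≥0∞) = ENNReal.ofReal 2 := by norm_num
  rw [e2, e3, ← ENNReal.ofReal_mul (by positivity),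
    ← ENNReal.ofReal_mul (by positivity) (q := D * 2 ^ (-(γ * k))),
    ← ENNReal.ofReal_add (by positivity) (by positivity)]
  refine ENNReal.ofReal_le_ofReal ?_
  -- The halvings turn the old order `r` into `r + 1`, which is more than the claimed `r + 1 / 2`.
  have e4 : (1 / 2 : ℝ) ^ k * 2 ^ (-(r * k)) ≤ 2 ^ (-(γ * k)) := by
    rw [one_div, inv_pow, ← Real.rpow_natCast, ← Real.rpow_neg (by norm_num),
      ← Real.rpow_add (by norm_num)]
    refine Real.rpow_le_rpow_of_exponent_le (by norm_num) ?_
    have : γ ≤ r + 1 / 2 := (min_le_left _ _).trans (min_le_left _ _)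
    nlinarith [(by positivity : (0 : ℝ) ≤ k)]
  calc (1 / 2) ^ k * (C₂ * 2 ^ (-(r * k))) + 2 * (D * 2 ^ (-(γ * k)))
      = C₂ * ((1 / 2) ^ k * 2 ^ (-(r * k))) + 2 * D * 2 ^ (-(γ * k)) := by ring
    _ ≤ C₂ * 2 ^ (-(γ * k)) + 2 * D * 2 ^ (-(γ * k)) := by gcongr
    _ = _ := by ring

end Absorption

end KleinGordon

namespace KleinGordon

open scoped ENNReal NNReal FourierTransform SchwartzMap

/-! ### Fourier transforms of test functions and of compactly supported Hölder functions -/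

section TestFunctions

variable {E : Type} [NormedAddCommGroup E] [InnerProductSpace ℝ E] [FiniteDimensional ℝ E]
  [MeasurableSpace E] [BorelSpace E]

theorem exists_pow_mul_norm_ft_le (f : 𝓢(E, ℂ)) (N : ℕ) :
    ∃ C : ℝ, 0 ≤ C ∧ ∀ η, (1 + ‖η‖) ^ N * ‖ft f η‖ ≤ C := by
  have h := SchwartzMap.one_add_le_sup_seminorm_apply (𝕜 := ℝ) (m := (N, 0)) le_rfl le_rfl (𝓕 f)
  refine ⟨(2 * Real.pi) ^ N * (2 ^ N *
    ((Finset.Iic (N, 0)).sup fun m => SchwartzMap.seminorm ℝ m.1 m.2) (𝓕 f)), by positivity,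
    fun η => ?_⟩
  have hx := h ((2 * Real.pi)⁻¹ • η)
  rw [norm_iteratedFDeriv_zero] at hx
  rw [ft_eq_fourier]
  have hπ : 1 ≤ 2 * Real.pi := by linarith [Real.pi_gt_three]
  have e : 1 + ‖η‖ ≤ 2 * Real.pi * (1 + ‖(2 * Real.pi)⁻¹ • η‖) := by
    rw [norm_smul, norm_inv, Real.norm_of_nonneg (by positivity), mul_add,
      mul_inv_cancel_left₀ (by positivity)]
    linarith
  calc (1 + ‖η‖) ^ N * ‖𝓕 (f : E → ℂ) ((2 * Real.pi)⁻¹ • η)‖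
      ≤ (2 * Real.pi * (1 + ‖(2 * Real.pi)⁻¹ • η‖)) ^ N *
        ‖𝓕 (f : E → ℂ) ((2 * Real.pi)⁻¹ • η)‖ := by gcongr
    _ = (2 * Real.pi) ^ N * ((1 + ‖(2 * Real.pi)⁻¹ • η‖) ^ N *
        ‖𝓕 (f : E → ℂ) ((2 * Real.pi)⁻¹ • η)‖) := by rw [mul_pow]; ring
    _ ≤ _ := mul_le_mul_of_nonneg_left hx (by positivity)

/-- Smooth functions of compact support. -/
def IsTest (ψ : E → ℂ) : Prop := ContDiff ℝ ∞ ψ ∧ HasCompactSupport ψ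

variable {ψ : E → ℂ}

theorem IsTest.integrable (h : IsTest ψ) : Integrable ψ :=
  h.1.continuous.integrable_of_hasCompactSupport h.2

theorem IsTest.continuous_ft (h : IsTest ψ) : Continuous (ft ψ) := KleinGordon.continuous_ft h.integrable

theorem IsTest.exists_pow_mul_le (h : IsTest ψ) (N : ℕ) :
    ∃ C : ℝ, 0 ≤ C ∧ ∀ η, (1 + ‖η‖) ^ N * ‖ft ψ η‖ ≤ C :=
  exists_pow_mul_norm_ft_le (h.2.toSchwartzMap h.1) N

theorem IsTest.integrable_weight (h : IsTest ψ) (a : ℝ) :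
    Integrable fun x => (1 + ‖x‖) ^ a * ‖ft ψ x‖ := by
  set d := Module.finrank ℝ E
  obtain ⟨N, hN⟩ := exists_nat_ge a
  obtain ⟨C, hC, hb⟩ := h.exists_pow_mul_le (N + (d + 1))
  have hi : Integrable fun x : E => C * (1 + ‖x‖) ^ (-((d + 1 : ℕ) : ℝ)) :=
    (integrable_one_add_norm (by push_cast; linarith)).const_mul C
  refine hi.mono ?_ (ae_of_all _ fun x => ?_)
  · have := h.continuous_ft
    exact Measurable.aestronglyMeasurable (by fun_prop)
  · have px : 1 ≤ 1 + ‖x‖ := by linarith [norm_nonneg x]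
    have px0 : 0 < 1 + ‖x‖ := by linarith
    rw [Real.norm_of_nonneg (by positivity), Real.norm_of_nonneg (by positivity),
      Real.rpow_neg px0.le, Real.rpow_natCast, ← div_eq_mul_inv, le_div_iff₀ (by positivity)]
    calc (1 + ‖x‖) ^ a * ‖ft ψ x‖ * (1 + ‖x‖) ^ (d + 1)
        ≤ (1 + ‖x‖) ^ (N : ℝ) * ‖ft ψ x‖ * (1 + ‖x‖) ^ (d + 1) := by gcongr
      _ = (1 + ‖x‖) ^ (N + (d + 1)) * ‖ft ψ x‖ := by rw [Real.rpow_natCast, pow_add]; ring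
      _ ≤ C := hb x

theorem IsTest.integrable_ft (h : IsTest ψ) : Integrable (ft ψ) := by
  have := h.integrable_weight 0
  simp only [Real.rpow_zero, one_mul] at this
  exact (integrable_norm_iff h.continuous_ft.aestronglyMeasurable).1 this

theorem IsTest.hasGrowth_ft (h : IsTest ψ) (r : ℝ) : HasGrowth r univ (ft ψ) := by
  refine hasGrowth_of_integrable ?_
  obtain ⟨C, hC, hb⟩ := h.exists_pow_mul_le 0
  have hi := ((h.integrable_weight (2 * |r|)).const_mul C)
  refine hi.mono ?_ (ae_of_all _ fun x => ?_)
  · have := h.continuous_ft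
    exact Measurable.aestronglyMeasurable (by fun_prop)
  · have px : 1 ≤ 1 + ‖x‖ := by linarith [norm_nonneg x]
    have hC' := hb x
    rw [pow_zero, one_mul] at hC'
    rw [Real.norm_of_nonneg (by positivity), Real.norm_of_nonneg (by positivity)]
    have : (1 + ‖x‖ ^ 2) ^ r ≤ (1 + ‖x‖) ^ (2 * |r|) := by
      rw [Real.rpow_mul (by positivity), Real.rpow_two]
      calc (1 + ‖x‖ ^ 2) ^ r ≤ (1 + ‖x‖ ^ 2) ^ |r| := by
            gcongr
            · nlinarith [sq_nonneg ‖x‖]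
            · exact le_abs_self r
        _ ≤ _ := by gcongr; nlinarith [norm_nonneg x]
    calc (1 + ‖x‖ ^ 2) ^ r * ‖ft ψ x‖ ^ 2 ≤ (1 + ‖x‖) ^ (2 * |r|) * (‖ft ψ x‖ * ‖ft ψ x‖) := by
          rw [pow_two ‖ft ψ x‖]; gcongr
      _ ≤ (1 + ‖x‖) ^ (2 * |r|) * (C * ‖ft ψ x‖) := by gcongr
      _ = _ := by ring

variable (E) in
/-- The constant in the Fourier inversion formula for `ft`. -/
def invConst : ℝ := ((2 * Real.pi) ^ Module.finrank ℝ E)⁻¹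

theorem invConst_pos : 0 < invConst E := by unfold invConst; positivity

theorem IsTest.ft_ft (h : IsTest ψ) (z : E) : (invConst E : ℂ) * ft (ft ψ) (-z) = ψ z := by
  set f := h.2.toSchwartzMap h.1
  have h1 : 𝓕⁻ (𝓕 (f : E → ℂ)) z = f z := by
    rw [← SchwartzMap.fourier_coe, ← SchwartzMap.fourierInv_coe, FourierTransform.fourierInv_fourier_eq]
  change _ = f z
  rw [← h1, Real.fourierInv_eq']
  have h2 := Measure.integral_comp_smul (volume : Measure E)
    (fun η => wave z η * ft ψ η) (2 * Real.pi)
  have h3 : (invConst E : ℂ) * ft (ft ψ) (-z) = ∫ x : E, wave z ((2 * Real.pi) • x) *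
      ft ψ ((2 * Real.pi) • x) := by
    rw [h2, abs_of_nonneg (by positivity), ft, neg_neg]
    simp [invConst]
  rw [h3]
  refine integral_congr_ae (ae_of_all _ fun x => ?_)
  simp only [ft_eq_fourier, smul_smul, smul_eq_mul]
  rw [inv_mul_cancel₀ (by positivity), one_smul]
  congr 1
  simp only [wave, inner_smul_left]
  congr 1
  push_cast
  simp
  ring

/-- Fourier inversion for `ψ` reduces this to `conv_ft`, so that `g` only has to be integrable. -/
theorem IsTest.ft_mul (h : IsTest ψ) {g : E → ℂ} (hg : Integrable g) (w : E) :
    ft (fun z => g z * ψ z) w = invConst E * conv (ft g) (ft ψ) w := by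
  rw [conv_ft hg h.integrable_ft, ← ft_const_mul]
  congr 1; ext z
  rw [← h.ft_ft z]; ring

/-- The witness is `-i` times the derivative of `ψ` along `e`. Powers of the frequency falling on
the kernel of a cut-off are therefore harmless. -/
theorem IsTest.exists_coord_mul_ft (h : IsTest ψ) (e : E) :
    ∃ ψ' : E → ℂ, IsTest ψ' ∧ ∀ η, ((inner ℝ η e : ℝ) : ℂ) * ft ψ η = ft ψ' η := by
  refine ⟨fun z => -Complex.I * fderiv ℝ ψ z e, ⟨?_, ?_⟩, fun η => ?_⟩
  · exact contDiff_const.mul ((h.1.fderiv_right (m := ∞) (by simp)).clm_apply contDiff_const)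
  · exact (h.2.fderiv_apply ℝ e).mul_left
  · set f := h.2.toSchwartzMap h.1
    have ht : (fun x : E => inner ℝ x e).HasTemperateGrowth := ((innerSL ℝ).flip e).hasTemperateGrowth
    have h1 := congrArg (fun g : 𝓢(E, ℂ) => g ((2 * Real.pi)⁻¹ • η))
      (SchwartzMap.fourier_lineDerivOp_eq f e)
    simp only [smul_apply, SchwartzMap.smulLeftCLM_apply_apply ht] at h1
    rw [ft_const_mul, ft_eq_fourier, ft_eq_fourier]
    have h2 : (𝓕 (LineDeriv.lineDerivOp e f) : 𝓢(E, ℂ)) ((2 * Real.pi)⁻¹ • η) =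
        𝓕 (fun z => fderiv ℝ ψ z e) ((2 * Real.pi)⁻¹ • η) := by
      rw [SchwartzMap.fourier_coe]
      congr 1
    rw [← h2, h1, SchwartzMap.fourier_coe]
    change _ = -Complex.I * ((2 * Real.pi * Complex.I) • (inner ℝ ((2 * Real.pi)⁻¹ • η) e •
      𝓕 ψ ((2 * Real.pi)⁻¹ • η)))
    rw [inner_smul_left, Complex.real_smul, smul_eq_mul]
    have : (Real.pi : ℂ) ≠ 0 := by exact_mod_cast Real.pi_ne_zero
    push_cast
    simp only [conj_trivial, Complex.ofReal_inv, Complex.ofReal_mul, Complex.ofReal_ofNat]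
    field_simp
    rw [Complex.I_sq]; ring

theorem Localizable.mono {t t' B B' : ℝ} {K : E → ℂ} (hK : Localizable t B K) (ht : t' ≤ t)
    (hB : B ≤ B') : Localizable t' B' K := by
  obtain ⟨h1, h2, C, hC, h3⟩ := hK
  refine ⟨h1, h2, C, hC, fun R hR => ?_⟩
  obtain ⟨k, a, b, c, d⟩ := h3 R hR
  refine ⟨k, a, b, fun f hf hf2 => (c f hf hf2).trans (by gcongr),
    fun f hf hf2 => (d f hf hf2).trans ?_⟩
  gcongr

theorem IsTest.exists_localizable (h : IsTest ψ) (t : ℝ) : ∃ B, Localizable t B (ft ψ) := by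
  obtain ⟨n, hn⟩ := exists_nat_ge t
  obtain ⟨A, -, hA⟩ := KleinGordon.exists_localizable E (θ := 1) one_pos le_rfl n
  obtain ⟨M, hM⟩ := h.1.continuous.bounded_above_of_compact_support h.2
  exact ⟨_, (hA ψ M h.2 (locHol_of_contDiffOn le_rfl isOpen_univ h.1.contDiffOn)
    ((norm_nonneg _).trans (hM 0)) hM).mono (by linarith) le_rfl⟩

theorem coneSep_univ (c : ℝ) : ConeSep c (univ : Set E) univ := fun _ _ ζ hζ => absurd (mem_univ ζ) hζ

theorem exists_isTest_eq_one {K : Set E} (hK : IsCompact K) :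
    ∃ χ : E → ℂ, IsTest χ ∧ ∀ z ∈ K, χ z = 1 := by
  obtain ⟨R, hR⟩ := hK.isBounded.subset_closedBall (0 : E)
  let f : ContDiffBump (0 : E) := ⟨max R 1, max R 1 + 1, by positivity, by linarith⟩
  refine ⟨fun z => (f z : ℂ), ⟨Complex.ofRealCLM.contDiff.comp f.contDiff, ?_⟩, fun z hz => ?_⟩
  · exact f.hasCompactSupport.comp_left Complex.ofReal_zero
  · change ((f z : ℝ) : ℂ) = 1
    rw [f.one_of_mem_closedBall (Metric.closedBall_subset_closedBall (le_max_left _ _) (hR hz)),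
      Complex.ofReal_one]

/-- The growth of the Fourier transform of a function of limited smoothness. -/
theorem hasGrowth_ft {θ t : ℝ} (hθ : 0 < θ) (hθ1 : θ ≤ 1) {n : ℕ} {G : E → ℂ}
    (hs : HasCompactSupport G) (hG : LocHol θ n univ G) (ht : t < n + θ) :
    HasGrowth t univ (ft G) := by
  have hcont : Continuous G := continuous_iff_continuousAt.2 fun x => hG.continuousAt hθ (mem_univ x)
  have hi : Integrable G := hcont.integrable_of_hasCompactSupport hs
  obtain ⟨M, hM⟩ := hcont.bounded_above_of_compact_support hs
  obtain ⟨A, -, hA⟩ := KleinGordon.exists_localizable E hθ hθ1 n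
  have hloc := hA G M hs hG ((norm_nonneg _).trans (hM 0)) hM
  obtain ⟨χ, hχ, hχ1⟩ := exists_isTest_eq_one hs
  -- With `χ = 1` on the support of `G`, `ft G` is a multiple of `ft G` convolved with the rapidly
  -- decreasing `ft χ`. Convolution outputs have order at most `s + (n + θ)`, and the input order `s
  -- = t' - (n + θ) < 0` is chosen to make this `t'`.
  have key : ∀ t', 0 < t' → t' < n + θ → HasGrowth t' univ (ft G) := by
    intro t' h0 h1
    obtain ⟨M', hM'⟩ := hloc.bounded
    have := hloc.hasGrowth_conv (s := t' - (n + θ)) (r := t') (by linarith) (by linarith) one_pos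
      (coneSep_univ 1) MeasurableSet.univ MeasurableSet.univ hχ.continuous_ft.measurable
      (hχ.hasGrowth_ft _) (hχ.hasGrowth_ft _)
      fun w => integrable_mul_of_bounded hloc.continuous hM' hχ.integrable_ft w
    rw [sub_add_cancel, min_self] at this
    have e : ft G = fun w => (invConst E : ℂ) * conv (ft G) (ft χ) w := by
      ext w
      rw [← hχ.ft_mul hi]
      congr 1; ext z
      by_cases hz : z ∈ tsupport G
      · rw [hχ1 z hz, mul_one]
      · rw [image_eq_zero_of_notMem_tsupport hz, zero_mul]
    rw [e]
    have := this.of_le (a := 0) MeasurableSet.univ (c := invConst E)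
      (W := fun w => (invConst E : ℂ) * conv (ft G) (ft χ) w) invConst_pos.le fun k z _ => by
        rw [norm_mul, Complex.norm_real, Real.norm_of_nonneg invConst_pos.le]; simp
    simpa using this
  rcases lt_or_ge 0 t with h | h
  · exact key t h ht
  · exact (key ((n + θ) / 2) (by positivity) (by linarith [(by positivity : (0:ℝ) < n + θ)])).mono
      (h.trans (by positivity))

end TestFunctions

end KleinGordon

namespace KleinGordon

open scoped ENNReal NNReal

/-! ### Commutators with cut-offs -/

section Improve

variable {ι : Type} [Fintype ι]

local notation "E" => EuclideanSpace ℝ ι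

theorem conv_const_mul_right (K : E → ℂ) (c : ℂ) (f : E → ℂ) (w : E) :
    conv K (fun ζ => c * f ζ) w = c * conv K f w := by
  simp only [conv]
  rw [← integral_const_mul]
  congr 1; ext ζ; ring

theorem HasGrowth.const_mul {r : ℝ} {Γ : Set E} (hΓ : MeasurableSet Γ) {V : E → ℂ}
    (hV : HasGrowth r Γ V) (c : ℂ) : HasGrowth r Γ fun w => c * V w := by
  have := hV.of_le (a := 0) hΓ (c := ‖c‖) (W := fun w => c * V w) (norm_nonneg c) fun k z _ => by
    rw [norm_mul]; simp
  simpa using this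

theorem HasGrowth.weight {r a c : ℝ} {Γ : Set E} (hΓ : MeasurableSet Γ) {V : E → ℂ}
    (hV : HasGrowth r Γ V) (hc : 0 ≤ c) {f : E → ℂ} (hf : ∀ z, ‖f z‖ ≤ c * (1 + ‖z‖) ^ a) :
    HasGrowth (r - a) Γ fun w => f w * V w := by
  refine hV.of_le (a := a) hΓ (c := c * 2 ^ |a|) (by positivity) fun k z hz => ?_
  rw [norm_mul]
  gcongr
  refine (hf z).trans ?_
  rw [mul_assoc]
  gcongr
  exact rpow_weight_le hz.1 a

theorem norm_coord_le (z : E) (μ : ι) : ‖((z μ : ℝ) : ℂ)‖ ≤ 1 * (1 + ‖z‖) ^ (1 : ℝ) := by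
  rw [Complex.norm_real, one_mul, Real.rpow_one]
  exact (PiLp.norm_apply_le z μ).trans (by linarith)

theorem norm_coord_mul_le (z : E) (μ ν : ι) :
    ‖((z μ : ℝ) : ℂ) * ((z ν : ℝ) : ℂ)‖ ≤ 1 * (1 + ‖z‖) ^ (2 : ℝ) := by
  have h1 := norm_coord_le z μ
  have h2 := norm_coord_le z ν
  rw [one_mul, Real.rpow_one] at h1 h2
  rw [norm_mul, one_mul, Real.rpow_two, pow_two]
  gcongr

theorem measurable_coord (μ : ι) : Measurable fun z : E => ((z μ : ℝ) : ℂ) := by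
  have : Continuous fun z : E => ((z μ : ℝ) : ℂ) := by fun_prop
  exact this.measurable

theorem IsTest.exists_coord {ψ : E → ℂ} (h : IsTest ψ) (μ : ι) :
    ∃ ψ' : E → ℂ, IsTest ψ' ∧ ∀ η : E, ((η μ : ℝ) : ℂ) * ft ψ η = ft ψ' η := by
  classical
  obtain ⟨ψ', h1, h2⟩ := h.exists_coord_mul_ft (EuclideanSpace.single μ (1 : ℝ))
  refine ⟨ψ', h1, fun η => ?_⟩
  rw [← h2]
  simp [EuclideanSpace.inner_single_right]

/-- Convolution with the Fourier transform of a test function preserves growth. -/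
theorem IsTest.hasGrowth_conv {ψ : E → ℂ} (h : IsTest ψ) {s r c : ℝ} {V : E → ℂ} (hs : s < 0)
    (hc : 0 < c) {Γ' Γ : Set E} (hsep : ConeSep c Γ' Γ) (mΓ' : MeasurableSet Γ')
    (mΓ : MeasurableSet Γ) (mV : Measurable V) (hV : HasGrowth s univ V) (hVΓ : HasGrowth r Γ V) :
    HasGrowth r Γ' (conv (ft ψ) V) := by
  -- This order is large enough for `0 < s + t` and for the far part not to limit the exponent `r`.
  obtain ⟨B, hB⟩ := h.exists_localizable (|s| + |r| + 1)
  have h1 := neg_abs_le s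
  have h2 := le_abs_self r
  have h3 := abs_nonneg r
  have := hB.hasGrowth_conv hs (by linarith) hc hsep mΓ' mΓ mV hV hVΓ fun w =>
    integrable_conv_of_growth h.continuous_ft.measurable mV (h.hasGrowth_ft (1 - s)) hV (by linarith) w
  rwa [min_eq_left (by linarith)] at this

theorem IsTest.integrable_conv {ψ : E → ℂ} (h : IsTest ψ) {s : ℝ} {V : E → ℂ}
    (mV : Measurable V) (hV : HasGrowth s univ V) (w : E) :
    Integrable fun ζ => ft ψ (w - ζ) * V ζ :=
  integrable_conv_of_growth h.continuous_ft.measurable mV (h.hasGrowth_ft (1 - s)) hV (by linarith) w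

/-- The commutator of `D_μ D_ν` and the multiplication with `ψ`, on the Fourier side. -/
def commutator (ψ U : E → ℂ) (μ ν : ι) (w : E) : ℂ :=
  (w μ : ℂ) * (w ν : ℂ) * (invConst E * conv (ft ψ) U w) -
    invConst E * conv (ft ψ) (fun ζ => (ζ μ : ℂ) * (ζ ν : ℂ) * U ζ) w

theorem measurable_commutator {ψ U : E → ℂ} (hψ : IsTest ψ) (hU : Measurable U) (μ ν : ι) :
    Measurable (commutator ψ U μ ν) := by
  have h1 := measurable_conv hψ.continuous_ft hU
  have h2 := measurable_conv hψ.continuous_ft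
    (((measurable_coord μ).mul (measurable_coord ν)).mul hU)
  exact (((measurable_coord μ).mul (measurable_coord ν)).mul (measurable_const.mul h1)).sub
    (measurable_const.mul h2)

/-- The kernel contains `w_μ w_ν - ζ_μ ζ_ν`, which expands in powers of `w - ζ` without constant
term. Factors `w - ζ` turn `ft ψ` into transforms of its derivatives, so at most one factor `ζ` is
left and one order is lost instead of two. -/
theorem hasGrowth_commutator {ψ U : E → ℂ} (hψ : IsTest ψ) (hU : Measurable U) {s r c : ℝ}
    (hs : s < 1) (hc : 0 < c) {Γ' Γ : Set E} (hsep : ConeSep c Γ' Γ) (mΓ' : MeasurableSet Γ')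
    (mΓ : MeasurableSet Γ) (hUs : HasGrowth s univ U) (hUr : HasGrowth r Γ U) (μ ν : ι) :
    HasGrowth (r - 1) Γ' (commutator ψ U μ ν) := by
  obtain ⟨ψ₁, h₁, e₁⟩ := hψ.exists_coord μ
  obtain ⟨ψ₂, h₂, e₂⟩ := hψ.exists_coord ν
  obtain ⟨ψ₃, h₃, e₃⟩ := h₂.exists_coord μ
  have mL : ∀ μ : ι, Measurable fun ζ : E => (ζ μ : ℂ) * U ζ := fun μ => (measurable_coord μ).mul hU
  have gs : ∀ μ : ι, HasGrowth (s - 1) univ fun ζ : E => (ζ μ : ℂ) * U ζ := fun μ =>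
    hUs.weight MeasurableSet.univ zero_le_one fun z => norm_coord_le z μ
  have gr : ∀ μ : ι, HasGrowth (r - 1) Γ fun ζ : E => (ζ μ : ℂ) * U ζ := fun μ =>
    hUr.weight mΓ zero_le_one fun z => norm_coord_le z μ
  have hs' : s - 1 < 0 := by linarith
  have g₁ := h₁.hasGrowth_conv hs' hc hsep mΓ' mΓ (mL ν) (gs ν) (gr ν)
  have g₂ := h₂.hasGrowth_conv hs' hc hsep mΓ' mΓ (mL μ) (gs μ) (gr μ)
  have g₃ := h₃.hasGrowth_conv hs' hc hsep mΓ' mΓ hU (hUs.mono (by linarith))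
    (hUr.mono (by linarith : r - 1 ≤ r))
  have m₁ := measurable_conv h₁.continuous_ft (mL ν)
  have m₂ := measurable_conv h₂.continuous_ft (mL μ)
  have m₃ := measurable_conv h₃.continuous_ft hU
  have e : commutator ψ U μ ν = fun w => (invConst E : ℂ) *
      (conv (ft ψ₁) (fun ζ => (ζ ν : ℂ) * U ζ) w + conv (ft ψ₂) (fun ζ => (ζ μ : ℂ) * U ζ) w +
        conv (ft ψ₃) U w) := by
    ext w
    have mQ : Measurable fun ζ : E => (ζ μ : ℂ) * (ζ ν : ℂ) * U ζ :=
      ((measurable_coord μ).mul (measurable_coord ν)).mul hU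
    have gQ : HasGrowth (s - 2) univ fun ζ : E => (ζ μ : ℂ) * (ζ ν : ℂ) * U ζ :=
      hUs.weight MeasurableSet.univ zero_le_one fun z => norm_coord_mul_le z μ ν
    have i0 := hψ.integrable_conv hU hUs w
    have iQ := hψ.integrable_conv mQ gQ w
    have i1 := h₁.integrable_conv (mL ν) (gs ν) w
    have i2 := h₂.integrable_conv (mL μ) (gs μ) w
    have i3 := h₃.integrable_conv hU hUs w
    have i12 : Integrable fun ζ : E => ft ψ₁ (w - ζ) * ((ζ ν : ℂ) * U ζ) +
        ft ψ₂ (w - ζ) * ((ζ μ : ℂ) * U ζ) := i1.add i2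
    have : (w μ : ℂ) * (w ν : ℂ) * conv (ft ψ) U w -
        conv (ft ψ) (fun ζ => (ζ μ : ℂ) * (ζ ν : ℂ) * U ζ) w =
        conv (ft ψ₁) (fun ζ => (ζ ν : ℂ) * U ζ) w + conv (ft ψ₂) (fun ζ => (ζ μ : ℂ) * U ζ) w +
        conv (ft ψ₃) U w := by
      simp only [conv]
      rw [← integral_const_mul, ← integral_sub (i0.const_mul _) iQ, ← integral_add i1 i2,
        ← integral_add i12 i3]
      congr 1; ext ζ
      rw [← e₃, ← e₂, ← e₁]
      simp only [PiLp.sub_apply, Complex.ofReal_sub]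
      ring
    rw [← this, commutator]
    ring
  rw [e]
  exact ((g₁.add g₂ m₁ m₂).add g₃ (m₁.add m₂) m₃).const_mul mΓ' _

end Improve

end KleinGordon

namespace KleinGordon

open scoped ENNReal NNReal

/-! ### One step of the elliptic bootstrap -/

section Improve

variable {ι : Type} [Fintype ι]

local notation "E" => EuclideanSpace ℝ ι

/-- Convergence of the integral only needs some `t'` with `-s < t' < t`; this matters because the
growth of a transform is known only strictly below the order of the function. -/
theorem Localizable.hasGrowth_conv_of_le {t B s r e c : ℝ} {K V : E → ℂ} (hK : Localizable t B K)
    (hKg : ∀ t' < t, HasGrowth t' univ K)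
    (hs : s < 0) (hst : 0 < s + t) (hc : 0 < c) {Γ' Γ : Set E} (hsep : ConeSep c Γ' Γ)
    (mΓ' : MeasurableSet Γ') (mΓ : MeasurableSet Γ) (mV : Measurable V)
    (hV : HasGrowth s univ V) (hVΓ : HasGrowth r Γ V) (h1 : e ≤ r) (h2 : e ≤ s + t) :
    HasGrowth e Γ' (conv K V) := by
  obtain ⟨t', ht1, ht2⟩ := exists_between (show -s < t by linarith)
  exact (hK.hasGrowth_conv hs hst hc hsep mΓ' mΓ mV hV hVΓ fun w =>
    integrable_conv_of_growth hK.continuous.measurable mV (hKg t' ht2) hV (by linarith) w).mono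
    (le_min h1 h2)

/-- One step of the regularity argument: a solution `W` of an elliptic equation with coefficients
close to constants gains half a derivative, up to the limit set by the regularity of the
coefficients. -/
theorem hasGrowth_improve {θ : ℝ} (hθ : 0 < θ) (hθ1 : θ ≤ 1) {n : ℕ} {A : ℝ}
    (hloc : ∀ (G : E → ℂ) (M : ℝ), HasCompactSupport G → LocHol θ (n + 1) univ G → 0 ≤ M →
      (∀ x, ‖G x‖ ≤ M) → Localizable ((n + 1 : ℕ) + θ) (A * M) (ft G))
    {s r c : ℝ} (hs : s < 1) (hst : 2 < s + ((n + 1 : ℕ) + θ)) (hc : 0 < c)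
    {Γ₀ Γ₁ Γ₂ Γ₃ : Set E} (h01 : ConeSep c Γ₀ Γ₁) (h12 : ConeSep c Γ₁ Γ₂) (h23 : ConeSep c Γ₂ Γ₃)
    (h13 : ConeSep c Γ₁ Γ₃) (s03 : Γ₀ ⊆ Γ₃) (s13 : Γ₁ ⊆ Γ₃)
    (mΓ₀ : MeasurableSet Γ₀) (mΓ₁ : MeasurableSet Γ₁) (mΓ₂ : MeasurableSet Γ₂) (mΓ₃ : MeasurableSet Γ₃)
    {U ψ : E → ℂ} (hU : Measurable U) (hψ : IsTest ψ)
    (hUs : HasGrowth s univ U) (hUr : HasGrowth r Γ₃ U)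
    (hWs : HasGrowth s univ fun w => (invConst E : ℂ) * conv (ft ψ) U w)
    (hWr : HasGrowth r Γ₃ fun w => (invConst E : ℂ) * conv (ft ψ) U w)
    {a₀ : ι × ι → ℂ} {c₀ : ℂ} {a : ι × ι → E → ℂ} {b : ι → E → ℂ} {η κ : ℝ} (hη : 0 ≤ η) (hκ : 0 < κ)
    (ha : ∀ i, HasCompactSupport (a i)) (ha' : ∀ i, LocHol θ (n + 1) univ (a i))
    (haη : ∀ i z, ‖a i z‖ ≤ η)
    (hb : ∀ μ, HasCompactSupport (b μ)) (hb' : ∀ μ, LocHol θ n univ (b μ))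
    (hell : ∀ w ∈ Γ₁, κ * ‖w‖ ^ 2 ≤ ‖∑ i, a₀ i * ((w i.1 : ℂ) * (w i.2 : ℂ))‖)
    (hsmall : 4 / κ * invConst E * (Fintype.card (ι × ι) * (A * η)) ≤ 1 / 2)
    (heq : ∀ w, ∑ i, (a₀ i * conv (ft ψ) (fun ζ => (ζ i.1 : ℂ) * (ζ i.2 : ℂ) * U ζ) w +
        conv (ft fun z => a i z * ψ z) (fun ζ => (ζ i.1 : ℂ) * (ζ i.2 : ℂ) * U ζ) w) +
      ∑ μ, conv (ft (b μ)) (fun ζ => (ζ μ : ℂ) * U ζ) w + c₀ * conv (ft ψ) U w = 0) :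
    HasGrowth (min (r + 1 / 2) (s + ((n + 1 : ℕ) + θ))) Γ₀
      fun w => (invConst E : ℂ) * conv (ft ψ) U w := by
  classical
  set t : ℝ := (n + 1 : ℕ) + θ
  have ht1 : 1 ≤ t := by simp only [t]; push_cast; linarith [(by positivity : (0 : ℝ) ≤ n)]
  set W : E → ℂ := fun w => (invConst E : ℂ) * conv (ft ψ) U w with hW
  have mW : Measurable W := measurable_const.mul (measurable_conv hψ.continuous_ft hU)
  set Q : ι × ι → E → ℂ := fun i ζ => (ζ i.1 : ℂ) * (ζ i.2 : ℂ)
  have mQ : ∀ i, Measurable (Q i) := fun i => (measurable_coord i.1).mul (measurable_coord i.2)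
  have hQ : ∀ i z, ‖Q i z‖ ≤ 1 * (1 + ‖z‖) ^ (2 : ℝ) := fun i z => norm_coord_mul_le z i.1 i.2
  have hint : ∀ i, Integrable (a i) := fun i => by
    have : Continuous (a i) :=
      continuous_iff_continuousAt.2 fun x => (ha' i).continuousAt hθ (mem_univ x)
    exact this.integrable_of_hasCompactSupport (ha i)
  have hL : ∀ i, Localizable t (A * η) (ft (a i)) := fun i =>
    hloc (a i) η (ha i) (ha' i) hη (haη i)
  have hLg : ∀ i, ∀ t' < t, HasGrowth t' univ (ft (a i)) := fun i t' h =>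
    hasGrowth_ft hθ hθ1 (ha i) (ha' i) h
  obtain ⟨t', ht', ht''⟩ := exists_between (show 2 - s < t by linarith)
  have hconv : ∀ i {V : E → ℂ}, Measurable V → HasGrowth (s - 2) univ V → ∀ w,
      Integrable fun ζ => ft (a i) (w - ζ) * V ζ := fun i V mV hV w =>
    integrable_conv_of_growth (hL i).continuous.measurable mV (hLg i t' ht'') hV (by linarith) w
  set G : ι × ι → E → ℂ := fun i => commutator ψ U i.1 i.2
  have mG : ∀ i, Measurable (G i) := fun i => measurable_commutator hψ hU i.1 i.2
  have hGs : ∀ i, HasGrowth (s - 1) univ (G i) := fun i =>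
    hasGrowth_commutator hψ hU hs one_pos (coneSep_univ 1) MeasurableSet.univ MeasurableSet.univ
      hUs hUs i.1 i.2
  have hGr : ∀ i, HasGrowth (r - 1) Γ₂ (G i) := fun i =>
    hasGrowth_commutator hψ hU hs hc h23 mΓ₂ mΓ₃ hUs hUr i.1 i.2
  set V' : ι × ι → E → ℂ := fun i w => Q i w * W w
  have mV' : ∀ i, Measurable (V' i) := fun i => (mQ i).mul mW
  have hV's : ∀ i, HasGrowth (s - 2) univ (V' i) := fun i =>
    hWs.weight MeasurableSet.univ zero_le_one (hQ i)
  have mQU : ∀ i, Measurable fun ζ => Q i ζ * U ζ := fun i => (mQ i).mul hU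
  have hQUs : ∀ i, HasGrowth (s - 2) univ fun ζ => Q i ζ * U ζ := fun i =>
    hUs.weight MeasurableSet.univ zero_le_one (hQ i)
  -- `T` is the perturbation acting on the second derivatives of the localised solution, to be
  -- absorbed; `Err` collects the commutators and the lower order terms.
  set T : E → ℂ := fun w => ∑ i, conv (ft (a i)) (V' i) w
  set Err : E → ℂ := fun w => ∑ i, a₀ i * G i w + invConst E * ∑ i, conv (ft (a i)) (G i) w -
    invConst E * ∑ μ, conv (ft (b μ)) (fun ζ => (ζ μ : ℂ) * U ζ) w - c₀ * W w
  -- The equation with the frozen form isolated. Associativity splits `a i * ψ` into `a i` acting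
  -- after `ψ`, and commuting `ψ` with the second derivatives replaces `U` by `W`.
  have main : ∀ w, (∑ i, a₀ i * Q i w) * W w = Err w - invConst E * T w := by
    intro w
    have e1 : ∀ i, invConst E * conv (ft ψ) (fun ζ => Q i ζ * U ζ) w = V' i w - G i w := fun i => by
      simp only [V', G, commutator, W, Q]; ring
    have e2 : ∀ i, invConst E * conv (ft fun z => a i z * ψ z) (fun ζ => Q i ζ * U ζ) w =
        invConst E * (conv (ft (a i)) (V' i) w - conv (ft (a i)) (G i) w) := fun i => by
      rw [funext fun w => hψ.ft_mul (hint i) w]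
      have e3 : conv (fun w => (invConst E : ℂ) * conv (ft (a i)) (ft ψ) w)
          (fun ζ => Q i ζ * U ζ) w =
          invConst E * conv (conv (ft (a i)) (ft ψ)) (fun ζ => Q i ζ * U ζ) w := by
        simp only [conv, mul_assoc]
        rw [integral_const_mul]
      rw [e3, ← conv_assoc (hL i).continuous.measurable hψ.continuous_ft.measurable (mQU i)
        (hLg i t' ht'') (hQUs i) (by linarith) hψ.integrable_weight, ← conv_const_mul_right]
      congr 1
      have i1 := hconv i (mV' i) (hV's i) w
      have i2 := hconv i (mG i) ((hGs i).mono (by linarith)) w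
      simp only [conv]
      rw [← integral_sub i1 i2]
      congr 1; ext x
      have := congrArg (ft (a i) (w - x) * ·) (show (invConst E : ℂ) *
        conv (ft ψ) (fun ζ => Q i ζ * U ζ) x = V' i x - G i x by
          simp only [V', G, commutator, W, Q]; ring)
      simp only [conv, mul_sub] at this
      exact this
    have h := congrArg ((invConst E : ℂ) * ·) (heq w)
    simp only [mul_zero, mul_add] at h
    rw [Finset.mul_sum, Finset.sum_congr rfl fun i _ => show (invConst E : ℂ) *
      (a₀ i * conv (ft ψ) (fun ζ => (ζ i.1 : ℂ) * (ζ i.2 : ℂ) * U ζ) w +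
        conv (ft fun z => a i z * ψ z) (fun ζ => (ζ i.1 : ℂ) * (ζ i.2 : ℂ) * U ζ) w) =
      a₀ i * Q i w * W w - a₀ i * G i w + (invConst E * conv (ft (a i)) (V' i) w -
        invConst E * conv (ft (a i)) (G i) w) by
        rw [mul_add, mul_left_comm]
        have h1 := e1 i
        have h2 := e2 i
        simp only [Q] at h1 h2
        rw [h1, h2]
        simp only [V', Q]; ring] at h
    simp only [Finset.sum_add_distrib, Finset.sum_sub_distrib, ← Finset.mul_sum, ← Finset.sum_mul]
      at h
    simp only [Err, T, W] at h ⊢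
    linear_combination h
  have mErr : Measurable Err := by
    refine (((Finset.measurable_sum _ fun i _ => measurable_const.mul (mG i)).add
      (measurable_const.mul (Finset.measurable_sum _ fun i _ =>
        measurable_conv (hL i).continuous (mG i)))).sub (measurable_const.mul
        (Finset.measurable_sum _ fun μ _ => measurable_conv ?_
          ((measurable_coord μ).mul hU)))).sub (measurable_const.mul mW)
    have : Continuous (b μ) :=
      continuous_iff_continuousAt.2 fun x => (hb' μ).continuousAt hθ (mem_univ x)
    exact continuous_ft (this.integrable_of_hasCompactSupport (hb μ))
  -- First order terms and commutators lose one order. The second limit comes from the first order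
  -- coefficients: an input of order `s - 1` and a kernel of order `t - 1`.
  set e : ℝ := min (r - 1) (s + t - 2)
  have he1 : e ≤ r - 1 := min_le_left _ _
  have he2 : e ≤ s + t - 2 := min_le_right _ _
  have hErr : HasGrowth e Γ₁ Err := by
    obtain ⟨A', -, hA'⟩ := exists_localizable E hθ hθ1 n
    have hB : ∀ μ, HasGrowth e Γ₁ (conv (ft (b μ)) fun ζ => (ζ μ : ℂ) * U ζ) := fun μ => by
      have hcont : Continuous (b μ) :=
        continuous_iff_continuousAt.2 fun x => (hb' μ).continuousAt hθ (mem_univ x)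
      obtain ⟨M, hM⟩ := hcont.bounded_above_of_compact_support (hb μ)
      refine (hA' (b μ) M (hb μ) (hb' μ) ((norm_nonneg _).trans (hM 0)) hM).hasGrowth_conv_of_le
        (fun t' h => hasGrowth_ft hθ hθ1 (hb μ) (hb' μ) h) (s := s - 1) (r := r - 1) (by linarith)
        ?_ hc h13 mΓ₁ mΓ₃ ((measurable_coord μ).mul hU)
        (hUs.weight MeasurableSet.univ zero_le_one fun z => norm_coord_le z μ)
        (hUr.weight mΓ₃ zero_le_one fun z => norm_coord_le z μ) he1 ?_
      · simp only [t] at hst; push_cast at hst; linarith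
      · simp only [t] at he2; push_cast at he2; linarith
    have mB : ∀ μ, Measurable (conv (ft (b μ)) fun ζ => (ζ μ : ℂ) * U ζ) := fun μ => by
      have : Continuous (b μ) :=
        continuous_iff_continuousAt.2 fun x => (hb' μ).continuousAt hθ (mem_univ x)
      exact measurable_conv (continuous_ft (this.integrable_of_hasCompactSupport (hb μ)))
        ((measurable_coord μ).mul hU)
    have g1 : HasGrowth e Γ₁ fun w => ∑ i, a₀ i * G i w :=
      HasGrowth.sum _ (fun i _ => ((hasGrowth_commutator hψ hU hs hc h13 mΓ₁ mΓ₃ hUs hUr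
        i.1 i.2).mono he1).const_mul mΓ₁ _) fun i _ => measurable_const.mul (mG i)
    have g2 : HasGrowth e Γ₁ fun w => (invConst E : ℂ) * ∑ i, conv (ft (a i)) (G i) w :=
      (HasGrowth.sum _ (fun i _ => (hL i).hasGrowth_conv_of_le (hLg i) (by linarith) (by linarith)
        hc h12 mΓ₁ mΓ₂ (mG i) (hGs i) (hGr i) he1 (by linarith)) fun i _ =>
        measurable_conv (hL i).continuous (mG i)).const_mul mΓ₁ _
    have g3 : HasGrowth e Γ₁ fun w => -(invConst E : ℂ) *
        ∑ μ, conv (ft (b μ)) (fun ζ => (ζ μ : ℂ) * U ζ) w :=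
      (HasGrowth.sum _ (fun μ _ => hB μ) fun μ _ => mB μ).const_mul mΓ₁ _
    have g4 : HasGrowth e Γ₁ fun w => -c₀ * W w :=
      ((hWr.mono (by linarith)).mono_set s13).const_mul mΓ₁ _
    have m1 : Measurable fun w => ∑ i, a₀ i * G i w :=
      Finset.measurable_sum _ fun i _ => measurable_const.mul (mG i)
    have m2 : Measurable fun w => (invConst E : ℂ) * ∑ i, conv (ft (a i)) (G i) w :=
      measurable_const.mul (Finset.measurable_sum _ fun i _ =>
        measurable_conv (hL i).continuous (mG i))
    have m3 : Measurable fun w => -(invConst E : ℂ) *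
        ∑ μ, conv (ft (b μ)) (fun ζ => (ζ μ : ℂ) * U ζ) w :=
      measurable_const.mul (Finset.measurable_sum _ fun μ _ => mB μ)
    convert ((g1.add g2 m1 m2).add g3 (m1.add m2) m3).add g4 ((m1.add m2).add m3)
      (measurable_const.mul mW) using 2 with w
    simp only [Err]
    ring
  -- The weight of order two dominates all `Q i` at once, so that every `V' i` is bounded by the
  -- same `V`.
  set V : E → ℂ := fun w => (((1 + ‖w‖) ^ (2 : ℝ) : ℝ) : ℂ) * W w
  have nV : ∀ w, ‖V w‖ = (1 + ‖w‖) ^ (2 : ℝ) * ‖W w‖ := fun w => by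
    rw [norm_mul, Complex.norm_real, Real.norm_of_nonneg (by positivity)]
  have wV : ∀ z : E, ‖(((1 + ‖z‖) ^ (2 : ℝ) : ℝ) : ℂ)‖ ≤ 1 * (1 + ‖z‖) ^ (2 : ℝ) := fun z => by
    rw [Complex.norm_real, Real.norm_of_nonneg (by positivity), one_mul]
  have mV : Measurable V := by
    have : Measurable fun w : E => (1 + ‖w‖) ^ (2 : ℝ) := by fun_prop
    exact (Complex.measurable_ofReal.comp this).mul mW
  have inv0 : 0 < invConst E := invConst_pos
  have habs := HasGrowth.absorb (K := fun i => ft (a i)) (V' := V') (V := V)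
    (Err := fun w => ((4 / κ : ℝ) : ℂ) * Err w) (t := t) (B := A * η) (b := 4 / κ * invConst E)
    (s := s - 2) (r := r - 2) (e := e) (c := c) hL (by linarith) (by linarith) ht1 (by positivity)
    hc h01 h13 s03 mΓ₁ mΓ₃ mV' mV (measurable_const.mul mErr)
    (fun i w => by
      rw [nV, norm_mul]
      have := hQ i w
      rw [one_mul] at this
      gcongr)
    (hWs.weight MeasurableSet.univ zero_le_one wV) (hWr.weight mΓ₃ zero_le_one wV)
    (hErr.const_mul mΓ₁ _) (fun i w => hconv i (mV' i) (hV's i) w) hsmall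
    (fun w hw hw1 => by
      have h1 : κ * ‖w‖ ^ 2 * ‖W w‖ ≤ ‖Err w‖ + invConst E * ‖T w‖ := by
        calc κ * ‖w‖ ^ 2 * ‖W w‖ ≤ ‖∑ i, a₀ i * Q i w‖ * ‖W w‖ := by
              gcongr; exact hell w hw
          _ = ‖Err w - invConst E * T w‖ := by rw [← norm_mul, main]
          _ ≤ ‖Err w‖ + ‖(invConst E : ℂ) * T w‖ := norm_sub_le _ _
          _ = _ := by rw [norm_mul, Complex.norm_real, Real.norm_of_nonneg inv0.le]
      rw [nV, norm_mul ((4 / κ : ℝ) : ℂ), Complex.norm_real,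
        Real.norm_of_nonneg (by positivity : 0 ≤ 4 / κ), Real.rpow_two]
      -- This is the origin of the constant `4 / κ`: `1 + ‖w‖ ≤ 2 ‖w‖` for `‖w‖ ≥ 1`.
      have h2 : (1 + ‖w‖) ^ 2 ≤ 4 / κ * (κ * ‖w‖ ^ 2) := by
        rw [← mul_assoc, div_mul_cancel₀ _ hκ.ne']
        nlinarith
      calc (1 + ‖w‖) ^ 2 * ‖W w‖ ≤ 4 / κ * (κ * ‖w‖ ^ 2) * ‖W w‖ := by gcongr
        _ = 4 / κ * (κ * ‖w‖ ^ 2 * ‖W w‖) := by ring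
        _ ≤ 4 / κ * (‖Err w‖ + invConst E * ‖T w‖) := by gcongr
        _ = _ := by ring)
  have wI : ∀ z : E, ‖(((1 + ‖z‖) ^ (-2 : ℝ) : ℝ) : ℂ)‖ ≤ 1 * (1 + ‖z‖) ^ (-2 : ℝ) := fun z => by
    rw [Complex.norm_real, Real.norm_of_nonneg (by positivity), one_mul]
  have hfin := habs.weight mΓ₀ zero_le_one wI
  have eW : (fun w => (((1 + ‖w‖) ^ (-2 : ℝ) : ℝ) : ℂ) * V w) = W := by
    ext w
    have : (1 + ‖w‖) ^ (-2 : ℝ) * (1 + ‖w‖) ^ (2 : ℝ) = 1 := by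
      rw [← Real.rpow_add (by positivity)]; norm_num
    simp only [V]
    rw [← mul_assoc, ← Complex.ofReal_mul, this, Complex.ofReal_one, one_mul]
  rw [eW] at hfin
  refine hfin.mono ?_
  have m1 := min_le_left (r + 1 / 2) (s + t)
  have m2 := min_le_right (r + 1 / 2) (s + t)
  rw [le_sub_iff_add_le]
  refine le_min (le_min (by linarith) (by linarith)) (le_min (by linarith) (by linarith))

end Improve

end KleinGordon

namespace KleinGordon

open scoped ENNReal NNReal

/-! ### Conic neighbourhoods -/

section Cones

variable {V : Type} [NormedAddCommGroup V] [InnerProductSpace ℝ V]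

/-- An open conic neighbourhood of `ζ₀`. -/
def cone (ζ₀ : V) (δ : ℝ) : Set V := {w | ‖‖w‖ • ζ₀ - ‖ζ₀‖ • w‖ < δ * ‖w‖}

theorem isOpen_cone (ζ₀ : V) (δ : ℝ) : IsOpen (cone ζ₀ δ) :=
  isOpen_lt (by fun_prop) (by fun_prop)

theorem mem_cone {ζ₀ : V} (h : ζ₀ ≠ 0) {δ : ℝ} (hδ : 0 < δ) : ζ₀ ∈ cone ζ₀ δ := by
  have := norm_pos_iff.2 h
  simp only [cone, mem_ofPred_eq, sub_self, norm_zero]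
  positivity

theorem smul_mem_cone {ζ₀ w : V} {δ a : ℝ} (h : w ∈ cone ζ₀ δ) (ha : 0 < a) : a • w ∈ cone ζ₀ δ := by
  simp only [cone, mem_ofPred_eq, norm_smul, Real.norm_of_nonneg ha.le] at h ⊢
  rw [smul_comm ‖ζ₀‖ a w, mul_smul, ← smul_sub, norm_smul, Real.norm_of_nonneg ha.le]
  nlinarith

theorem cone_mono {ζ₀ : V} {δ δ' : ℝ} (h : δ' ≤ δ) : cone ζ₀ δ' ⊆ cone ζ₀ δ := fun w hw =>
  lt_of_lt_of_le (show _ < δ' * ‖w‖ from hw) (by gcongr)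

/-- The defining function `‖‖w‖ ζ₀ - ‖ζ₀‖ w‖` is Lipschitz with constant `2 ‖ζ₀‖`; passing from the
inner cone out of the larger one takes a distance proportional to the norms of both points. -/
theorem coneSep_cone {ζ₀ : V} {δ δ' c : ℝ} (hδ' : 0 ≤ δ') (hlt : δ' < δ)
    (hc : c * (δ + 2 * ‖ζ₀‖) ≤ δ - δ') : ConeSep c (cone ζ₀ δ') (cone ζ₀ δ) := by
  intro w hw ζ hζ
  simp only [cone, mem_ofPred_eq, not_lt] at hw hζ
  set d := ‖w - ζ‖
  have hd : 0 ≤ d := norm_nonneg _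
  have h0 : 0 ≤ ‖ζ₀‖ := norm_nonneg _
  have n1 : |‖w‖ - ‖ζ‖| ≤ d := abs_norm_sub_norm_le w ζ
  have n2 : ‖w‖ ≤ ‖ζ‖ + d := by linarith [le_abs_self (‖w‖ - ‖ζ‖)]
  have h1 : ‖‖ζ‖ • ζ₀ - ‖ζ₀‖ • ζ‖ ≤ ‖‖w‖ • ζ₀ - ‖ζ₀‖ • w‖ + 2 * ‖ζ₀‖ * d := by
    have e : ‖ζ‖ • ζ₀ - ‖ζ₀‖ • ζ =
        (‖w‖ • ζ₀ - ‖ζ₀‖ • w) + (‖ζ₀‖ • (w - ζ) - (‖w‖ - ‖ζ‖) • ζ₀) := by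
      rw [smul_sub, sub_smul]; abel
    rw [e]
    refine (norm_add_le _ _).trans (add_le_add le_rfl ((norm_sub_le _ _).trans ?_))
    rw [norm_smul, norm_smul, norm_norm, Real.norm_eq_abs]
    nlinarith
  have h2 : (δ - δ') * ‖ζ‖ ≤ (δ' + 2 * ‖ζ₀‖) * d := by nlinarith
  have hpos : 0 < δ + 2 * ‖ζ₀‖ := by linarith
  have h3 : (δ - δ') * ‖ζ‖ ≤ (δ + 2 * ‖ζ₀‖) * d := by nlinarith
  have h4 : (δ - δ') * ‖w‖ ≤ (δ + 2 * ‖ζ₀‖) * d := by nlinarith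
  constructor
  · have : c * (δ + 2 * ‖ζ₀‖) * ‖w‖ ≤ (δ - δ') * ‖w‖ := by gcongr
    nlinarith
  · have : c * (δ + 2 * ‖ζ₀‖) * ‖ζ‖ ≤ (δ - δ') * ‖ζ‖ := by gcongr
    nlinarith

end Cones

/-! ### Microlocal regularity by iteration -/

section Bootstrap

variable {ι : Type} [Fintype ι]

local notation "E" => EuclideanSpace ℝ ι

/-- After rescaling to the norm of `ζ₀`, a point of the cone is `δ`-close to `ζ₀`, where continuity
keeps the form away from zero; homogeneity of degree two does the rest. -/
theorem exists_cone_elliptic {a₀ : ι × ι → ℂ} {ζ₀ : E} (hζ : ζ₀ ≠ 0)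
    (h : ∑ i, a₀ i * ((ζ₀ i.1 : ℂ) * (ζ₀ i.2 : ℂ)) ≠ 0) :
    ∃ δ κ : ℝ, 0 < δ ∧ 0 < κ ∧ ∀ w ∈ cone ζ₀ δ,
      κ * ‖w‖ ^ 2 ≤ ‖∑ i, a₀ i * ((w i.1 : ℂ) * (w i.2 : ℂ))‖ := by
  set p : E → ℂ := fun w => ∑ i, a₀ i * ((w i.1 : ℂ) * (w i.2 : ℂ)) with hp
  have hcont : Continuous fun w => ‖p w‖ := by simp only [hp]; fun_prop
  have hp0 : 0 < ‖p ζ₀‖ := norm_pos_iff.2 h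
  have hz0 : 0 < ‖ζ₀‖ := norm_pos_iff.2 hζ
  have hev : ∀ᶠ w in 𝓝 ζ₀, ‖p ζ₀‖ / 2 < ‖p w‖ :=
    (hcont.tendsto ζ₀).eventually (lt_mem_nhds (by linarith))
  obtain ⟨δ, hδ, hball⟩ := Metric.eventually_nhds_iff.1 hev
  refine ⟨δ, ‖p ζ₀‖ / 2 / ‖ζ₀‖ ^ 2, hδ, by positivity, fun w hw => ?_⟩
  change ‖‖w‖ • ζ₀ - ‖ζ₀‖ • w‖ < δ * ‖w‖ at hw
  have hw0 : 0 < ‖w‖ := by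
    by_contra hn
    have : ‖w‖ = 0 := le_antisymm (not_lt.1 hn) (norm_nonneg _)
    rw [this, mul_zero] at hw
    exact absurd hw (norm_nonneg _).not_gt
  set q := ‖ζ₀‖ / ‖w‖ with hq
  have h1 : dist (q • w) ζ₀ < δ := by
    have e : q • w - ζ₀ = -(‖w‖⁻¹ • (‖w‖ • ζ₀ - ‖ζ₀‖ • w)) := by
      rw [smul_sub, smul_smul, smul_smul, inv_mul_cancel₀ hw0.ne', one_smul, neg_sub, hq,
        div_eq_inv_mul]
    rw [dist_eq_norm, e, norm_neg, norm_smul, norm_inv, norm_norm, inv_mul_lt_iff₀ hw0]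
    linarith
  have h2 := (hball h1).le
  have h3 : p (q • w) = ((q ^ 2 : ℝ) : ℂ) * p w := by
    simp only [hp, PiLp.smul_apply, smul_eq_mul, Finset.mul_sum]
    refine Finset.sum_congr rfl fun i _ => ?_
    push_cast; ring
  rw [h3, norm_mul, Complex.norm_real, Real.norm_of_nonneg (by positivity), hq, div_pow] at h2
  change _ ≤ ‖p w‖
  rw [div_mul_eq_mul_div, div_le_iff₀ (by positivity)]
  calc ‖p ζ₀‖ / 2 * ‖w‖ ^ 2 ≤ ‖ζ₀‖ ^ 2 / ‖w‖ ^ 2 * ‖p w‖ * ‖w‖ ^ 2 := by gcongr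
    _ = ‖p w‖ * ‖ζ₀‖ ^ 2 := by field_simp

/-- The localized Fourier transforms `U χ` of a solution of a second order equation
`∑ a_{μν} D_μ D_ν u + ∑ b_μ D_μ u + c u = 0` in `Ω`, which is of regularity `s`. -/
structure IsLocalSolution (Ω : Set E) (s : ℝ) (a : ι × ι → E → ℂ) (b : ι → E → ℂ) (c₀ : ℂ)
    (U : (E → ℂ) → E → ℂ) : Prop where
  measurable : ∀ χ, IsTest χ → tsupport χ ⊆ Ω → Measurable (U χ)
  growth : ∀ χ, IsTest χ → tsupport χ ⊆ Ω → HasGrowth s univ (U χ)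
  mul : ∀ ψ χ, IsTest ψ → IsTest χ → tsupport χ ⊆ Ω →
    ∀ w, U (fun z => ψ z * χ z) w = invConst E * conv (ft ψ) (U χ) w
  equation : ∀ ψ χ, IsTest ψ → IsTest χ → tsupport χ ⊆ Ω → (∀ᶠ z in 𝓝ˢ (tsupport ψ), χ z = 1) →
    ∀ w, ∑ i : ι × ι, conv (ft fun z => a i z * ψ z)
        (fun ζ => (ζ i.1 : ℂ) * (ζ i.2 : ℂ) * U χ ζ) w +
      ∑ μ, conv (ft fun z => b μ z * ψ z) (fun ζ => (ζ μ : ℂ) * U χ ζ) w +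
      c₀ * conv (ft ψ) (U χ) w = 0

theorem exists_bump (z₀ : E) {ρ : ℝ} (hρ : 0 < ρ) :
    ∃ χ : E → ℂ, IsTest χ ∧ (∀ z, ‖χ z‖ ≤ 1) ∧ (∀ z ∈ Metric.ball z₀ (ρ / 2), χ z = 1) ∧
      tsupport χ ⊆ Metric.ball z₀ ρ := by
  let f : ContDiffBump z₀ := ⟨ρ / 2, 3 / 4 * ρ, by positivity, by linarith⟩
  have hts : tsupport (fun z => (f z : ℂ)) ⊆ tsupport f :=
    closure_mono fun z hz => by
      simp only [Function.mem_support, ne_eq, Complex.ofReal_eq_zero] at hz ⊢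
      exact hz
  refine ⟨fun z => (f z : ℂ), ⟨Complex.ofRealCLM.contDiff.comp f.contDiff,
    f.hasCompactSupport.comp_left Complex.ofReal_zero⟩, fun z => ?_, fun z hz => ?_, ?_⟩
  · rw [Complex.norm_real, Real.norm_of_nonneg f.nonneg]
    exact f.le_one
  · change ((f z : ℝ) : ℂ) = 1
    rw [f.one_of_mem_closedBall (Metric.ball_subset_closedBall hz), Complex.ofReal_one]
  · refine hts.trans ?_
    rw [f.tsupport_eq]
    exact Metric.closedBall_subset_ball (by change 3 / 4 * ρ < ρ; linarith)

theorem LocHol.test_mul {θ : ℝ} (hθ : 0 < θ) (hθ1 : θ ≤ 1) {n : ℕ} {Ω : Set E} (hΩ : IsOpen Ω)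
    {χ a : E → ℂ} (hχ : IsTest χ) (hs : tsupport χ ⊆ Ω) (ha : LocHol θ n Ω a) :
    LocHol θ n univ fun z => a z * χ z := by
  have := LocHol.cutoff hθ hθ1 hΩ (ContinuousLinearMap.mul ℝ ℂ) hχ.1 hs ha
  simpa only [ContinuousLinearMap.mul_apply', mul_comm] using this

theorem IsTest.hasCompactSupport_mul {χ : E → ℂ} (hχ : IsTest χ) (a : E → ℂ) :
    HasCompactSupport fun z => a z * χ z := hχ.2.mul_left

/-- `hasGrowth_improve` is applied with the coefficients frozen at `z₀` and the differences cut off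
by `χ`, which is `1` on the half ball carrying `ψ`. Four nested cones provide the margins between
input and output, at the cost of a quarter of the aperture. -/
theorem IsLocalSolution.improve {Ω : Set E} (hΩ : IsOpen Ω) {s θ : ℝ} {n : ℕ} (hθ : 0 < θ)
    (hθ1 : θ ≤ 1) {a : ι × ι → E → ℂ} {b : ι → E → ℂ} {c₀ : ℂ} {U : (E → ℂ) → E → ℂ}
    (hU : IsLocalSolution Ω s a b c₀ U) (ha : ∀ i, LocHol θ (n + 1) Ω (a i))
    (hb : ∀ μ, LocHol θ n Ω (b μ)) (hs : s < 1) (hst : 2 < s + ((n + 1 : ℕ) + θ)) {A : ℝ}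
    (hloc : ∀ (G : E → ℂ) (M : ℝ), HasCompactSupport G → LocHol θ (n + 1) univ G → 0 ≤ M →
      (∀ x, ‖G x‖ ≤ M) → Localizable ((n + 1 : ℕ) + θ) (A * M) (ft G))
    {z₀ ζ₀ : E} {δ ρ η κ r : ℝ} (hδ : 0 < δ) (hρ : 0 < ρ) (hη : 0 ≤ η) (hκ : 0 < κ)
    (hball : Metric.ball z₀ ρ ⊆ Ω) (hclose : ∀ i, ∀ z ∈ Metric.ball z₀ ρ, ‖a i z - a i z₀‖ ≤ η)
    (hell : ∀ w ∈ cone ζ₀ δ, κ * ‖w‖ ^ 2 ≤ ‖∑ i, a i z₀ * ((w i.1 : ℂ) * (w i.2 : ℂ))‖)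
    (hsmall : 4 / κ * invConst E * (Fintype.card (ι × ι) * (A * η)) ≤ 1 / 2)
    (hr : ∀ χ, IsTest χ → tsupport χ ⊆ Metric.ball z₀ ρ → HasGrowth r (cone ζ₀ δ) (U χ))
    {ψ : E → ℂ} (hψ : IsTest ψ) (hψs : tsupport ψ ⊆ Metric.ball z₀ (ρ / 2)) :
    HasGrowth (min (r + 1 / 2) (s + ((n + 1 : ℕ) + θ))) (cone ζ₀ (δ / 4)) (U ψ) := by
  obtain ⟨χ, hχ, hχ1, hχe, hχs⟩ := exists_bump z₀ hρ
  have hχΩ := hχs.trans hball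
  have hψρ : tsupport ψ ⊆ Metric.ball z₀ ρ := hψs.trans (Metric.ball_subset_ball (by linarith))
  have hψΩ := hψρ.trans hball
  have hW : (fun w => (invConst E : ℂ) * conv (ft ψ) (U χ) w) = U ψ := by
    ext w
    rw [← hU.mul ψ χ hψ hχ hχΩ]
    congr 1; ext z
    by_cases hz : z ∈ tsupport ψ
    · rw [hχe z (hψs hz), mul_one]
    · rw [image_eq_zero_of_notMem_tsupport hz, zero_mul]
  -- The apertures `δ / 4, δ / 2, 3 δ / 4, δ` are at least `δ / 4` apart, so one constant serves all
  -- pairs.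
  set c : ℝ := δ / 4 / (δ + 2 * ‖ζ₀‖)
  have hz0 := norm_nonneg ζ₀
  have hc : 0 < c := by positivity
  have hc' : c * (δ + 2 * ‖ζ₀‖) = δ / 4 := div_mul_cancel₀ _ (by positivity)
  have hcd : ∀ d ≤ δ, c * (d + 2 * ‖ζ₀‖) ≤ δ / 4 := fun d hd => by
    rw [← hc']; gcongr
  have hd : ∀ i, LocHol θ (n + 1) Ω fun z => a i z - a i z₀ := fun i => by
    have : LocHol θ (n + 1) Ω fun _ : E => -a i z₀ := locHol_of_contDiffOn hθ1 hΩ contDiffOn_const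
    simpa only [sub_eq_add_neg] using (ha i).add hΩ this
  have hd' : ∀ i, LocHol θ (n + 1) univ fun z => (a i z - a i z₀) * χ z := fun i =>
    (hd i).test_mul hθ hθ1 hΩ hχ hχΩ
  rw [← hW]
  have mU := hU.measurable χ hχ hχΩ
  have gU := hU.growth χ hχ hχΩ
  refine hasGrowth_improve hθ hθ1 hloc hs hst hc (Γ₁ := cone ζ₀ (δ / 2))
    (Γ₂ := cone ζ₀ (3 / 4 * δ)) (Γ₃ := cone ζ₀ δ)
    (coneSep_cone (by linarith) (by linarith) ((hcd _ (by linarith)).trans (by linarith)))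
    (coneSep_cone (by linarith) (by linarith) ((hcd _ (by linarith)).trans (by linarith)))
    (coneSep_cone (by linarith) (by linarith) ((hcd _ (by linarith)).trans (by linarith)))
    (coneSep_cone (by linarith) (by linarith) ((hcd _ (by linarith)).trans (by linarith)))
    (cone_mono (by linarith)) (cone_mono (by linarith)) (isOpen_cone _ _).measurableSet
    (isOpen_cone _ _).measurableSet (isOpen_cone _ _).measurableSet (isOpen_cone _ _).measurableSet
    mU hψ gU (hr χ hχ hχs)
    (by rw [hW]; exact hU.growth ψ hψ hψΩ) (by rw [hW]; exact hr ψ hψ hψρ)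
    (a₀ := fun i => a i z₀) (c₀ := c₀) (a := fun i z => (a i z - a i z₀) * χ z)
    (b := fun μ z => b μ z * ψ z) hη hκ (fun i => hχ.hasCompactSupport_mul _) hd' (fun i z => ?_)
    (fun μ => hψ.hasCompactSupport_mul _) (fun μ => (hb μ).test_mul hθ hθ1 hΩ hψ hψΩ)
    (fun w hw => hell w (cone_mono (by linarith) hw)) hsmall (fun w => ?_)
  · by_cases hz : z ∈ tsupport χ
    · rw [norm_mul]
      calc _ ≤ η * 1 := by
            gcongr
            · exact hclose i z (hχs hz)
            · exact hχ1 z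
        _ = η := mul_one _
    · rw [image_eq_zero_of_notMem_tsupport hz, mul_zero, norm_zero]; exact hη
  · rw [← hU.equation ψ χ hψ hχ hχΩ (by
      refine Filter.mem_of_superset (Metric.isOpen_ball.mem_nhdsSet.2 hψs) fun z hz => hχe z hz) w]
    congr 2
    refine Finset.sum_congr rfl fun i _ => ?_
    obtain ⟨t', ht', ht''⟩ := exists_between (show 2 - s < (n + 1 : ℕ) + θ by linarith)
    have gQ : HasGrowth (s - 2) univ fun ζ : E => (ζ i.1 : ℂ) * (ζ i.2 : ℂ) * U χ ζ :=
      gU.weight MeasurableSet.univ zero_le_one fun z => norm_coord_mul_le z i.1 i.2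
    have mQ : Measurable fun ζ : E => (ζ i.1 : ℂ) * (ζ i.2 : ℂ) * U χ ζ :=
      ((measurable_coord i.1).mul (measurable_coord i.2)).mul mU
    have hdψ : LocHol θ (n + 1) univ fun z => (a i z - a i z₀) * χ z * ψ z :=
      (hd' i).test_mul hθ hθ1 isOpen_univ hψ (subset_univ _)
    have hi : Integrable fun z => (a i z - a i z₀) * χ z * ψ z := by
      have hcont : Continuous fun z => (a i z - a i z₀) * χ z * ψ z :=
        continuous_iff_continuousAt.2 fun x => hdψ.continuousAt hθ (mem_univ x)
      exact hcont.integrable_of_hasCompactSupport (hψ.hasCompactSupport_mul _)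
    have i1 := (hψ.integrable_conv mQ gQ w).const_mul (a i z₀)
    have i2 := integrable_conv_of_growth (continuous_ft hi).measurable mQ
      (hasGrowth_ft hθ hθ1 (hψ.hasCompactSupport_mul _) hdψ ht'') gQ (by linarith) w
    -- On the support of `ψ` one has `χ = 1`, so inserting the cut-off into the difference changes
    -- nothing.
    have e : (ft fun z => a i z * ψ z) =
        fun x => a i z₀ * ft ψ x + ft (fun z => (a i z - a i z₀) * χ z * ψ z) x := by
      ext x
      rw [← ft_const_mul, ← ft_add (hψ.integrable.const_mul _) hi]
      congr 1; ext z
      by_cases hz : z ∈ tsupport ψ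
      · rw [hχe z (hψs hz)]; ring
      · rw [image_eq_zero_of_notMem_tsupport hz]; ring
    rw [e, conv_add_left (by simpa only [mul_assoc] using i1) i2]
    congr 1
    simp only [conv, mul_assoc]
    rw [integral_const_mul]

/-- Microlocal elliptic regularity for equations with coefficients of limited smoothness. -/
theorem IsLocalSolution.exists_hasGrowth {Ω : Set E} (hΩ : IsOpen Ω) {s θ : ℝ} {n : ℕ} (hθ : 0 < θ)
    (hθ1 : θ ≤ 1) {a : ι × ι → E → ℂ} {b : ι → E → ℂ} {c₀ : ℂ} {U : (E → ℂ) → E → ℂ}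
    (hU : IsLocalSolution Ω s a b c₀ U) (ha : ∀ i, LocHol θ (n + 1) Ω (a i))
    (hb : ∀ μ, LocHol θ n Ω (b μ)) (hs : s < 1) (hst : 2 < s + ((n + 1 : ℕ) + θ))
    {z₀ ζ₀ : E} (hz₀ : z₀ ∈ Ω) (hζ₀ : ζ₀ ≠ 0)
    (hell : ∑ i, a i z₀ * ((ζ₀ i.1 : ℂ) * (ζ₀ i.2 : ℂ)) ≠ 0) :
    ∃ δ ρ : ℝ, 0 < δ ∧ 0 < ρ ∧ Metric.ball z₀ ρ ⊆ Ω ∧ ∀ ψ, IsTest ψ →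
      tsupport ψ ⊆ Metric.ball z₀ ρ → HasGrowth (s + ((n + 1 : ℕ) + θ)) (cone ζ₀ δ) (U ψ) := by
  obtain ⟨δ₀, κ, hδ₀, hκ, hell⟩ := exists_cone_elliptic hζ₀ hell
  obtain ⟨A, hA, hloc⟩ := exists_localizable E hθ hθ1 (n + 1)
  have inv0 : 0 < invConst E := invConst_pos
  set D : ℝ := 4 / κ * invConst E * (Fintype.card (ι × ι) * A)
  have hD : 0 ≤ D := by positivity
  -- The oscillation allowed for the coefficients depends on the ellipticity constant and the
  -- dimension, and on the solution not at all; hence the same initial ball serves all rounds.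
  set η : ℝ := (2 * (D + 1))⁻¹
  have hη : 0 < η := by positivity
  have hsmall : 4 / κ * invConst E * (Fintype.card (ι × ι) * (A * η)) ≤ 1 / 2 := by
    calc _ = D * η := by simp only [D]; ring
      _ ≤ (D + 1) * η := by gcongr; linarith
      _ = 1 / 2 := by simp only [η]; field_simp
  have hev : ∀ᶠ z in 𝓝 z₀, z ∈ Ω ∧ ∀ i, ‖a i z - a i z₀‖ < η := by
    refine (hΩ.eventually_mem hz₀).and (eventually_all.2 fun i => ?_)
    have := ((ha i).continuousAt hθ hz₀).sub_const (a i z₀)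
    have h2 := this.norm
    refine h2.eventually_lt continuousAt_const ?_
    simpa using hη
  obtain ⟨ρ₀, hρ₀, hball⟩ := Metric.eventually_nhds_iff_ball.1 hev
  set t : ℝ := (n + 1 : ℕ) + θ
  have step : ∀ k : ℕ, ∃ δ ρ : ℝ, 0 < δ ∧ δ ≤ δ₀ ∧ 0 < ρ ∧ ρ ≤ ρ₀ ∧ ∀ ψ, IsTest ψ →
      tsupport ψ ⊆ Metric.ball z₀ ρ → HasGrowth (min (s + k / 2) (s + t)) (cone ζ₀ δ) (U ψ) := by
    intro k
    induction k with
    | zero =>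
      refine ⟨δ₀, ρ₀, hδ₀, le_rfl, hρ₀, le_rfl, fun ψ hψ hψs => ?_⟩
      refine ((hU.growth ψ hψ (hψs.trans fun z hz => (hball z hz).1)).mono ?_).mono_set
        (subset_univ _)
      refine (min_le_left _ _).trans ?_
      simp
    | succ k ih =>
      obtain ⟨δ, ρ, h1, h2, h3, h4, h5⟩ := ih
      have hsub : Metric.ball z₀ ρ ⊆ Metric.ball z₀ ρ₀ := Metric.ball_subset_ball h4
      refine ⟨δ / 4, ρ / 2, by linarith, by linarith, by linarith, by linarith, fun ψ hψ hψs => ?_⟩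
      refine (hU.improve hΩ hθ hθ1 ha hb hs hst hloc h1 h3 hη.le hκ
        (fun z hz => (hball z (hsub hz)).1) (fun i z hz => ((hball z (hsub hz)).2 i).le)
        (fun w hw => hell w (cone_mono h2 hw)) hsmall h5 hψ hψs).mono ?_
      have m1 := min_le_left (s + ((k + 1 : ℕ) : ℝ) / 2) (s + t)
      have m2 := min_le_right (s + ((k + 1 : ℕ) : ℝ) / 2) (s + t)
      rw [Nat.cast_succ] at m1 m2 ⊢
      refine le_min ?_ m2
      rw [← sub_le_iff_le_add]
      exact le_min (by linarith) (by linarith)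
  -- Each round gains `1 / 2`, so `N ≥ 2 t` rounds reach the ceiling `s + t`.
  obtain ⟨N, hN⟩ := exists_nat_ge (2 * t)
  obtain ⟨δ, ρ, h1, -, h3, h4, h5⟩ := step N
  refine ⟨δ, ρ, h1, h3, fun z hz => (hball z (Metric.ball_subset_ball h4 hz)).1, fun ψ hψ hψs => ?_⟩
  have := h5 ψ hψ hψs
  rwa [min_eq_right (by linarith)] at this

end Bootstrap

end KleinGordon

namespace KleinGordon

open scoped ENNReal NNReal FourierTransform

/-! ### Local representation of distributions -/

section Representation

/-- The bound lets `u` factor through the range of `J`; Hahn–Banach extends the factor to `H`, and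
Riesz represents it. -/
theorem exists_inner_eq_of_le {X H : Type*} [AddCommGroup X] [Module ℂ X] [NormedAddCommGroup H]
    [InnerProductSpace ℂ H] [CompleteSpace H] (u : X →ₗ[ℂ] ℂ) (J : X →ₗ[ℂ] H) {C : ℝ}
    (h : ∀ x, ‖u x‖ ≤ C * ‖J x‖) : ∃ m : H, ∀ x, u x = inner ℂ m (J x) := by
  have hker : LinearMap.ker J ≤ LinearMap.ker u := fun x hx => by
    have := h x
    rw [LinearMap.mem_ker.1 hx, norm_zero, mul_zero] at this
    exact norm_le_zero_iff.1 this
  let g : LinearMap.range J →ₗ[ℂ] ℂ :=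
    (LinearMap.ker J).liftQ u hker ∘ₗ J.quotKerEquivRange.symm.toLinearMap
  have hg : ∀ x, g ⟨J x, LinearMap.mem_range_self J x⟩ = u x := fun x => by
    have := J.quotKerEquivRange_symm_apply_image x (LinearMap.mem_range_self J x)
    simp only [g, LinearMap.coe_comp, LinearEquiv.coe_coe, Function.comp_apply, this]
    exact Submodule.liftQ_apply _ _ _
  have hgb : ∀ y, ‖g y‖ ≤ C * ‖y‖ := by
    rintro ⟨y, x, rfl⟩
    rw [hg]; exact h x
  obtain ⟨G, hG, -⟩ := exists_extension_norm_eq (LinearMap.range J) (g.mkContinuous C hgb)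
  refine ⟨(InnerProductSpace.toDual ℂ H).symm G, fun x => ?_⟩
  rw [InnerProductSpace.toDual_symm_apply, ← hg x]
  exact (hG ⟨J x, LinearMap.mem_range_self J x⟩).symm

variable {E : Type} [NormedAddCommGroup E] [InnerProductSpace ℝ E] [FiniteDimensional ℝ E]
  [MeasurableSpace E] [BorelSpace E]

theorem fourier_eq_ft (f : E → ℂ) (x : E) :
    𝓕 f x = ft f ((2 * Real.pi) • x) := by
  rw [ft_eq_fourier, smul_smul, inv_mul_cancel₀ (by positivity), one_smul]

/-- As a Fourier transform of its reflected transform, `f` has derivatives bounded by moments of `ft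
f`. Seminorms of test functions thus become weighted integrals on the Fourier side. -/
theorem IsTest.norm_iteratedFDeriv_le {f : E → ℂ} (hf : IsTest f) {k N : ℕ} (hk : k ≤ N) (z : E) :
    ‖iteratedFDeriv ℝ k f z‖ ≤
      ((2 * Real.pi) ^ k * (k + 1)) * ∫ η, (1 + ‖η‖) ^ N * ‖ft f η‖ := by
  have hcont := hf.continuous_ft
  set g : E → ℂ := fun x => 𝓕 f (-x) with hg
  have hgc : Continuous g := by
    have : g = fun x => ft f ((2 * Real.pi) • -x) := funext fun x => fourier_eq_ft f _
    rw [this]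
    exact hcont.comp (by fun_prop)
  have hfg : f = 𝓕 g := by
    have h1 : 𝓕⁻ (𝓕 f) = f := by
      set F := hf.2.toSchwartzMap hf.1
      change 𝓕⁻ (𝓕 (F : E → ℂ)) = F
      rw [← SchwartzMap.fourier_coe, ← SchwartzMap.fourierInv_coe,
        FourierTransform.fourierInv_fourier_eq]
    rw [← h1, Real.fourierInv_eq_fourier_comp_neg]
  have hweight : Integrable fun η : E => (1 + ‖η‖) ^ N * ‖ft f η‖ := by
    have := hf.integrable_weight N
    simpa only [Real.rpow_natCast] using this
  have hπ : 1 ≤ 2 * Real.pi := by linarith [Real.pi_gt_three]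
  have hπ0 : -(2 * Real.pi) ≠ 0 := by linarith
  have hle : ∀ p ≤ N, ∀ v : E, ‖v‖ ^ p * ‖g v‖ ≤
      (1 + ‖(-(2 * Real.pi)) • v‖) ^ N * ‖ft f ((-(2 * Real.pi)) • v)‖ := fun p hp v => by
    have e : g v = ft f ((-(2 * Real.pi)) • v) := by
      simp only [hg, fourier_eq_ft]
      rw [smul_neg, neg_smul]
    rw [e]
    gcongr
    have : ‖v‖ ≤ 1 + ‖(-(2 * Real.pi)) • v‖ := by
      rw [norm_smul, norm_neg, Real.norm_of_nonneg (by positivity)]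
      nlinarith [norm_nonneg v]
    calc ‖v‖ ^ p ≤ (1 + ‖(-(2 * Real.pi)) • v‖) ^ p := by gcongr
      _ ≤ _ := pow_le_pow_right₀ (by linarith [norm_nonneg ((-(2 * Real.pi)) • v)]) hp
  have hi0 : Integrable fun v : E =>
      (1 + ‖(-(2 * Real.pi)) • v‖) ^ N * ‖ft f ((-(2 * Real.pi)) • v)‖ :=
    hweight.comp_smul hπ0
  have hi : ∀ p ≤ N, Integrable fun v => ‖v‖ ^ p * ‖g v‖ := fun p hp => by
    refine hi0.mono ((by fun_prop : Continuous fun v => ‖v‖ ^ p * ‖g v‖).aestronglyMeasurable)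
      (ae_of_all _ fun v => ?_)
    rw [Real.norm_of_nonneg (by positivity), Real.norm_of_nonneg (by positivity)]
    exact hle p hp v
  have hI : ∀ p ≤ N, ∫ v, ‖v‖ ^ p * ‖g v‖ ≤ ∫ η, (1 + ‖η‖) ^ N * ‖ft f η‖ := fun p hp => by
    refine (integral_mono (hi p hp) hi0 (hle p hp)).trans ?_
    rw [Measure.integral_comp_smul (volume : Measure E)
      (fun η => (1 + ‖η‖) ^ N * ‖ft f η‖), smul_eq_mul]
    refine mul_le_of_le_one_left (integral_nonneg fun η => by positivity) ?_
    rw [abs_inv, abs_pow, abs_neg, abs_of_nonneg (by positivity)]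
    exact inv_le_one_of_one_le₀ (one_le_pow₀ hπ)
  have key := Real.pow_mul_norm_iteratedFDeriv_fourier_le (f := g) (K := k) (N := 0)
    (contDiff_zero.2 hgc) (fun p m hp hm => by
      have : m = 0 := by simpa using hm
      subst this
      simpa using hi p ((by exact_mod_cast hp : p ≤ k).trans hk)) (k := k) (n := 0) le_rfl le_rfl z
  simp only [pow_zero, one_mul, mul_one, zero_add, Finset.range_one, Finset.product_singleton,
    Finset.sum_map, Function.Embedding.coeFn_mk, norm_iteratedFDeriv_zero] at key
  rw [← hfg] at key
  refine key.trans ?_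
  rw [mul_assoc]
  gcongr
  refine (Finset.sum_le_card_nsmul _ _ _ fun p hp => hI p ?_).trans_eq ?_
  · have := Finset.mem_range.1 hp; omega
  · simp

theorem memLp_weight_ft {f : E → ℂ} (hf : IsTest f) (M : ℕ) :
    MemLp (fun η => (((1 + ‖η‖) ^ M : ℝ) : ℂ) * ft f η) 2 := by
  have hcont := hf.continuous_ft
  have hc : Continuous fun η => (((1 + ‖η‖) ^ M : ℝ) : ℂ) * ft f η := by fun_prop
  rw [memLp_two_iff_integrable_sq_norm hc.aestronglyMeasurable]
  obtain ⟨C, hC, hb⟩ := hf.exists_pow_mul_le M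
  have hw := (hf.integrable_weight M).const_mul C
  simp only [Real.rpow_natCast] at hw
  refine hw.mono (hc.norm.pow 2).aestronglyMeasurable (ae_of_all _ fun η => ?_)
  rw [Real.norm_of_nonneg (by positivity), Real.norm_of_nonneg (by positivity), norm_mul,
    Complex.norm_real, Real.norm_of_nonneg (by positivity), pow_two]
  gcongr
  exact hb η

/-- Cauchy–Schwarz against the square integrable weight `(1 + ‖η‖) ^ (-(d + 1))`, with `d` the
dimension. -/
theorem exists_integral_le_norm (E : Type) [NormedAddCommGroup E] [InnerProductSpace ℝ E]
    [FiniteDimensional ℝ E] [MeasurableSpace E] [BorelSpace E] (N : ℕ) :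
    ∃ M : ℕ, ∃ C : ℝ, 0 ≤ C ∧ ∀ (f : E → ℂ) (hf : IsTest f),
      ∫ η, (1 + ‖η‖) ^ N * ‖ft f η‖ ≤ C * ‖(memLp_weight_ft hf M).toLp‖ := by
  set d := Module.finrank ℝ E
  set ρ : E → ℝ := fun η => ((1 + ‖η‖) ^ (d + 1))⁻¹
  have hρc : Continuous ρ :=
    Continuous.inv₀ (by fun_prop) fun η => by positivity
  have hρ : MemLp ρ 2 := by
    rw [memLp_two_iff_integrable_sq_norm hρc.aestronglyMeasurable]
    have hi : Integrable fun x : E => (1 + ‖x‖) ^ (-((2 * (d + 1) : ℕ) : ℝ)) :=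
      integrable_one_add_norm (by push_cast; linarith [(by positivity : (0 : ℝ) ≤ d)])
    refine hi.congr (ae_of_all _ fun x => ?_)
    simp only [ρ]
    rw [Real.norm_of_nonneg (by positivity), Real.rpow_neg (by positivity), Real.rpow_natCast,
      inv_pow, ← pow_mul, mul_comm 2]
  refine ⟨N + (d + 1), (∫ η, ‖ρ η‖ ^ (2 : ℝ)) ^ (1 / 2 : ℝ),
    Real.rpow_nonneg (integral_nonneg fun η => by positivity) _, fun f hf => ?_⟩
  set g : E → ℂ := fun η => (((1 + ‖η‖) ^ (N + (d + 1)) : ℝ) : ℂ) * ft f η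
  have hg : MemLp g 2 := memLp_weight_ft hf (N + (d + 1))
  have h2 : ENNReal.ofReal 2 = 2 := by norm_num
  have key := integral_mul_norm_le_Lp_mul_Lq (μ := (volume : Measure E)) (f := ρ)
    (g := fun η => ‖g η‖) (p := 2) (q := 2) (Real.HolderConjugate.two_two) (by rwa [h2])
    (by rw [h2]; exact hg.norm)
  have e1 : ∀ η, ‖ρ η‖ * ‖‖g η‖‖ = (1 + ‖η‖) ^ N * ‖ft f η‖ := fun η => by
    rw [norm_norm, norm_mul, Complex.norm_real, Real.norm_of_nonneg (by positivity),
      Real.norm_of_nonneg (by positivity), pow_add]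
    simp only [ρ]
    field_simp
  have e2 : ‖hg.toLp‖ = (∫ η, ‖‖g η‖‖ ^ (2 : ℝ)) ^ (1 / 2 : ℝ) := by
    rw [Lp.norm_toLp, hg.eLpNorm_eq_integral_rpow_norm (by norm_num) (by norm_num),
      ENNReal.toReal_ofReal (Real.rpow_nonneg (integral_nonneg fun η => by positivity) _)]
    simp
  simp only [e1] at key
  rw [← e2] at key
  exact key

/-- On test functions with support in a compact set, a distribution is given by the integral of the
Fourier transform against a function of polynomial growth. -/
theorem exists_ft_representation {Ω : Opens E} (u : 𝓓(Ω, ℂ) →L[ℂ] ℂ) {K : Set E} (hK : IsCompact K)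
    (hKΩ : K ⊆ Ω) :
    ∃ (ν : E → ℂ) (r : ℝ), Measurable ν ∧ HasGrowth r univ ν ∧ ∀ f : 𝓓(Ω, ℂ), tsupport f ⊆ K →
      u f = ∫ η, ν (-η) * ft f η := by
  let K' : Compacts E := ⟨K, hK⟩
  let u' : 𝓓_{K'}(E, ℂ) →L[ℂ] ℂ := u.comp (TestFunction.ofSupportedInCLM ℂ (K := K') hKΩ)
  have hT : ∀ f : 𝓓_{K'}(E, ℂ), IsTest f := fun f => ⟨f.contDiff, f.compact_supp⟩
  have hq : Continuous ((normSeminorm ℂ ℂ).comp (u' : 𝓓_{K'}(E, ℂ) →ₗ[ℂ] ℂ)) :=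
    continuous_norm.comp u'.continuous
  obtain ⟨s, C, -, hC⟩ := Seminorm.bound_of_continuous
    (ContDiffMapSupportedIn.withSeminorms ℂ E ℂ ⊤ K') _ hq
  obtain ⟨N, hN⟩ := s.exists_le
  obtain ⟨M, C₁, hC₁, hM⟩ := exists_integral_le_norm E N
  let J : 𝓓_{K'}(E, ℂ) →ₗ[ℂ] Lp ℂ 2 (volume : Measure E) :=
    { toFun := fun f => (memLp_weight_ft (hT f) M).toLp
      map_add' := fun f g => by
        rw [← MemLp.toLp_add]
        congr 1
        ext η
        simp only [Pi.add_apply]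
        rw [← mul_add, ← ft_add (hT f).integrable (hT g).integrable]
        rfl
      map_smul' := fun c f => by
        rw [RingHom.id_apply, ← MemLp.toLp_const_smul]
        congr 1
        ext η
        simp only [Pi.smul_apply, smul_eq_mul]
        rw [mul_left_comm, ← ft_const_mul c f η]
        rfl }
  -- On functions supported in `K`, continuity is a bound by finitely many derivatives, hence by a
  -- weighted `L²` norm of the transform.
  have hbound : ∀ f, ‖u' f‖ ≤ (C * ((2 * Real.pi) ^ N * (N + 1) * C₁)) * ‖J f‖ := by
    intro f
    have h1 : ‖u' f‖ ≤ C * (s.sup (ContDiffMapSupportedIn.seminorm ℂ E ℂ ⊤ K')) f := hC f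
    refine h1.trans ?_
    rw [mul_assoc]
    refine mul_le_mul_of_nonneg_left ?_ C.2
    refine Seminorm.finset_sup_apply_le (by positivity) fun i hi => ?_
    rw [ContDiffMapSupportedIn.seminorm_top_le_iff ℂ (by positivity)]
    intro x _
    refine ((hT f).norm_iteratedFDeriv_le (hN i hi) x).trans ?_
    have hπ : 1 ≤ 2 * Real.pi := by linarith [Real.pi_gt_three]
    have hi' : (i : ℝ) ≤ N := by exact_mod_cast hN i hi
    calc (2 * Real.pi) ^ i * (i + 1) * ∫ η, (1 + ‖η‖) ^ N * ‖ft f η‖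
        ≤ (2 * Real.pi) ^ N * (N + 1) * (C₁ * ‖J f‖) := by
          gcongr
          · exact hN i hi
          · exact hM f (hT f)
      _ = _ := by ring
  obtain ⟨m, hm⟩ := exists_inner_eq_of_le (u' : 𝓓_{K'}(E, ℂ) →ₗ[ℂ] ℂ) J hbound
  set m' : E → ℂ := (Lp.aestronglyMeasurable m).mk m
  have hm'm : Measurable m' := (Lp.aestronglyMeasurable m).stronglyMeasurable_mk.measurable
  have hae : m' =ᵐ[volume] m := (Lp.aestronglyMeasurable m).ae_eq_mk.symm
  have hm'2 : MemLp m' 2 := (memLp_congr_ae hae).2 (Lp.memLp m)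
  -- The conjugation comes from the antilinear slot of the inner product; the reflection makes the
  -- final formula a convolution.
  set ν : E → ℂ := fun η => (((1 + ‖η‖) ^ M : ℝ) : ℂ) * (starRingEnd ℂ) (m' (-η))
  have mν : Measurable ν := by
    have h1 : Continuous fun η : E => (((1 + ‖η‖) ^ M : ℝ) : ℂ) := by fun_prop
    exact h1.measurable.mul
      (Complex.continuous_conj.measurable.comp (hm'm.comp measurable_neg))
  refine ⟨ν, -M, mν, hasGrowth_of_integrable ?_, fun f hf => ?_⟩
  · have hi := ((memLp_two_iff_integrable_sq_norm hm'm.aestronglyMeasurable).1 hm'2).comp_neg.const_mul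
      (2 ^ M)
    refine hi.mono (Measurable.aestronglyMeasurable (by fun_prop)) (ae_of_all _ fun x => ?_)
    rw [Real.norm_of_nonneg (by positivity), Real.norm_of_nonneg (by positivity), norm_mul,
      Complex.norm_real, Real.norm_of_nonneg (by positivity), RCLike.norm_conj, mul_pow, ← mul_assoc,
      Real.rpow_neg (by positivity), Real.rpow_natCast]
    gcongr
    rw [inv_mul_le_iff₀ (by positivity), ← pow_mul, mul_comm M 2, pow_mul, ← mul_pow]
    gcongr
    nlinarith [sq_nonneg (‖x‖ - 1)]
  · let f' : 𝓓_{K'}(E, ℂ) := ⟨f, f.contDiff, fun x hx =>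
      image_eq_zero_of_notMem_tsupport fun h => hx (hf h)⟩
    have e : u f = u' f' := congrArg u (by ext; rfl)
    have h1 : u' f' = inner ℂ m (J f') := hm f'
    rw [e, h1, L2.inner_def]
    refine integral_congr_ae ?_
    filter_upwards [hae, (memLp_weight_ft (hT f') M).coeFn_toLp] with η h2 h3
    have h4 : (J f' : E → ℂ) η = (((1 + ‖η‖) ^ M : ℝ) : ℂ) * ft f η := h3
    rw [h4, ← h2, RCLike.inner_apply]
    simp only [ν, norm_neg, neg_neg]
    ring

end Representation

end KleinGordon

namespace KleinGordon

open scoped ENNReal NNReal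

/-! ### Localised solutions on the Fourier side -/

section LocalSolution

/-- The test function on `Ω` with the underlying function `χ`. -/
def IsTest.toTestFunction {Ω : Opens E8} {χ : E8 → ℂ} (h : IsTest χ) (hs : tsupport χ ⊆ Ω) : 𝓓(Ω, ℂ) :=
  ⟨χ, h.1, h.2, hs⟩

open Classical in
/-- The Fourier transform of `χ u`, as a function of `χ`. -/
def localFT {Ω : Opens E8} (u : 𝓓(Ω, ℂ) →L[ℂ] ℂ) (χ : E8 → ℂ) : E8 → ℂ :=
  if h : IsTest χ ∧ tsupport χ ⊆ Ω then fourierLoc u (h.1.toTestFunction h.2) else 0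

variable {Ω : Opens E8} {u : 𝓓(Ω, ℂ) →L[ℂ] ℂ}

theorem localFT_eq {χ : E8 → ℂ} (h : IsTest χ) (hs : tsupport χ ⊆ Ω) :
    localFT u χ = fourierLoc u (h.toTestFunction hs) := by
  unfold localFT
  rw [dif_pos ⟨h, hs⟩]

theorem ft_wave_mul (f : E8 → ℂ) (w η : E8) :
    ft (fun z => wave (-w) z * f z) η = ft f (w + η) := by
  simp only [ft, ← mul_assoc, ← wave_add]
  congr 1; ext z
  congr 2
  abel

/-- Modulating `χ` translates `ft χ`, so pairing with the modulations is convolution with one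
function `ν` for all `χ` supported in `K`. Measurability of `𝓕(χu)` and the product rule for
cut-offs follow from this. -/
theorem exists_conv_representation (u : 𝓓(Ω, ℂ) →L[ℂ] ℂ) {K : Set E8} (hK : IsCompact K)
    (hKΩ : K ⊆ Ω) :
    ∃ (ν : E8 → ℂ) (r : ℝ), Measurable ν ∧ HasGrowth r univ ν ∧ ∀ χ : 𝓓(Ω, ℂ), tsupport χ ⊆ K →
      ∀ w, fourierLoc u χ w = ((2 * Real.pi) ^ (-4 : ℤ) : ℝ) * conv (ft χ) ν w := by
  obtain ⟨ν, r, mν, gν, h⟩ := exists_ft_representation u hK hKΩ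
  refine ⟨ν, r, mν, gν, fun χ hχ w => ?_⟩
  rw [fourierLoc, h _ ((tsupport_mul_subset_right (f := planeWave (-w)) (g := χ)).trans hχ), conv,
    ← integral_neg_eq_self]
  congr 1
  refine integral_congr_ae (ae_of_all _ fun η => ?_)
  change ν (- -η) * ft (fun z => wave (-w) z * χ z) (-η) = _
  rw [ft_wave_mul, neg_neg, ← sub_eq_add_neg]
  exact mul_comm _ _

/-- The product rule is associativity of convolution in the representation above. The equation at
the frequency `w` is the weak equation tested with `e^{-i⟨·, w⟩} ψ`: its inner integral consists of
transforms of `a ψ`, `b ψ` and `ψ` at `w - ζ`. -/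
theorem isLocalSolution_localFT {s θ : ℝ} {n : ℕ} (hθ : 0 < θ) (hθ1 : θ ≤ 1)
    (hst : 2 < s + ((n + 1 : ℕ) + θ)) (hu : ∀ φ : 𝓓(Ω, ℂ), Integrable (sobolevDensity s u φ))
    {p : E8 → E8 → ℂ} {a : (Fin 4 ⊕ Fin 4) × (Fin 4 ⊕ Fin 4) → E8 → ℂ}
    {b : Fin 4 ⊕ Fin 4 → E8 → ℂ} {c₀ : ℂ}
    (hp : ∀ z ζ, p z ζ = ∑ i, a i z * ((ζ i.1 : ℂ) * (ζ i.2 : ℂ)) + ∑ μ, b μ z * (ζ μ : ℂ) + c₀)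
    (ha : ∀ i, LocHol θ (n + 1) Ω (a i)) (hb : ∀ μ, LocHol θ n Ω (b μ))
    (heq : ∀ φ χ : 𝓓(Ω, ℂ), (∀ᶠ z in 𝓝ˢ (tsupport φ), χ z = 1) →
      ((2 * Real.pi) ^ (-4 : ℤ) : ℝ) *
        (∫ ζ : E8, fourierLoc u χ ζ * ∫ z : E8, planeWave ζ z * p z ζ * φ z) = 0) :
    IsLocalSolution (Ω : Set E8) s a b c₀ (localFT u) := by
  have meas : ∀ χ, IsTest χ → tsupport χ ⊆ Ω → Measurable (localFT u χ) := fun χ hχ hs => by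
    obtain ⟨ν, r, mν, gν, h⟩ := exists_conv_representation u hχ.2 hs
    rw [localFT_eq hχ hs, funext (h (hχ.toTestFunction hs) le_rfl)]
    exact measurable_const.mul (measurable_conv hχ.continuous_ft mν)
  have growth : ∀ χ, IsTest χ → tsupport χ ⊆ Ω → HasGrowth s univ (localFT u χ) :=
    fun χ hχ hs => by
      rw [localFT_eq hχ hs]
      exact hasGrowth_of_integrable (hu _)
  refine ⟨meas, growth, fun ψ χ hψ hχ hs w => ?_, fun ψ χ hψ hχ hs h1 w => ?_⟩
  · have hψχ : IsTest fun z => ψ z * χ z := ⟨hψ.1.mul hχ.1, hχ.2.mul_left⟩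
    have hsub : tsupport (fun z => ψ z * χ z) ⊆ tsupport χ := tsupport_mul_subset_right
    obtain ⟨ν, r, mν, gν, h⟩ := exists_conv_representation u hχ.2 hs
    rw [localFT_eq hχ hs, localFT_eq hψχ (hsub.trans hs), h _ hsub, funext (h _ le_rfl),
      conv_const_mul_right, mul_left_comm]
    congr 1
    change conv (ft fun z => ψ z * χ z) ν w = invConst E8 * conv (ft ψ) (conv (ft χ) ν) w
    rw [conv_assoc hψ.continuous_ft.measurable hχ.continuous_ft.measurable mν
      (hψ.hasGrowth_ft (1 - r)) gν (by linarith) hχ.integrable_weight,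
      funext fun w => hχ.ft_mul hψ.integrable w]
    simp only [conv, mul_assoc]
    rw [integral_const_mul]
  · set U := localFT u χ with hUdef
    have mU := meas χ hχ hs
    have gU := growth χ hχ hs
    obtain ⟨t', ht', ht''⟩ := exists_between (show 2 - s < (n + 1 : ℕ) + θ by linarith)
    -- Since `χ = 1` on the support of `ψ`, that support lies in the one of `χ`.
    have hψΩ : tsupport ψ ⊆ Ω := fun z hz => by
      by_contra hn
      have h0 : χ z = 0 := image_eq_zero_of_notMem_tsupport fun h => hn (hs h)
      have := (Filter.eventually_iff.1 h1 |> fun h => subset_of_mem_nhdsSet h) hz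
      rw [mem_ofPred_eq, h0] at this
      exact zero_ne_one this
    have haψ : ∀ i, LocHol θ (n + 1) univ fun z => a i z * ψ z := fun i =>
      (ha i).test_mul hθ hθ1 Ω.isOpen hψ hψΩ
    have hbψ : ∀ μ, LocHol θ n univ fun z => b μ z * ψ z := fun μ =>
      (hb μ).test_mul hθ hθ1 Ω.isOpen hψ hψΩ
    have int_of : ∀ {k : ℕ} {f : E8 → ℂ}, LocHol θ k univ (fun z => f z * ψ z) →
        Integrable fun z => f z * ψ z := fun {k f} h => by
      have hcont : Continuous fun z => f z * ψ z :=
        continuous_iff_continuousAt.2 fun x => h.continuousAt hθ (mem_univ x)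
      exact hcont.integrable_of_hasCompactSupport (hψ.hasCompactSupport_mul _)
    have ia : ∀ i : (Fin 4 ⊕ Fin 4) × (Fin 4 ⊕ Fin 4), Integrable fun ζ : E8 =>
        ft (fun z => a i z * ψ z) (w - ζ) * ((ζ i.1 : ℂ) * (ζ i.2 : ℂ) * U ζ) := fun i =>
      integrable_conv_of_growth (continuous_ft (int_of (haψ i))).measurable
        (((measurable_coord i.1).mul (measurable_coord i.2)).mul mU)
        (hasGrowth_ft hθ hθ1 (hψ.hasCompactSupport_mul _) (haψ i) ht'')
        (gU.weight MeasurableSet.univ zero_le_one fun z => norm_coord_mul_le z i.1 i.2)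
        (by linarith) w
    have ib : ∀ μ, Integrable fun ζ : E8 =>
        ft (fun z => b μ z * ψ z) (w - ζ) * ((ζ μ : ℂ) * U ζ) := fun μ =>
      integrable_conv_of_growth (continuous_ft (int_of (hbψ μ))).measurable
        ((measurable_coord μ).mul mU)
        -- First order coefficients are one order rougher, which is balanced by having only one
        -- factor of `ζ`.
        (hasGrowth_ft (t := t' - 1) hθ hθ1 (hψ.hasCompactSupport_mul _) (hbψ μ)
          (by push_cast at ht''; linarith))
        (gU.weight MeasurableSet.univ zero_le_one fun z => norm_coord_le z μ)
        (by linarith) w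
    have ic := hψ.integrable_conv mU gU w
    set φ : 𝓓(Ω, ℂ) := smulTest (planeWave (-w)) (contDiff_planeWave (-w)) (hψ.toTestFunction hψΩ)
    have hφs : tsupport φ ⊆ tsupport ψ :=
      tsupport_mul_subset_right (f := planeWave (-w)) (g := ψ)
    have key := heq φ (hχ.toTestFunction hs) (h1.filter_mono (nhdsSet_mono hφs))
    rw [mul_eq_zero, or_iff_right (Complex.ofReal_ne_zero.2 (by positivity))] at key
    rw [← key, ← localFT_eq hχ hs, ← hUdef]
    simp only [conv]
    have sa := integrable_finsetSum Finset.univ fun i _ => ia i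
    have sb := integrable_finsetSum Finset.univ fun μ _ => ib μ
    have sab : Integrable fun ζ : E8 =>
        (∑ i : (Fin 4 ⊕ Fin 4) × (Fin 4 ⊕ Fin 4),
          ft (fun z => a i z * ψ z) (w - ζ) * ((ζ i.1 : ℂ) * (ζ i.2 : ℂ) * U ζ)) +
        ∑ μ, ft (fun z => b μ z * ψ z) (w - ζ) * ((ζ μ : ℂ) * U ζ) := sa.add sb
    rw [← integral_const_mul, ← integral_finsetSum _ fun i _ => ia i,
      ← integral_finsetSum _ fun μ _ => ib μ, ← integral_add sa sb,
      ← integral_add sab (ic.const_mul c₀)]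
    refine integral_congr_ae (ae_of_all _ fun ζ => ?_)
    have inner_eq : ∫ z : E8, planeWave ζ z * p z ζ * φ z =
        ∑ i : (Fin 4 ⊕ Fin 4) × (Fin 4 ⊕ Fin 4),
          ((ζ i.1 : ℂ) * (ζ i.2 : ℂ)) * ft (fun z => a i z * ψ z) (w - ζ) +
        ∑ μ, (ζ μ : ℂ) * ft (fun z => b μ z * ψ z) (w - ζ) + c₀ * ft ψ (w - ζ) := by
      have ja : ∀ i, Integrable fun z : E8 => ((ζ i.1 : ℂ) * (ζ i.2 : ℂ)) *
          (wave (-(w - ζ)) z * (a i z * ψ z)) := fun i : (Fin 4 ⊕ Fin 4) × (Fin 4 ⊕ Fin 4) =>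
        (integrable_wave_mul (int_of (haψ i)) _).const_mul _
      have jb : ∀ μ, Integrable fun z : E8 => (ζ μ : ℂ) *
          (wave (-(w - ζ)) z * (b μ z * ψ z)) := fun μ =>
        (integrable_wave_mul (int_of (hbψ μ)) _).const_mul _
      have jc : Integrable fun z : E8 => c₀ * (wave (-(w - ζ)) z * ψ z) :=
        (integrable_wave_mul hψ.integrable _).const_mul _
      simp only [ft]
      simp only [← integral_const_mul]
      have ta := integrable_finsetSum Finset.univ fun i _ => ja i
      have tb := integrable_finsetSum Finset.univ fun μ _ => jb μ
      have tab : Integrable fun z : E8 =>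
          (∑ i : (Fin 4 ⊕ Fin 4) × (Fin 4 ⊕ Fin 4),
            (ζ i.1 : ℂ) * (ζ i.2 : ℂ) * (wave (-(w - ζ)) z * (a i z * ψ z))) +
          ∑ μ, (ζ μ : ℂ) * (wave (-(w - ζ)) z * (b μ z * ψ z)) := ta.add tb
      rw [← integral_finsetSum _ fun i _ => ja i, ← integral_finsetSum _ fun μ _ => jb μ,
        ← integral_add ta tb, ← integral_add tab jc]
      refine integral_congr_ae (ae_of_all _ fun z => ?_)
      change wave ζ z * p z ζ * (wave (-w) z * ψ z) = _
      have hw : wave (-(w - ζ)) z = wave ζ z * wave (-w) z := by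
        rw [← wave_add]; congr 1; abel
      simp only [hp, hw, add_mul, mul_add, Finset.sum_mul,
        Finset.mul_sum]
      congr 1
      · congr 1
        · exact Finset.sum_congr rfl fun i _ => by ring
        · exact Finset.sum_congr rfl fun i _ => by ring
      · ring
    change _ = U ζ * ∫ z : E8, planeWave ζ z * p z ζ * φ z
    rw [inner_eq]
    simp only [mul_add, Finset.mul_sum]
    congr 1
    · congr 1
      · exact Finset.sum_congr rfl fun i _ => by ring
      · exact Finset.sum_congr rfl fun i _ => by ring
    · ring

end LocalSolution

end KleinGordon

namespace KleinGordon

/-! ### The metric in coordinates -/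

section MetricMatrix

variable {S : Type*} [TopologicalSpace S] [ChartedSpace E3 S] [IsManifold 𝓘(ℝ, E3) ∞ S]

theorem Chart.mdifferentiableAt_symm (e : Chart S) {u : E3} (hu : u ∈ e.1.target) :
    MDifferentiableAt 𝓘(ℝ, E3) 𝓘(ℝ, E3) e.1.symm u :=
  (((contMDiffOn_symm_of_mem_maximalAtlas e.2).contMDiffAt
    (e.1.open_target.mem_nhds hu)).mdifferentiableAt (by simp))

theorem Chart.mdifferentiableAt (e : Chart S) {x : S} (hx : x ∈ e.1.source) :
    MDifferentiableAt 𝓘(ℝ, E3) 𝓘(ℝ, E3) e.1 x :=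
  ((contMDiffOn_of_mem_maximalAtlas e.2).contMDiffAt
    (e.1.open_source.mem_nhds hx)).mdifferentiableAt (by simp)

theorem Chart.mfderiv_comp_mfderiv_symm (e : Chart S) {u : E3} (hu : u ∈ e.1.target) (v : E3) :
    mfderiv 𝓘(ℝ, E3) 𝓘(ℝ, E3) e.1 (e.1.symm u)
      (mfderiv 𝓘(ℝ, E3) 𝓘(ℝ, E3) e.1.symm u v) = v := by
  have h1 := mfderiv_comp u (e.mdifferentiableAt (e.1.map_target hu)) (e.mdifferentiableAt_symm hu)
  have h2 : (e.1 ∘ e.1.symm) =ᶠ[𝓝 u] id := by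
    filter_upwards [e.1.open_target.mem_nhds hu] with y hy using e.1.right_inv hy
  rw [h2.mfderiv_eq, mfderiv_id] at h1
  exact (DFunLike.congr_fun h1 v).symm

theorem sum_smul_coordVector (e : Chart S) (u : E3) (c : Fin 3 → ℝ) :
    ∑ i, c i • coordVector e u i =
      mfderiv 𝓘(ℝ, E3) 𝓘(ℝ, E3) e.1.symm u (WithLp.toLp 2 c : E3) := by
  have : (WithLp.toLp 2 c : E3) = ∑ i, c i • EuclideanSpace.single i (1 : ℝ) := by
    ext j
    simp [Finset.sum_apply, Pi.single_apply]
  simp only [coordVector]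
  rw [this]
  erw [map_sum]
  exact Finset.sum_congr rfl fun i _ => (ContinuousLinearMap.map_smul _ _ _).symm

/-- The differential of the inverse chart is injective, having the differential of the chart as a
left inverse, so a nonzero coefficient vector gives a nonzero tangent vector. -/
theorem posDef_metricMatrix (h : Metric S) (e : Chart S) {u : E3} (hu : u ∈ e.1.target) :
    (metricMatrix h e u).PosDef := by
  refine Matrix.PosDef.of_dotProduct_mulVec_pos ?_ fun c hc => ?_
  · ext i j
    simp [metricMatrix, h.symm _ (coordVector e u j)]
  · have key : star c ⬝ᵥ (metricMatrix h e u).mulVec c =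
        h.inner (e.1.symm u) (∑ i, c i • coordVector e u i) (∑ i, c i • coordVector e u i) := by
      simp only [map_sum, sum_apply, map_smul, smul_apply,
        dotProduct, Matrix.mulVec, metricMatrix, Matrix.of_apply, Finset.mul_sum, smul_eq_mul,
        star_trivial]
      rw [Finset.sum_comm]
      refine Finset.sum_congr rfl fun i _ => Finset.sum_congr rfl fun j _ => ?_
      ring
    rw [key]
    refine h.pos _ _ fun h0 => hc ?_
    rw [sum_smul_coordVector] at h0
    have h1 := e.mfderiv_comp_mfderiv_symm hu (WithLp.toLp 2 c : E3)
    rw [h0, map_zero] at h1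
    ext i
    exact (congrArg (fun w : E3 => w i) h1).symm

/-- Littlewood–Paley bounds see a function only up to null sets. Continuity is therefore taken from
the metric, before the Zygmund condition is turned into pointwise regularity. -/
theorem continuousOn_metricMatrix (h : Metric S) (e : Chart S) (i j : Fin 3) :
    ContinuousOn (fun u => metricMatrix h e u i j) e.1.target := by
  have hc : ∀ i, ContinuousOn (fun u : E3 => (⟨e.1.symm u, coordVector e u i⟩ :
      TangentBundle 𝓘(ℝ, E3) S)) e.1.target := fun i => by
    have h1 := (contMDiffOn_symm_of_mem_maximalAtlas e.2).continuousOn_tangentMapWithin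
      (by simp) e.1.open_target.uniqueMDiffOn
    have h2 : Continuous fun u : E3 => (⟨u, EuclideanSpace.single i (1 : ℝ)⟩ :
        TangentBundle 𝓘(ℝ, E3) E3) := by
      have := (tangentBundleModelSpaceHomeomorph 𝓘(ℝ, E3)).symm.continuous.comp
        (by fun_prop : Continuous fun u : E3 => (u, (EuclideanSpace.single i (1 : ℝ) : E3)))
      exact this
    refine (h1.comp h2.continuousOn fun u hu => hu).congr fun u hu => ?_
    simp only [Function.comp_apply, tangentMapWithin, coordVector]
    rw [mfderivWithin_of_isOpen e.1.open_target hu]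
  have hg : ContinuousOn (fun u : E3 => Bundle.TotalSpace.mk' (E3 →L[ℝ] E3 →L[ℝ] ℝ)
      (E := fun x : S => TangentSpace 𝓘(ℝ, E3) x →L[ℝ] TangentSpace 𝓘(ℝ, E3) x →L[ℝ] ℝ)
      (e.1.symm u) (h.inner (e.1.symm u))) e.1.target :=
    h.continuous.comp_continuousOn e.1.continuousOn_symm
  have := ContinuousOn.clm_bundle_apply₂ (E₃ := fun _ : S => ℝ) (F₃ := ℝ) hg (hc i) (hc j)
  exact (continuous_snd.comp (Bundle.Trivial.homeomorphProd S ℝ).continuous).comp_continuousOn this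

end MetricMatrix

end KleinGordon

namespace KleinGordon

open scoped SchwartzMap FourierTransform

/-! ### Bernstein's inequality and sums of smooth pieces -/

section Bernstein

variable {E : Type} [NormedAddCommGroup E] [InnerProductSpace ℝ E] [FiniteDimensional ℝ E]
  [MeasurableSpace E] [BorelSpace E]

/-- Mean value inequality together with the rapid decay of the derivative, which gives an integrable
majorant. -/
theorem exists_integral_translate_sub_le (k : 𝓢(E, ℂ)) :
    ∃ L : ℝ, 0 ≤ L ∧ ∀ h : E, ‖h‖ ≤ 1 → ∫ y, |(k (y + h)).re - (k y).re| ≤ L * ‖h‖ := by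
  set d := Module.finrank ℝ E + 1
  have hk := SchwartzMap.one_add_le_sup_seminorm_apply (𝕜 := ℝ) (m := (d, 1)) le_rfl le_rfl k
  set A := 2 ^ (d, 1).1 * ((Finset.Iic (d, 1)).sup fun m => SchwartzMap.seminorm ℝ m.1 m.2) k
  have hA : 0 ≤ A := (by positivity : (0 : ℝ) ≤ _).trans (hk 0)
  have hi : Integrable fun x : E => (1 + ‖x‖) ^ (-(d : ℝ)) :=
    integrable_one_add_norm (by simp [d])
  refine ⟨2 ^ d * A * ∫ x : E, (1 + ‖x‖) ^ (-(d : ℝ)), mul_nonneg (by positivity)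
    (integral_nonneg fun x => by positivity), fun h hh => ?_⟩
  have key : ∀ y, |(k (y + h)).re - (k y).re| ≤ 2 ^ d * A * ‖h‖ * (1 + ‖y‖) ^ (-(d : ℝ)) := by
    intro y
    rw [← Complex.sub_re]
    refine (Complex.abs_re_le_norm _).trans ?_
    have hd : ∀ w ∈ Metric.closedBall y 1, ‖fderiv ℝ k w‖ ≤ 2 ^ d * A * (1 + ‖y‖) ^ (-(d : ℝ)) := by
      intro w hw
      rw [Metric.mem_closedBall, dist_eq_norm] at hw
      have h1 := hk w
      rw [← norm_iteratedFDeriv_fderiv, norm_iteratedFDeriv_zero] at h1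
      have h2 : 1 + ‖y‖ ≤ 2 * (1 + ‖w‖) := by
        have := norm_sub_norm_le y w
        rw [norm_sub_rev] at this
        linarith [norm_nonneg w]
      rw [Real.rpow_neg (by positivity), Real.rpow_natCast, ← div_eq_mul_inv, le_div_iff₀ (by positivity)]
      calc ‖fderiv ℝ k w‖ * (1 + ‖y‖) ^ d ≤ ‖fderiv ℝ k w‖ * (2 * (1 + ‖w‖)) ^ d := by gcongr
        _ = 2 ^ d * ((1 + ‖w‖) ^ d * ‖fderiv ℝ k w‖) := by rw [mul_pow]; ring
        _ ≤ 2 ^ d * A := by gcongr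
    have := (convex_closedBall y 1).norm_image_sub_le_of_norm_fderiv_le
      (fun w _ => k.differentiableAt) hd (Metric.mem_closedBall_self zero_le_one)
      (show y + h ∈ _ by simpa [Metric.mem_closedBall] using hh)
    refine this.trans (le_of_eq ?_)
    rw [add_sub_cancel_left]; ring
  calc ∫ y, |(k (y + h)).re - (k y).re| ≤ ∫ y, 2 ^ d * A * ‖h‖ * (1 + ‖y‖) ^ (-(d : ℝ)) := by
        refine integral_mono_of_nonneg (ae_of_all _ fun y => abs_nonneg _) (hi.const_mul _)
          (ae_of_all _ key)
    _ = _ := by rw [integral_const_mul]; ring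

variable {V : Type} [NormedAddCommGroup V] [NormedSpace ℝ V] [CompleteSpace V]
  {K : E → ℝ} {L R : ℝ}

omit [CompleteSpace V] in
-- After a change of variables a translation of `Q` falls on the kernel, whose `L¹` modulus of
-- continuity gives a Lipschitz bound for `Q`.
theorem norm_fderiv_le_of_reproduced (hK : Continuous K) (hi : Integrable K) (hL : 0 ≤ L)
    (hKL : ∀ h : E, ‖h‖ ≤ 1 → ∫ y, |K (y + h) - K y| ≤ L * ‖h‖) (hR : 0 < R)
    {Q : E → V} (hQ : Continuous Q) {M : ℝ} (hM : ∀ x, ‖Q x‖ ≤ M)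
    (hrep : ∀ x, Q x = ∫ y, K y • Q (x - R⁻¹ • y)) (x : E) : ‖fderiv ℝ Q x‖ ≤ R * L * M := by
  have hM0 : 0 ≤ M := (norm_nonneg _).trans (hM 0)
  refine norm_fderiv_le_of_lip' ℝ (by positivity) ?_
  have hev : ∀ᶠ y in 𝓝 x, ‖R • (y - x)‖ ≤ 1 := by
    have : Tendsto (fun y => ‖R • (y - x)‖) (𝓝 x) (𝓝 0) := by
      have h : Continuous fun y => ‖R • (y - x)‖ := by fun_prop
      simpa using h.tendsto x
    exact this.eventually_le_const one_pos
  filter_upwards [hev] with z hz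
  have hint : ∀ h : E, Integrable fun y => K (y + h) • Q (x - R⁻¹ • y) := fun h => by
    refine ((hi.comp_add_right h).norm.mul_const M).mono' ?_ (ae_of_all _ fun y => ?_)
    · exact ((hK.comp (by fun_prop)).smul (hQ.comp (by fun_prop))).aestronglyMeasurable
    · rw [norm_smul]; gcongr; exact hM _
  have h1 : Q z = ∫ y, K (y + R • (z - x)) • Q (x - R⁻¹ • y) := by
    rw [hrep z, ← integral_add_right_eq_self _ (R • (z - x))]
    congr 1; ext y
    rw [smul_add, smul_smul, inv_mul_cancel₀ hR.ne', one_smul]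
    congr 2
    abel
  have h2 : Q x = ∫ y, K (y + 0) • Q (x - R⁻¹ • y) := by simpa using hrep x
  rw [h1, h2, ← integral_sub (hint _) (hint _)]
  calc ‖∫ y, K (y + R • (z - x)) • Q (x - R⁻¹ • y) - K (y + 0) • Q (x - R⁻¹ • y)‖
      ≤ ∫ y, |K (y + R • (z - x)) - K y| * M := by
        refine norm_integral_le_of_norm_le
          (((hi.comp_add_right (R • (z - x))).sub hi).abs.mul_const M) (ae_of_all _ fun y => ?_)
        rw [add_zero, ← sub_smul, norm_smul, Real.norm_eq_abs]
        exact mul_le_mul_of_nonneg_left (hM _) (abs_nonneg _)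
    _ ≤ L * ‖R • (z - x)‖ * M := by
        rw [integral_mul_const]; gcongr; exact hKL _ hz
    _ = R * L * M * ‖z - x‖ := by
        rw [norm_smul, Real.norm_of_nonneg hR.le]; ring

/-- Bernstein's inequality for functions that are reproduced by a kernel of scale `1 / R`. -/
theorem norm_iteratedFDeriv_le_of_reproduced (hK : Continuous K) (hi : Integrable K) (hL : 0 ≤ L)
    (hKL : ∀ h : E, ‖h‖ ≤ 1 → ∫ y, |K (y + h) - K y| ≤ L * ‖h‖) (hR : 0 < R)
    {Q : E → V} (hQ : ContDiff ℝ ∞ Q) {M : ℝ} (hM : ∀ x, ‖Q x‖ ≤ M)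
    (hrep : ∀ x, Q x = ∫ y, K y • Q (x - R⁻¹ • y)) (k : ℕ) (x : E) :
    ‖iteratedFDeriv ℝ k Q x‖ ≤ (R * L) ^ k * M := by
  induction k generalizing V M with
  | zero => simpa using hM x
  | succ k ih =>
    have hb := norm_fderiv_le_of_reproduced hK hi hL hKL hR hQ.continuous hM hrep
    have hQ' : ContDiff ℝ ∞ (fderiv ℝ Q) := hQ.fderiv_right (by simp)
    rw [← norm_iteratedFDeriv_fderiv, pow_succ, mul_assoc]
    -- The derivative is reproduced by the same kernel, so the estimate iterates.
    refine ih hQ' hb fun x => ?_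
    have hd : HasFDerivAt (fun x => ∫ y, K y • Q (x - R⁻¹ • y))
        (∫ y, K y • fderiv ℝ Q (x - R⁻¹ • y)) x := by
      refine hasFDerivAt_integral_of_dominated_of_fderiv_le (F' := fun x y => K y • fderiv ℝ Q (x - R⁻¹ • y))
        (bound := fun y => ‖K y‖ * (R * L * M)) univ_mem (Eventually.of_forall fun x => ?_) ?_ ?_
        (ae_of_all _ fun y x _ => ?_) (hi.norm.mul_const _) (ae_of_all _ fun y x _ => ?_)
      · exact (hK.smul (hQ.continuous.comp (by fun_prop))).aestronglyMeasurable
      · refine (hi.norm.mul_const M).mono' ?_ (ae_of_all _ fun y => ?_)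
        · exact (hK.smul (hQ.continuous.comp (by fun_prop))).aestronglyMeasurable
        · rw [norm_smul]; gcongr; exact hM _
      · exact (hK.smul (hQ'.continuous.comp (by fun_prop))).aestronglyMeasurable
      · rw [norm_smul]; gcongr; exact hb _
      · have h1 := (hQ.differentiable (by simp) (x - R⁻¹ • y)).hasFDerivAt
        have h2 : HasFDerivAt (fun x : E => x - R⁻¹ • y) (ContinuousLinearMap.id ℝ E) x :=
          (hasFDerivAt_id x).sub_const _
        have h3 := (h1.comp x h2).const_smul (K y)
        rw [ContinuousLinearMap.comp_id] at h3
        exact h3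
    rw [← hd.fderiv, ← funext hrep]

/-- The increment of the `n`-th derivative of `P j` is at most a multiple of both `2 ^ (-j)` and `‖x
- y‖`. Their geometric mean with exponents `1 - θ` and `θ` is summable in `j` because `θ < 1`. -/
theorem locHol_tsum {θ : ℝ} (hθ : 0 < θ) (hθ1 : θ < 1) {n : ℕ} {P : ℕ → E → V}
    (hP : ∀ j, ContDiff ℝ ∞ (P j)) {C : ℝ}
    (hb : ∀ k ≤ n, ∀ j x, ‖iteratedFDeriv ℝ k (P j) x‖ ≤ C * (1 / 2) ^ j)
    (hb' : ∀ j x, ‖iteratedFDeriv ℝ (n + 1) (P j) x‖ ≤ C) :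
    LocHol θ n univ fun x => ∑' j, P j x := by
  have hC : 0 ≤ C := (norm_nonneg _).trans (hb' 0 0)
  have hs : Summable fun j : ℕ => C * (1 / 2 : ℝ) ^ j :=
    (summable_geometric_of_lt_one (by norm_num) (by norm_num)).mul_left C
  have hPn : ∀ j, ContDiff ℝ ((n : ℕ∞) : WithTop ℕ∞) (P j) := fun j =>
    (hP j).of_le (by exact_mod_cast le_top)
  have hcd : ContDiff ℝ ((n : ℕ∞) : WithTop ℕ∞) fun x => ∑' j, P j x :=
    contDiff_tsum (v := fun _ j => C * (1 / 2 : ℝ) ^ j) hPn (fun _ _ => hs)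
      fun k j x hk => hb k (by exact_mod_cast hk) j x
  set q : ℝ := (1 / 2 : ℝ) ^ (1 - θ)
  have hq0 : 0 ≤ q := by positivity
  have hq1 : q < 1 := Real.rpow_lt_one (by norm_num) (by norm_num) (by linarith)
  have hsq : Summable fun j : ℕ => q ^ j := summable_geometric_of_lt_one hq0 hq1
  refine locHol_of_iteratedFDeriv (C := 2 * C * ∑' j, q ^ j) (by exact_mod_cast hcd) fun x y => ?_
  have hit : ∀ z, iteratedFDeriv ℝ n (fun x => ∑' j, P j x) z = ∑' j, iteratedFDeriv ℝ n (P j) z :=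
    iteratedFDeriv_tsum_apply (v := fun _ j => C * (1 / 2 : ℝ) ^ j) hPn (fun _ _ => hs)
      (fun k j x hk => hb k (by exact_mod_cast hk) j x) le_rfl
  have hsum : ∀ z, Summable fun j => iteratedFDeriv ℝ n (P j) z := fun z =>
    Summable.of_norm_bounded hs fun j => hb n le_rfl j z
  rw [hit, hit, ← (hsum x).tsum_sub (hsum y)]
  have hterm : ∀ j, ‖iteratedFDeriv ℝ n (P j) x - iteratedFDeriv ℝ n (P j) y‖
      ≤ 2 * C * ‖x - y‖ ^ θ * q ^ j := by
    intro j
    set D := ‖iteratedFDeriv ℝ n (P j) x - iteratedFDeriv ℝ n (P j) y‖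
    have h1 : D ≤ 2 * C * (1 / 2) ^ j := by
      refine (norm_sub_le _ _).trans ?_
      linarith [hb n le_rfl j x, hb n le_rfl j y]
    have h2 : D ≤ 2 * C * ‖x - y‖ := by
      have : D ≤ C * ‖x - y‖ := convex_univ.norm_image_sub_le_of_norm_fderiv_le (𝕜 := ℝ)
        (fun w _ => ((hP j).differentiable_iteratedFDeriv (m := n)
          (by exact_mod_cast WithTop.coe_lt_top n)).differentiableAt)
        (fun w _ => by rw [norm_fderiv_iteratedFDeriv]; exact hb' j w) (mem_univ y) (mem_univ x)
      have : 0 ≤ C * ‖x - y‖ := by positivity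
      linarith
    have hD : 0 ≤ D := norm_nonneg _
    calc D = D ^ (1 - θ) * D ^ θ := by
          rw [← Real.rpow_add_of_nonneg hD (by linarith) hθ.le, sub_add_cancel, Real.rpow_one]
      _ ≤ (2 * C * (1 / 2) ^ j) ^ (1 - θ) * (2 * C * ‖x - y‖) ^ θ := by
          gcongr
      _ = ((2 * C) ^ (1 - θ) * (2 * C) ^ θ) * ‖x - y‖ ^ θ * q ^ j := by
          have hq : ((1 / 2 : ℝ) ^ j) ^ (1 - θ) = q ^ j := by
            rw [← Real.rpow_natCast, ← Real.rpow_natCast, ← Real.rpow_mul (by norm_num),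
              ← Real.rpow_mul (by norm_num), mul_comm]
          rw [Real.mul_rpow (x := 2 * C) (y := (1 / 2) ^ j) (by positivity) (by positivity),
            Real.mul_rpow (x := 2 * C) (by positivity) (norm_nonneg _), hq]
          ring
      _ = _ := by
          rw [← Real.rpow_add_of_nonneg (by positivity) (by linarith) hθ.le, sub_add_cancel,
            Real.rpow_one]
  refine (tsum_of_norm_bounded ((hsq.hasSum).mul_left (2 * C * ‖x - y‖ ^ θ)) hterm).trans
    (le_of_eq (by ring))

end Bernstein

end KleinGordon

namespace KleinGordon

open scoped SchwartzMap FourierTransform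

/-! ### Band-limited functions and dilated multipliers -/

section BandLimited

variable {E : Type} [NormedAddCommGroup E] [InnerProductSpace ℝ E] [FiniteDimensional ℝ E]
  [MeasurableSpace E] [BorelSpace E]

theorem contDiff_ft {g : E → ℂ} (hg : Continuous g) (hs : HasCompactSupport g) :
    ContDiff ℝ ∞ (ft g) := by
  have h1 : ContDiff ℝ ((⊤ : ℕ∞) : WithTop ℕ∞) (𝓕 g) := Real.contDiff_fourier fun n _ =>
    ((continuous_norm.pow n).mul hg.norm).integrable_of_hasCompactSupport hs.norm.mul_left
  rw [show ft g = fun η => 𝓕 g ((2 * Real.pi)⁻¹ • η) from funext (ft_eq_fourier g)]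
  exact h1.comp (contDiff_const_smul _)

/-- Multiplying `g` by a function that is `1` on its support changes nothing; after Fubini this is
convolution with the rescaled kernel. -/
theorem ft_reproduced {K : E → ℝ} (hi : Integrable K) {R : ℝ} {g : E → ℂ} (hg : Integrable g)
    (h : ∀ ξ, g ξ ≠ 0 → ft (fun y => (K y : ℂ)) (R⁻¹ • ξ) = 1) (x : E) :
    ft g (-x) = ∫ y, K y • ft g (-(x - R⁻¹ • y)) := by
  have hp : Integrable (fun p : E × E => wave (x - R⁻¹ • p.1) p.2 * ((K p.1 : ℂ) * g p.2))
      (volume.prod volume) := by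
    refine (hi.ofReal.mul_prod hg).bdd_mul (c := 1) ?_ (ae_of_all _ fun p => (norm_wave _ _).le)
    exact (continuous_wave.comp
      (by fun_prop : Continuous fun p : E × E => (x - R⁻¹ • p.1, p.2))).aestronglyMeasurable
  calc ft g (-x) = ∫ ξ, wave x ξ * g ξ * ft (fun y => (K y : ℂ)) (R⁻¹ • ξ) := by
        rw [ft, neg_neg]
        refine integral_congr_ae (ae_of_all _ fun ξ => ?_)
        by_cases h0 : g ξ = 0
        · simp [h0]
        · simp only [h ξ h0, mul_one]
    _ = ∫ ξ, ∫ y, wave (x - R⁻¹ • y) ξ * ((K y : ℂ) * g ξ) := by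
        refine integral_congr_ae (ae_of_all _ fun ξ => ?_)
        simp only [ft]
        rw [← integral_const_mul]
        congr 1; ext y
        have hw : wave (x - R⁻¹ • y) ξ = wave x ξ * wave (-(R⁻¹ • ξ)) y := by
          rw [sub_eq_add_neg, wave_add]
          congr 1
          simp only [wave, inner_neg_right, inner_smul_right, real_inner_comm y ξ]
        rw [hw]; ring
    _ = ∫ y, ∫ ξ, wave (x - R⁻¹ • y) ξ * ((K y : ℂ) * g ξ) :=
        (integral_integral_swap hp).symm
    _ = _ := by
        simp only [ft, neg_neg, ← integral_smul]
        congr 1; ext y; congr 1; ext ξ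
        rw [Complex.real_smul]; ring

theorem exists_bernstein (E : Type) [NormedAddCommGroup E] [InnerProductSpace ℝ E]
    [FiniteDimensional ℝ E] [MeasurableSpace E] [BorelSpace E] :
    ∃ L : ℝ, 0 ≤ L ∧ ∀ (R : ℝ) (g : E → ℂ) (M : ℝ), 0 < R → Continuous g →
      (∀ ξ, 2 * R ≤ ‖ξ‖ → g ξ = 0) → (∀ x, ‖ft g (-x)‖ ≤ M) → ∀ k x,
        ‖iteratedFDeriv ℝ k (fun x => ft g (-x)) x‖ ≤ (R * L) ^ k * M := by
  have hp := Real.pi_pos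
  -- The inner radius `π⁻¹` covers exactly `‖ξ‖ ≤ 2 R` after the scaling by `(2π)⁻¹ R⁻¹`.
  let m : ContDiffBump (0 : E) := ⟨Real.pi⁻¹, 2 * Real.pi⁻¹, by positivity, by
    linarith [inv_pos.2 hp]⟩
  obtain ⟨k, hk⟩ := exists_schwartz_ft_eq m
  obtain ⟨L, hL, hkL⟩ := exists_integral_translate_sub_le k
  refine ⟨L, hL, fun R g M hR hg hs hM j x => ?_⟩
  have hcs : HasCompactSupport g := HasCompactSupport.intro (isCompact_closedBall 0 (2 * R))
    fun ξ hξ => hs ξ (by simpa using (not_le.1 fun h => hξ (by simpa using h)).le)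
  refine norm_iteratedFDeriv_le_of_reproduced (K := fun y => (k y).re)
    (Complex.continuous_re.comp k.continuous) k.integrable.re hL hkL hR
    ((contDiff_ft hg hcs).comp contDiff_neg) hM (fun x => ?_) j x
  refine ft_reproduced (K := fun y => (k y).re) k.integrable.re (hg.integrable_of_hasCompactSupport hcs) (fun ξ hξ => ?_) x
  rw [hk, m.one_of_mem_closedBall, Complex.ofReal_one]
  have : ‖ξ‖ < 2 * R := not_le.1 fun h => hξ (hs ξ h)
  rw [mem_closedBall_zero_iff, norm_smul, norm_smul, Real.norm_of_nonneg (by positivity),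
    Real.norm_of_nonneg (by positivity)]
  show _ ≤ Real.pi⁻¹
  calc (2 * Real.pi)⁻¹ * (R⁻¹ * ‖ξ‖) ≤ (2 * Real.pi)⁻¹ * (R⁻¹ * (2 * R)) := by gcongr
    _ = Real.pi⁻¹ := by field_simp

theorem IsTest.integral_dilate {ψ f : E → ℂ} (hψ : IsTest ψ) (hf : Integrable f) {R : ℝ}
    (hR : 0 < R) (x : E) :
    ∫ ξ, wave ξ x * ψ (R⁻¹ • ξ) * ft f ξ = ∫ y, ft ψ (-y) * f (x - R⁻¹ • y) := by
  set g : E → ℂ := fun ξ => ψ (R⁻¹ • -ξ) with hg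
  have hgi : Integrable g := by
    have := ((integrable_comp_smul_iff volume ψ (inv_ne_zero hR.ne')).2 hψ.integrable).comp_neg
    exact this
  have h1 := conv_ft hgi hf x
  have h2 : ∫ ξ, wave ξ x * ψ (R⁻¹ • ξ) * ft f ξ = ft (fun z => g z * ft f (-z)) x := by
    rw [← integral_neg_eq_self, ft]
    congr 1; ext z
    have hw : wave (-z) x = wave (-x) z := by simp only [wave, inner_neg_right, real_inner_comm]
    rw [hg, hw]; ring
  have h3 : ∀ η, ft g η = R ^ Module.finrank ℝ E * ft ψ (-(R • η)) := fun η => by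
    have h4 := Measure.integral_comp_smul (volume : Measure E)
      (fun z => wave (R • η) z * ψ z) R⁻¹
    rw [ft, ft, ← integral_neg_eq_self, neg_neg]
    rw [inv_pow, inv_inv, abs_of_pos (by positivity), Complex.real_smul] at h4
    push_cast at h4
    rw [← h4]
    congr 1; ext z
    rw [wave_smul_left, smul_inv_smul₀ hR.ne', hg]
    simp only [neg_neg, wave, inner_neg_left, inner_neg_right]
  have h5 := Measure.integral_comp_smul (volume : Measure E)
    (fun y => ft ψ (-y) * f (x - R⁻¹ • y)) R
  rw [abs_of_pos (by positivity), Complex.real_smul, ← integral_sub_left_eq_self _ _ x] at h5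
  rw [h2, ← h1, conv]
  simp only [h3, mul_assoc]
  rw [integral_const_mul]
  simp only [inv_smul_smul₀ hR.ne', sub_sub_cancel] at h5
  rw [h5, ← mul_assoc]
  push_cast
  rw [mul_inv_cancel₀ (pow_ne_zero _ (Complex.ofReal_ne_zero.2 hR.ne')), one_mul]

/-- A summability version of Fourier inversion: `ft f` need not be integrable, but the cut-off
integral is an average of `f` at the scale `1 / R`. -/
theorem IsTest.tendsto_integral_dilate {ψ f : E → ℂ} (hψ : IsTest ψ) (hf : Continuous f)
    (hs : HasCompactSupport f) (x : E) {R : ℕ → ℝ} (hR : Tendsto (fun j => (R j)⁻¹) atTop (𝓝 0))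
    (hR0 : ∀ j, 0 < R j) :
    Tendsto (fun j => ∫ ξ, wave ξ x * ψ ((R j)⁻¹ • ξ) * ft f ξ) atTop
      (𝓝 ((invConst E : ℂ)⁻¹ * ψ 0 * f x)) := by
  obtain ⟨M, hM⟩ := hf.bounded_above_of_compact_support hs
  have hlim : (invConst E : ℂ)⁻¹ * ψ 0 * f x = ∫ y, ft ψ (-y) * f x := by
    rw [integral_mul_const, integral_neg_eq_self (ft ψ), ← hψ.ft_ft 0, ← mul_assoc,
      inv_mul_cancel₀ (Complex.ofReal_ne_zero.2 invConst_pos.ne'), one_mul, ft]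
    simp [wave_zero]
  rw [hlim]
  simp only [hψ.integral_dilate (hf.integrable_of_hasCompactSupport hs) (hR0 _)]
  refine tendsto_integral_of_dominated_convergence (fun y => ‖ft ψ (-y)‖ * M) (fun j => ?_) ?_
    (fun j => ae_of_all _ fun y => ?_) (ae_of_all _ fun y => ?_)
  · exact ((hψ.continuous_ft.comp continuous_neg).mul
      (hf.comp (by fun_prop))).aestronglyMeasurable
  · exact hψ.integrable_ft.comp_neg.norm.mul_const M
  · rw [norm_mul]; gcongr; exact hM _
  · refine tendsto_const_nhds.mul ((hf.tendsto x).comp ?_)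
    have := (hR.smul_const y).const_sub x
    simpa using this

end BandLimited

/-! ### Zygmund functions of integer order are almost Lipschitz to that order -/

section Zygmund

theorem sum_littlewoodPaley (ψ₀ : E3 → ℝ) (J : ℕ) (ξ : E3) :
    ∑ j ∈ Finset.range (J + 1), littlewoodPaley ψ₀ j ξ = ψ₀ (((2 : ℝ) ^ J)⁻¹ • ξ) := by
  induction J with
  | zero => simp [littlewoodPaley]
  | succ J ih => rw [Finset.sum_range_succ, ih, littlewoodPaley]; ring

variable {ψ₀ : E3 → ℝ} (hψ : IsLittlewoodPaley ψ₀)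
include hψ

theorem IsLittlewoodPaley.continuous (j : ℕ) : Continuous (littlewoodPaley ψ₀ j) := by
  have := hψ.1.continuous
  cases j <;> unfold littlewoodPaley <;> fun_prop

theorem IsLittlewoodPaley.eq_zero (j : ℕ) {ξ : E3} (hξ : 2 * (2 : ℝ) ^ j ≤ ‖ξ‖) :
    littlewoodPaley ψ₀ j ξ = 0 := by
  cases j with
  | zero => exact hψ.2.2 ξ (by simpa using hξ)
  | succ j =>
    rw [littlewoodPaley, hψ.2.2, hψ.2.2, sub_zero]
    · rw [norm_smul, norm_inv, norm_pow, Real.norm_ofNat, inv_mul_eq_div, le_div_iff₀ (by positivity)]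
      refine le_trans ?_ hξ
      gcongr <;> norm_num
    · rw [norm_smul, norm_inv, norm_pow, Real.norm_ofNat, inv_mul_eq_div, le_div_iff₀ (by positivity)]
      exact hξ

omit hψ in
theorem multiplier_eq_ft (ψ f : E3 → ℝ) (x : E3) :
    multiplier ψ f x = ft (fun ξ => ((2 * Real.pi) ^ (-3 : ℤ) : ℝ) * (ψ ξ * ft (fun y => (f y : ℂ)) ξ)) (-x) := by
  rw [multiplier, ft, ← integral_const_mul]
  congr 1; ext ξ
  change _ * (wave ξ x * _ * ft (fun y => (f y : ℂ)) ξ) = _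
  rw [neg_neg, wave_comm ξ x]; ring

/-- The Littlewood–Paley pieces have size `2 ^ (-j (n + 1))`, and by Bernstein each derivative costs
`2 ^ j`. Orders up to `n` thus decay at least like `2 ^ (-j)` and order `n + 1` is bounded, as
`locHol_tsum` requires. -/
theorem locHol_of_isZygmund {θ : ℝ} (hθ : 0 < θ) (hθ1 : θ < 1) {n : ℕ} {f : E3 → ℝ}
    (hf : Continuous f) (hs : HasCompactSupport f) {C : ℝ}
    (hC : ∀ (j : ℕ) (x : E3),
      (2 : ℝ) ^ ((j : ℝ) * (n + 1 : ℕ)) * ‖multiplier (littlewoodPaley ψ₀ j) f x‖ ≤ C) :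
    LocHol θ n univ f := by
  set c : ℝ := (2 * Real.pi) ^ (-3 : ℤ)
  have hc : 0 < c := by positivity
  have hfi : Integrable fun y => (f y : ℂ) := (hf.integrable_of_hasCompactSupport hs).ofReal
  have hF := continuous_ft hfi
  obtain ⟨L, hL, hB⟩ := exists_bernstein E3
  have hC0 : 0 ≤ C := (by positivity : (0 : ℝ) ≤ _).trans (hC 0 0)
  set g : ℕ → E3 → ℂ := fun j ξ => c * (littlewoodPaley ψ₀ j ξ * ft (fun y => (f y : ℂ)) ξ)
  have hg : ∀ j, Continuous (g j) := fun j =>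
    continuous_const.mul ((Complex.continuous_ofReal.comp (hψ.continuous j)).mul hF)
  have hg0 : ∀ j ξ, 2 * (2 : ℝ) ^ j ≤ ‖ξ‖ → g j ξ = 0 := fun j ξ hξ => by
    simp [g, hψ.eq_zero j hξ]
  have hgs : ∀ j, HasCompactSupport (g j) := fun j =>
    HasCompactSupport.intro (isCompact_closedBall 0 (2 * 2 ^ j))
      fun ξ hξ => hg0 j ξ (not_le.1 fun h => hξ (by simpa using h)).le
  set P : ℕ → E3 → ℂ := fun j x => ft (g j) (-x)
  have hPm : ∀ j x, P j x = multiplier (littlewoodPaley ψ₀ j) f x := fun j x =>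
    (multiplier_eq_ft _ _ _).symm
  have hPd : ∀ j, ContDiff ℝ ∞ (P j) := fun j => (contDiff_ft (hg j) (hgs j)).comp contDiff_neg
  have hP : ∀ j x, ‖P j x‖ ≤ C / ((2 : ℝ) ^ j) ^ (n + 1) := fun j x => by
    have := hC j x
    rw [Real.rpow_mul zero_le_two, Real.rpow_natCast, Real.rpow_natCast] at this
    rw [le_div_iff₀ (by positivity), mul_comm, hPm]
    exact this
  have hPk : ∀ k j x, ‖iteratedFDeriv ℝ k (P j) x‖ ≤
      ((2 : ℝ) ^ j * L) ^ k * (C / ((2 : ℝ) ^ j) ^ (n + 1)) := fun k j x =>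
    hB _ _ _ (by positivity) (hg j) (hg0 j) (hP j) k x
  have hL1 : 1 ≤ L + 1 := by linarith
  have hPk' : ∀ k ≤ n + 1, ∀ j x, ‖iteratedFDeriv ℝ k (P j) x‖ ≤
      (L + 1) ^ (n + 1) * C * ((2 : ℝ) ^ j) ^ k / ((2 : ℝ) ^ j) ^ (n + 1) := fun k hk j x => by
    refine (hPk k j x).trans ?_
    rw [mul_pow, ← mul_div_assoc, mul_comm (((2 : ℝ) ^ j) ^ k), mul_right_comm]
    have : L ^ k ≤ (L + 1) ^ (n + 1) :=
      (pow_le_pow_left₀ hL (by linarith) k).trans (pow_le_pow_right₀ hL1 hk)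
    gcongr
  have hH : LocHol θ n univ fun x => ∑' j, P j x := by
    refine locHol_tsum hθ hθ1 hPd (C := (L + 1) ^ (n + 1) * C) (fun k hk j x => ?_) fun j x => ?_
    · refine (hPk' k (by omega) j x).trans ?_
      have h1 : ((2 : ℝ) ^ j) ^ k ≤ ((2 : ℝ) ^ j) ^ n :=
        pow_le_pow_right₀ (one_le_pow₀ (by norm_num)) hk
      rw [mul_div_assoc, one_div, inv_pow]
      gcongr
      rw [div_le_iff₀ (by positivity), pow_succ, mul_comm, mul_assoc, mul_inv_cancel₀ (by positivity),
        mul_one]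
      exact h1
    · refine (hPk' (n + 1) le_rfl j x).trans (le_of_eq ?_)
      rw [mul_div_assoc, div_self (by positivity), mul_one]
  have hsum : ∀ x, Summable fun j => P j x := fun x => by
    have h2 : Summable fun j : ℕ => C * (1 / 2 : ℝ) ^ j :=
      (summable_geometric_of_lt_one (by norm_num) (by norm_num)).mul_left C
    refine Summable.of_norm_bounded h2 fun j => (hP j x).trans ?_
    rw [div_eq_mul_inv, one_div, inv_pow]
    gcongr
    exact le_self_pow₀ (one_le_pow₀ (by norm_num)) (by omega)
  set ψ : E3 → ℂ := fun ξ => (ψ₀ ξ : ℂ)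
  have hψt : IsTest ψ := ⟨Complex.ofRealCLM.contDiff.comp hψ.1,
    HasCompactSupport.intro (isCompact_closedBall 0 2) fun ξ hξ => by
      simp [ψ, hψ.2.2 ξ (not_le.1 fun h => hξ (by simpa using h)).le]⟩
  have hfs : HasCompactSupport fun y => (f y : ℂ) := hs.comp_left Complex.ofReal_zero
  -- The pieces telescope to a dilate of `ψ₀`, whose multipliers converge to a multiple of `f`. The
  -- value of the multiple is not needed, only that it is nonzero.
  have heq : ∀ x, ∑' j, P j x = c * ((invConst E3 : ℂ)⁻¹ * f x) := fun x => by
    have h1 := ((hsum x).hasSum.tendsto_sum_nat).comp (tendsto_add_atTop_nat 1)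
    have h2 := (hψt.tendsto_integral_dilate (f := fun y => (f y : ℂ))
      (Complex.continuous_ofReal.comp hf) hfs x (R := fun j => (2 : ℝ) ^ j)
      (tendsto_inv_atTop_zero.comp (tendsto_pow_atTop_atTop_of_one_lt one_lt_two))
      (fun j => by positivity)).const_mul (c : ℂ)
    have h0 : ψ 0 = 1 := by simp [ψ, hψ.2.1 0 (by simp)]
    rw [h0, mul_one] at h2
    refine tendsto_nhds_unique h1 (h2.congr fun J => ?_)
    simp only [Function.comp_apply]
    have hint : ∀ j, Integrable fun ξ => wave (- -x) ξ * g j ξ := fun j =>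
      integrable_wave_mul ((hg j).integrable_of_hasCompactSupport (hgs j)) _
    change _ = ∑ j ∈ Finset.range (J + 1), ∫ ξ, wave (- -x) ξ * g j ξ
    rw [← integral_finsetSum _ fun j _ => hint j, ← integral_const_mul]
    congr 1; ext ξ
    simp only [g, ← Finset.mul_sum, ← Finset.sum_mul, ψ]
    rw [← Complex.ofReal_sum, sum_littlewoodPaley, neg_neg, wave_comm ξ x]
    ring
  have hκ : (c : ℂ) * (invConst E3 : ℂ)⁻¹ ≠ 0 := mul_ne_zero (Complex.ofReal_ne_zero.2 hc.ne')
    (inv_ne_zero (Complex.ofReal_ne_zero.2 invConst_pos.ne'))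
  have hfin := hH.clm isOpen_univ (Complex.reCLM ∘L
    ContinuousLinearMap.mul ℝ ℂ ((c : ℂ) * (invConst E3 : ℂ)⁻¹)⁻¹)
  refine hfin.congr isOpen_univ fun x _ => ?_
  change (((c : ℂ) * (invConst E3 : ℂ)⁻¹)⁻¹ * ∑' j, P j x).re = f x
  rw [heq, ← mul_assoc (c : ℂ), inv_mul_cancel_left₀ hκ, Complex.ofReal_re]

end Zygmund

end KleinGordon

namespace KleinGordon

/-! ### Determinants and inverses of Hölder matrices -/

section LocalHolderAlgebra

variable {E : Type} [NormedAddCommGroup E] [NormedSpace ℝ E] {V : Type} [NormedAddCommGroup V]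
  [NormedSpace ℝ V] {θ : ℝ} {n : ℕ} {U : Set E}

/-- The condition only involves germs at the points of `U`, so it can be checked with a different
cut-off at each point. -/
theorem locHol_of_forall_singleton {F : E → V} (h : ∀ x ∈ U, LocHol θ n {x} F) : LocHol θ n U F := by
  induction n generalizing V with
  | zero => exact fun x hx => h x hx x rfl
  | succ n ih => exact ⟨fun x hx => (h x hx).1 x rfl, ih fun x hx => (h x hx).2⟩

theorem locHol_const (hθ1 : θ ≤ 1) (hU : IsOpen U) (c : V) : LocHol θ n U fun _ => c :=
  locHol_of_contDiffOn hθ1 hU contDiffOn_const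

theorem LocHol.sub (hU : IsOpen U) {F G : E → V} (hF : LocHol θ n U F) (hG : LocHol θ n U G) :
    LocHol θ n U fun x => F x - G x :=
  (hF.add hU (hG.clm hU (-ContinuousLinearMap.id ℝ V))).congr hU fun _ _ =>
    (sub_eq_add_neg _ _).symm

theorem LocHol.det (hθ : 0 < θ) (hθ1 : θ ≤ 1) (hU : IsOpen U) {A : E → Matrix (Fin 3) (Fin 3) ℝ}
    (hA : ∀ i j, LocHol θ n U fun x => A x i j) : LocHol θ n U fun x => (A x).det := by
  have m3 : ∀ i j k l p q, LocHol θ n U fun x => A x i j * A x k l * A x p q := fun i j k l p q =>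
    LocHol.mul hθ hθ1 hU (LocHol.mul hθ hθ1 hU (hA i j) (hA k l)) (hA p q)
  simp only [Matrix.det_fin_three]
  exact ((((((m3 0 0 1 1 2 2).sub hU (m3 0 0 1 2 2 1)).sub hU (m3 0 1 1 0 2 2)).add hU
    (m3 0 1 1 2 2 0)).add hU (m3 0 2 1 0 2 1)).sub hU (m3 0 2 1 1 2 0))

theorem LocHol.matrix_inv (hθ : 0 < θ) (hθ1 : θ ≤ 1) (hU : IsOpen U)
    {A : E → Matrix (Fin 3) (Fin 3) ℝ} (hA : ∀ i j, LocHol θ n U fun x => A x i j)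
    (hd : ∀ x ∈ U, (A x).det ≠ 0) (i j : Fin 3) : LocHol θ n U fun x => (A x)⁻¹ i j := by
  have h1 : LocHol θ n U fun x => ((A x).det)⁻¹ :=
    (LocHol.det hθ hθ1 hU hA).scomp hθ hθ1 hU (T := {0}ᶜ) isOpen_compl_singleton
      (contDiffOn_id.inv fun x hx => hx) hd
  have h2 : LocHol θ n U fun x => (A x).adjugate i j := by
    simp only [Matrix.adjugate_apply]
    refine LocHol.det hθ hθ1 hU fun k l => ?_
    by_cases hk : k = j
    · simp only [hk, Matrix.updateRow_self]
      exact locHol_const hθ1 hU _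
    · simp only [Matrix.updateRow_ne hk]
      exact hA k l
  refine (LocHol.mul hθ hθ1 hU h1 h2).congr hU fun x _ => ?_
  simp [Matrix.inv_def, Ring.inverse_eq_inv']

end LocalHolderAlgebra

/-! ### From the class `C^τ` to local Hölder classes -/

section HolderZygmund

/-- For non-integer `τ` the Hölder exponents are exact. For integer `τ = n + 2` any `θ < 1` is
available, and `θ > 1 - δ` keeps the loss below `δ`. As `τ > 1`, at least one derivative always
exists, which the first order coefficients consume. -/
theorem exists_locHol_of_isClass {τ : ℝ} (hτ : 1 < τ) {δ : ℝ} (hδ : 0 < δ) :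
    ∃ (n : ℕ) (θ : ℝ), 0 < θ ∧ θ ≤ 1 ∧ τ - δ < (n + 1 : ℕ) + θ ∧ (n + 1 : ℕ) + θ ≤ τ ∧
      ∀ f : E3 → ℝ, Continuous f → HasCompactSupport f → IsClass τ f → LocHol θ (n + 1) univ f := by
  by_cases hN : ∃ N : ℕ, (N : ℝ) = τ
  · obtain ⟨N, rfl⟩ := hN
    obtain ⟨n, rfl⟩ : ∃ n, N = n + 1 + 1 := ⟨N - 2, by
      have : 1 < N := by exact_mod_cast hτ
      omega⟩
    obtain ⟨θ, h1, h2⟩ := exists_between (show max 0 (1 - δ) < 1 by simp [hδ])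
    rw [max_lt_iff] at h1
    refine ⟨n, θ, h1.1, h2.le, by push_cast; linarith, by push_cast; linarith, fun f hf hs hc => ?_⟩
    obtain ⟨ψ₀, hψ, C, hC⟩ := hc.1 ⟨_, rfl⟩
    exact locHol_of_isZygmund hψ h1.1 h2 hf hs hC
  · have h0 : (⌊τ⌋₊ : ℝ) ≤ τ := Nat.floor_le (by linarith)
    have h1 : τ < ⌊τ⌋₊ + 1 := Nat.lt_floor_add_one τ
    have h2 : (⌊τ⌋₊ : ℝ) ≠ τ := fun h => hN ⟨_, h⟩
    obtain ⟨n, hn⟩ : ∃ n, ⌊τ⌋₊ = n + 1 := ⟨⌊τ⌋₊ - 1, by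
      have : 1 ≤ ⌊τ⌋₊ := Nat.le_floor (by exact_mod_cast hτ.le)
      omega⟩
    refine ⟨n, τ - ⌊τ⌋₊, sub_pos.2 (lt_of_le_of_ne h0 h2), by linarith, by rw [← hn]; linarith,
      by rw [← hn]; linarith, fun f hf hs hc => ?_⟩
    obtain ⟨a, -, C, hC⟩ := hc.2 hN
    rw [← hn]
    exact locHol_of_iteratedFDeriv a hC

theorem IsClassLoc.locHol {τ θ : ℝ} {n : ℕ} {U : Set E3} (hU : IsOpen U)
    (H : ∀ f : E3 → ℝ, Continuous f → HasCompactSupport f → IsClass τ f → LocHol θ n univ f)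
    {f : E3 → ℝ} (hf : ContinuousOn f U) (h : IsClassLoc τ U f) : LocHol θ n U f := by
  refine locHol_of_forall_singleton fun x hx => ?_
  obtain ⟨r, hr, hball⟩ := Metric.isOpen_iff.1 hU x hx
  let χ : ContDiffBump x := ⟨r / 4, r / 2, by positivity, by linarith⟩
  have hsub : tsupport χ ⊆ U := by
    rw [χ.tsupport_eq]
    exact (Metric.closedBall_subset_ball (by show r / 2 < r; linarith)).trans hball
  have hsub' : tsupport (fun y => χ y * f y) ⊆ tsupport χ := tsupport_mul_subset_left
  have h1 := H (fun y => χ y * f y)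
    (continuous_of_tsupport fun y hy => χ.continuous.continuousAt.mul
      (hf.continuousAt (hU.mem_nhds (hsub (hsub' hy)))))
    χ.hasCompactSupport.mul_right (h χ χ.contDiff χ.hasCompactSupport hsub)
  refine ((h1.mono_set (subset_univ (Metric.ball x (r / 4)))).congr Metric.isOpen_ball
    fun y hy => ?_).mono_set (singleton_subset_iff.2 (Metric.mem_ball_self (by positivity)))
  rw [χ.one_of_mem_closedBall (Metric.ball_subset_closedBall hy), one_mul]

end HolderZygmund

/-! ### Regularity of the coefficients of the Klein-Gordon operator -/

section Coefficients

variable {S : Type*} [TopologicalSpace S] [ChartedSpace E3 S] [IsManifold 𝓘(ℝ, E3) ∞ S]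
  {h : Metric S} {e : Chart S} {θ : ℝ} {n : ℕ}

theorem locHol_invMetric (hθ : 0 < θ) (hθ1 : θ ≤ 1)
    (hA : ∀ i j, LocHol θ n e.1.target fun u => metricMatrix h e u i j) (i j : Fin 3) :
    LocHol θ n e.1.target fun u => invMetric h e u i j :=
  LocHol.matrix_inv hθ hθ1 e.1.open_target hA (fun _ hu => (posDef_metricMatrix h e hu).det_pos.ne')
    i j

theorem contDiffOn_sqrt : ContDiffOn ℝ ∞ Real.sqrt (Ioi 0) := fun _ hx =>
  (Real.contDiffAt_sqrt (ne_of_gt hx)).contDiffWithinAt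

theorem locHol_volDensity (hθ : 0 < θ) (hθ1 : θ ≤ 1)
    (hA : ∀ i j, LocHol θ n e.1.target fun u => metricMatrix h e u i j) :
    LocHol θ n e.1.target (volDensity h e) :=
  (LocHol.det hθ hθ1 e.1.open_target hA).scomp hθ hθ1 e.1.open_target isOpen_Ioi contDiffOn_sqrt
    fun _ hu => (posDef_metricMatrix h e hu).det_pos

theorem locHol_firstOrderCoeff (hθ : 0 < θ) (hθ1 : θ ≤ 1)
    (hA : ∀ i j, LocHol θ (n + 1) e.1.target fun u => metricMatrix h e u i j) (j : Fin 3) :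
    LocHol θ n e.1.target fun u => firstOrderCoeff h e u j := by
  have hU := e.1.open_target
  have h1 : LocHol θ n e.1.target fun u => (volDensity h e u)⁻¹ :=
    ((locHol_volDensity hθ hθ1 hA).of_succ hθ hθ1 hU).scomp hθ hθ1 hU isOpen_Ioi
      (contDiffOn_id.inv fun x hx => ne_of_gt hx)
      fun u hu => Real.sqrt_pos.2 (posDef_metricMatrix h e hu).det_pos
  have h2 : ∀ i : Fin 3, LocHol θ n e.1.target fun u =>
      fderiv ℝ (fun w => invMetric h e w i j * volDensity h e w) u
        (EuclideanSpace.single i (1 : ℝ)) := fun i =>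
    (LocHol.mul hθ hθ1 hU (locHol_invMetric hθ hθ1 hA i j) (locHol_volDensity hθ hθ1 hA)).2.clm hU
      (ContinuousLinearMap.apply ℝ ℝ (EuclideanSpace.single i (1 : ℝ)))
  refine LocHol.mul hθ hθ1 hU h1 ?_
  simp only [Fin.sum_univ_three]
  exact ((h2 0).add hU (h2 1)).add hU (h2 2)

/-- The projection to the space variables of the first factor as a linear map. -/
def space1L : E8 →L[ℝ] E3 where
  toFun := space1
  map_add' _ _ := rfl
  map_smul' _ _ := rfl
  cont := continuous_space1

omit [IsManifold 𝓘(ℝ, E3) ∞ S] in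
theorem locHol_comp_space1 (hθ : 0 < θ) (e₂ : Chart S) {f : E3 → ℝ}
    (hf : LocHol θ n e.1.target f) :
    LocHol θ n (chartDomain e e₂ : Set E8) fun z => (f (space1 z) : ℂ) :=
  ((hf.comp_clm hθ e.1.open_target space1L).clm
    (e.1.open_target.preimage space1L.continuous) Complex.ofRealCLM).mono_set fun _ hz => hz.1

variable (h e)

/-- The coefficients of the second order part of the Klein-Gordon operator. -/
def secondOrder : (Fin 4 ⊕ Fin 4) × (Fin 4 ⊕ Fin 4) → E8 → ℂ
  | (Sum.inl μ, Sum.inl ν), z => Fin.cases (Fin.cases (-1) (fun _ => 0) ν)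
      (fun i => Fin.cases 0 (fun j => (invMetric h e (space1 z) i j : ℂ)) ν) μ
  | _, _ => 0

/-- The coefficients of the first order part of the symbol of the Klein-Gordon operator. -/
def firstOrder : Fin 4 ⊕ Fin 4 → E8 → ℂ
  | Sum.inl μ, z => Fin.cases 0 (fun j => -Complex.I * (firstOrderCoeff h e (space1 z) j : ℂ)) μ
  | _, _ => 0

theorem symbol_eq (m : ℝ) (z ζ : E8) :
    symbol h m e z ζ = ∑ i, secondOrder h e i z * ((ζ i.1 : ℂ) * (ζ i.2 : ℂ)) +
      ∑ μ, firstOrder h e μ z * (ζ μ : ℂ) + ((m ^ 2 : ℝ) : ℂ) := by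
  simp only [symbol, Fintype.sum_prod_type, Fintype.sum_sum_type, secondOrder, firstOrder,
    Fin.sum_univ_succ (n := 3), Fin.cases_zero, Fin.cases_succ, space1, zero_mul,
    Finset.sum_const_zero, add_zero, zero_add, Complex.ofReal_add, Complex.ofReal_neg,
    Complex.ofReal_sum, Complex.ofReal_mul, neg_mul, Finset.sum_neg_distrib,
    Finset.mul_sum, one_mul, sub_eq_add_neg, mul_assoc, sq]

/-- The principal part does not involve the covariables of the second factor, so the direction `ds`
is characteristic at every base point. -/
theorem secondOrder_single_inr (z : E8) (r : ℝ) :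
    ∑ i, secondOrder h e i z * ((EuclideanSpace.single (Sum.inr 0) r : E8) i.1 *
      ((EuclideanSpace.single (Sum.inr 0) r : E8) i.2 : ℂ)) = 0 := by
  simp [Fintype.sum_prod_type, Fintype.sum_sum_type, secondOrder]

variable {h e}

theorem locHol_secondOrder (hθ : 0 < θ) (hθ1 : θ ≤ 1) (e₂ : Chart S)
    (hA : ∀ i j, LocHol θ n e.1.target fun u => metricMatrix h e u i j) (i) :
    LocHol θ n (chartDomain e e₂ : Set E8) (secondOrder h e i) := by
  have hc : ∀ c : ℂ, LocHol θ n (chartDomain e e₂ : Set E8) fun _ => c :=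
    locHol_const hθ1 (chartDomain e e₂).isOpen
  obtain ⟨μ | μ, ν | ν⟩ := i
  · cases μ using Fin.cases with
    | zero => cases ν using Fin.cases with
      | zero => exact hc _
      | succ j => exact hc _
    | succ i => cases ν using Fin.cases with
      | zero => exact hc _
      | succ j => exact locHol_comp_space1 hθ e₂ (locHol_invMetric hθ hθ1 hA i j)
  all_goals exact hc 0

theorem locHol_firstOrder (hθ : 0 < θ) (hθ1 : θ ≤ 1) (e₂ : Chart S)
    (hA : ∀ i j, LocHol θ (n + 1) e.1.target fun u => metricMatrix h e u i j) (μ) :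
    LocHol θ n (chartDomain e e₂ : Set E8) (firstOrder h e μ) := by
  have hO := (chartDomain e e₂).isOpen
  obtain μ | μ := μ
  · cases μ using Fin.cases with
    | zero => exact locHol_const hθ1 hO (0 : ℂ)
    | succ j =>
      exact (locHol_comp_space1 hθ e₂ (locHol_firstOrderCoeff hθ hθ1 hA j)).clm hO
        (ContinuousLinearMap.mul ℝ ℂ (-Complex.I))
  · exact locHol_const hθ1 hO (0 : ℂ)

end Coefficients

/-! ### Non-characteristic points -/

section NonCharacteristic

/-- Along a ray, lower order terms grow at most linearly, so a quadratic lower bound forces the form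
to be nonzero. The definition does not itself exclude `ζ₀ = 0`; but then the open set would contain
small covectors in a direction where the form vanishes. -/
theorem IsNonChar.ne_zero {Ω : Opens E8} {p : E8 → E8 → ℂ}
    {a : (Fin 4 ⊕ Fin 4) × (Fin 4 ⊕ Fin 4) → E8 → ℂ} {b : Fin 4 ⊕ Fin 4 → E8 → ℂ} {c₀ : ℂ}
    (hp : ∀ z ζ, p z ζ = ∑ i, a i z * ((ζ i.1 : ℂ) * (ζ i.2 : ℂ)) + ∑ μ, b μ z * (ζ μ : ℂ) + c₀)
    {z₀ ζ₀ : E8} (ha : ∀ r : ℝ, ∑ i, a i z₀ * ((EuclideanSpace.single (Sum.inr 0) r : E8) i.1 *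
      ((EuclideanSpace.single (Sum.inr 0) r : E8) i.2 : ℂ)) = 0) (h : IsNonChar Ω p z₀ ζ₀) :
    z₀ ∈ Ω ∧ ζ₀ ≠ 0 ∧ ∑ i, a i z₀ * ((ζ₀ i.1 : ℂ) * (ζ₀ i.2 : ℂ)) ≠ 0 := by
  obtain ⟨Γ, c, C, hc, hC, hΓ, hmem, hΩ, hcone, hlow⟩ := h
  have key : ∀ ζ : E8, (z₀, ζ) ∈ Γ → ζ ≠ 0 →
      ∑ i, a i z₀ * ((ζ i.1 : ℂ) * (ζ i.2 : ℂ)) ≠ 0 := fun ζ hζ h0 hz => by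
    set B := ‖∑ μ, b μ z₀ * (ζ μ : ℂ)‖
    have hn : 0 < ‖ζ‖ := norm_pos_iff.2 h0
    -- Large enough for the lower bound to apply at `l • ζ` and for the quadratic term to exceed all
    -- lower order ones.
    set l : ℝ := max (max 1 (C / ‖ζ‖)) ((B + ‖c₀‖ + 1) / (c * ‖ζ‖ ^ 2))
    have l1 : 1 ≤ l := (le_max_left _ _).trans (le_max_left _ _)
    have l2 : C / ‖ζ‖ ≤ l := (le_max_right _ _).trans (le_max_left _ _)
    have l3 : (B + ‖c₀‖ + 1) / (c * ‖ζ‖ ^ 2) ≤ l := le_max_right _ _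
    rw [div_le_iff₀ hn] at l2
    rw [div_le_iff₀ (by positivity)] at l3
    have hl : 0 < l := by linarith
    have h1 := hlow _ (hcone _ hζ l hl)
    simp only [norm_smul, Real.norm_of_nonneg hl.le] at h1
    have h2 := h1 l2
    have h3 : p z₀ (l • ζ) = l * ∑ μ, b μ z₀ * (ζ μ : ℂ) + c₀ := by
      rw [hp]
      have e1 : ∑ i, a i z₀ * (((l • ζ) i.1 : ℂ) * ((l • ζ) i.2 : ℂ)) =
          l ^ 2 * ∑ i, a i z₀ * ((ζ i.1 : ℂ) * (ζ i.2 : ℂ)) := by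
        rw [Finset.mul_sum]
        refine Finset.sum_congr rfl fun i _ => ?_
        simp only [PiLp.smul_apply, smul_eq_mul, Complex.ofReal_mul]; ring
      rw [e1, hz, mul_zero, zero_add, Finset.mul_sum]
      congr 1
      refine Finset.sum_congr rfl fun i _ => ?_
      simp only [PiLp.smul_apply, smul_eq_mul, Complex.ofReal_mul]; ring
    have h4 : ‖p z₀ (l • ζ)‖ ≤ l * B + ‖c₀‖ := by
      rw [h3]
      refine (norm_add_le _ _).trans (le_of_eq ?_)
      rw [norm_mul, Complex.norm_real, Real.norm_of_nonneg hl.le]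
    have hB : 0 ≤ B := norm_nonneg _
    have hc₀ : 0 ≤ ‖c₀‖ := norm_nonneg _
    have h5 : l * (B + ‖c₀‖ + 1) ≤ c * (l * ‖ζ‖) ^ 2 := by
      calc l * (B + ‖c₀‖ + 1) ≤ l * (l * (c * ‖ζ‖ ^ 2)) := by gcongr
        _ = _ := by ring
    have h6 : ‖c₀‖ ≤ l * ‖c₀‖ := le_mul_of_one_le_left hc₀ l1
    nlinarith
  have hζ₀ : ζ₀ ≠ 0 := fun h0 => by
    have hcont : Continuous fun r : ℝ => (z₀, (EuclideanSpace.single (Sum.inr 0) r : E8)) := by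
      refine continuous_const.prodMk ?_
      exact (PiLp.continuous_toLp 2 _).comp
        (continuous_single (A := fun _ : Fin 4 ⊕ Fin 4 => ℝ) (Sum.inr 0))
    have hn : (fun r : ℝ => (z₀, (EuclideanSpace.single (Sum.inr 0) r : E8))) ⁻¹' Γ ∈ 𝓝 (0 : ℝ) :=
      hcont.continuousAt (hΓ.mem_nhds (by
        rw [h0] at hmem
        convert hmem using 2
        ext i; simp))
    obtain ⟨r, hr, hball⟩ := Metric.mem_nhds_iff.1 hn
    refine key _ (hball (show r / 2 ∈ Metric.ball 0 r from ?_)) ?_ (ha _)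
    · rw [Metric.mem_ball, dist_zero_right, Real.norm_of_nonneg (by positivity)]
      linarith
    · intro h
      have := congrArg (fun ζ : E8 => ζ (Sum.inr 0)) h
      simp [hr.ne'] at this
  exact ⟨hΩ _ hmem, hζ₀, key ζ₀ hmem hζ₀⟩

end NonCharacteristic

end KleinGordon

namespace KleinGordon

/-! ### Conclusion -/

section Microlocal

theorem integrable_sobolevDensity_mono {Ω : Opens E8} {s s' : ℝ} (hs : s ≤ s')
    {u : 𝓓(Ω, ℂ) →L[ℂ] ℂ} {φ : 𝓓(Ω, ℂ)} (h : Integrable (sobolevDensity s' u φ)) :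
    Integrable (sobolevDensity s u φ) := by
  have heq : sobolevDensity s u φ =
      fun ξ => (1 + ‖ξ‖ ^ 2) ^ (s - s') * sobolevDensity s' u φ ξ := by
    ext ξ
    rw [sobolevDensity, sobolevDensity, ← mul_assoc, ← Real.rpow_add (by positivity),
      sub_add_cancel]
  rw [heq]
  refine h.bdd_mul (c := 1) ?_ (ae_of_all _ fun ξ => ?_)
  · exact (Measurable.aestronglyMeasurable (by fun_prop))
  · rw [Real.norm_of_nonneg (by positivity)]
    exact Real.rpow_le_one_of_one_le_of_nonpos (by nlinarith [sq_nonneg ‖ξ‖]) (by linarith)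

/-- The strict inequality `r < r'` turns shell bounds into a convergent integral. -/
theorem isMicrolocal_of_hasGrowth {Ω : Opens E8} {u : 𝓓(Ω, ℂ) →L[ℂ] ℂ} {r r' δ : ℝ} {z₀ ζ₀ : E8}
    (hr0 : 0 ≤ r) (hr : r < r') (hδ : 0 < δ) (hζ₀ : ζ₀ ≠ 0) {ψ : E8 → ℂ} (hψ : IsTest ψ)
    (hs : tsupport ψ ⊆ Ω) (hψ₀ : ψ z₀ ≠ 0) (hm : Measurable (localFT u ψ))
    (hg : HasGrowth r' (cone ζ₀ δ) (localFT u ψ)) : IsMicrolocal r u z₀ ζ₀ := by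
  refine ⟨hψ.toTestFunction hs, cone ζ₀ δ, hψ₀, isOpen_cone _ _, mem_cone hζ₀ hδ,
    fun ζ hζ a ha => smul_mem_cone hζ ha, ?_⟩
  have h1 := hg.integrableOn (isOpen_cone ζ₀ δ).measurableSet hm hr
  rw [localFT_eq hψ hs] at h1 hm
  refine h1.mono' ?_ (ae_of_all _ fun ζ => ?_)
  · unfold sobolevDensity
    exact Measurable.aestronglyMeasurable (by fun_prop)
  · have hn := norm_nonneg ζ
    rw [sobolevDensity, Real.norm_of_nonneg (by positivity), mul_pow]
    gcongr
    calc (1 + ‖ζ‖ ^ 2) ^ r ≤ ((1 + ‖ζ‖) ^ 2) ^ r := by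
          gcongr
          nlinarith
      _ = ((1 + ‖ζ‖) ^ r) ^ 2 := by
          rw [← Real.rpow_natCast, ← Real.rpow_natCast, ← Real.rpow_mul (by positivity),
            ← Real.rpow_mul (by positivity), mul_comm]

variable {S : Type*} [TopologicalSpace S] [ChartedSpace E3 S] [IsManifold 𝓘(ℝ, E3) ∞ S]

theorem isMicrolocal_of_isNonChar {h : Metric S} {m τ σ ε : ℝ} (hτ : 1 < τ) (hh : h.HasClass τ)
    (hσ : 0 ≤ σ) (hστ : σ < τ - 1) (hε : 0 < ε) {e₁ e₂ : Chart S}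
    {u : 𝓓(chartDomain e₁ e₂, ℂ) →L[ℂ] ℂ}
    (hu : ∀ φ, Integrable (sobolevDensity (2 + σ - τ + ε) u φ))
    (heq : ∀ φ χ : 𝓓(chartDomain e₁ e₂, ℂ), (∀ᶠ z in 𝓝ˢ (tsupport φ), χ z = 1) →
      ((2 * Real.pi) ^ (-4 : ℤ) : ℝ) *
        (∫ ζ : E8, fourierLoc u χ ζ * ∫ z : E8, planeWave ζ z * symbol h m e₁ z ζ * φ z) = 0)
    {z₀ ζ₀ : E8} (hnc : IsNonChar (chartDomain e₁ e₂) (symbol h m e₁) z₀ ζ₀) :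
    IsMicrolocal (σ + 2) u z₀ ζ₀ := by
  obtain ⟨hz₀, hζ₀, hell⟩ := hnc.ne_zero (symbol_eq h e₁ m) (secondOrder_single_inr h e₁ z₀)
  -- Lowering `ε` to `ε' < τ - 1 - σ` gives the order `s = 2 + σ - τ + ε' < 1`, so that first
  -- derivatives have negative order. A loss of `ε' / 2` in the coefficients still leaves `s + t > σ
  -- + 2 ≥ 2`, as needed for the products and for the conclusion.
  obtain ⟨ε', hε'0, hε'⟩ := exists_between (show 0 < min ε (τ - 1 - σ) from lt_min hε (by linarith))
  rw [lt_min_iff] at hε'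
  obtain ⟨n, θ, hθ, hθ1, hlow, -, H⟩ := exists_locHol_of_isClass hτ (half_pos hε'0)
  have hA : ∀ i j, LocHol θ (n + 1) e₁.1.target fun v => metricMatrix h e₁ v i j := fun i j =>
    (hh e₁ i j).locHol e₁.1.open_target H (continuousOn_metricMatrix h e₁ i j)
  have hst : σ + 2 < 2 + σ - τ + ε' + ((n + 1 : ℕ) + θ) := by linarith
  have hsol := isLocalSolution_localFT hθ hθ1 (by linarith)
    (fun φ => integrable_sobolevDensity_mono (by linarith : 2 + σ - τ + ε' ≤ _) (hu φ))
    (symbol_eq h e₁ m) (locHol_secondOrder hθ hθ1 e₂ hA) (locHol_firstOrder hθ hθ1 e₂ hA) heq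
  obtain ⟨δ, ρ, hδ, hρ, hball, hgrowth⟩ := hsol.exists_hasGrowth (chartDomain e₁ e₂).isOpen hθ hθ1
    (locHol_secondOrder hθ hθ1 e₂ hA) (locHol_firstOrder hθ hθ1 e₂ hA) (by linarith)
    (by linarith) hz₀ hζ₀ hell
  obtain ⟨χ, hχ, -, hχ1, hχs⟩ := exists_bump z₀ hρ
  refine isMicrolocal_of_hasGrowth (by linarith) hst hδ hζ₀ hχ (hχs.trans hball) ?_
    (hsol.measurable χ hχ (hχs.trans hball)) (hgrowth χ hχ hχs)
  rw [hχ1 z₀ (Metric.mem_ball_self (half_pos hρ))]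
  exact one_ne_zero

end Microlocal

end KleinGordon

end

/-- Both sets are complements of conditions imposed in every pair of charts around the base point,
so the inclusion is checked in one pair of charts at a time. -/
theorem theorem3p3 {S : Type*} [TopologicalSpace S] [T2Space S] [CompactSpace S]
    [ChartedSpace KleinGordon.E3 S]
    [IsManifold (modelWithCornersSelf ℝ KleinGordon.E3) ((⊤ : ℕ∞) : WithTop ℕ∞) S]
    (h : KleinGordon.Metric S) (m : ℝ) (hm : 0 < m)
    (τ : ℝ) (hτ : 1 < τ) (hh : h.HasClass τ)
    (σ : ℝ) (hσ : 0 ≤ σ) (hστ : σ < τ - 1)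
    (ε : ℝ) (hε : 0 < ε)
    (v : KleinGordon.BiDistribution S) (hv : v.IsSobolevLoc (2 + σ - τ + ε))
    (hP : v.SolvesKleinGordon h m) :
    KleinGordon.waveFront (σ + 2) v ⊆ KleinGordon.charSet h m := by
  intro w hw
  refine ⟨hw.1, fun hnc => hw.2 fun e₁ e₂ h₁ h₂ => ?_⟩
  exact KleinGordon.isMicrolocal_of_isNonChar hτ hh hσ hστ hε (hv e₁ e₂) (hP e₁ e₂) (hnc e₁ e₂ h₁ h₂)
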